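/- Let $\mathcal S_N$ be the space of real symmetric $N\times N$ matrices, let $O(N)$ act on it by $U\mapsto OUO^t$, and put $N^*=N(N+1)/2$. **(Finite $N$.)** For every $\Delta>0$ let $\mu_\Delta$ be an $O(N)$-invariant probability measure on $\mathcal S_N$, and let $L_N$ be a (complex-valued) function of the invariants $\{\operatorname{tr}J^{2p}\}_{p\ge1}$ such that, for all $\Delta>0$ and all $J\in\mathcal S_N$, $$e^{-\Delta L_N(\{\operatorname{tr}J^{2p}\}_p)}=\int_{\mathcal S_N}e^{i\operatorname{tr}(JU)}\,d\mu_\Delta(U).$$ Let $\sigma$ be a nonnegative Borel measure on $\mathcal S_N$ such that $$\lim_{\Delta\to0^+}\Delta^{-1}\int_{\operatorname{tr}U^2>\Delta}f\,d\mu_\Delta=\int_{\operatorname{tr}U^2>0}f\,d\sigma$$ for every continuous $f$ with compact support in $\{\operatorname{tr}U^2>0\}$, each such $f$ being $\sigma$-integrable there. Then $\sigma$ restricted to $\{\operatorname{tr}U^2>0\}$ is $O(N)$-invariant, $$\int_{\operatorname{tr}U^2>0}\frac{\operatorname{tr}U^2}{1+\operatorname{tr}U^2}\,d\sigma(U)<\infty,$$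 and there is a constant $a\ge0$ such that for all $J\in\mathcal S_N$ $$L_N(\{\operatorname{tr}J^{2p}\}_p)=a\operatorname{tr}J^2+\int_{\operatorname{tr}U^2>0}\bigl(1-e^{i\operatorname{tr}(JU)}\bigr)\,d\sigma(U),$$ where the integral is understood as $\lim_{\varepsilon\to0^+}\int_{\operatorname{tr}U^2>\varepsilon}$ (these integrals converge absolutely), and equals the absolutely convergent integral $\int_{\operatorname{tr}U^2>0}\bigl(1-\cos\operatorname{tr}(JU)\bigr)\,d\sigma(U)$. **($N=\infty$.)** For every $\Delta>0$ and every $N$ let $\mu_{\Delta,N}$ be an $O(N)$-invariant probability measure on $\mathcal S_N$. Suppose that for each $\Delta>0$, as $N\to\infty$, the law of $b=\operatorname{tr}U^2/(2N^*)$ under $\mu_{\Delta,N}$ converges weakly to a probability measure $\mu_\Delta(db)$, and $\operatorname{tr}U^4/(N^*)^2\to0$ in $\mu_{\Delta,N}$-probability. Let $L_\infty$ be a (complex-valued) function of $\{\operatorname{tr}J^{2p}\}_{p\ge1}$ such that, for all $\Delta>0$ and every infinite real symmetric matrix $J=(J_{ab})_{a,b\in\mathbb N}$ with $\operatorname{tr}J^2=\sum_{a,b}J_{ab}^2<\infty$,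 with upper left $N\times N$ corners $J_N$, $$\lim_{N\to\infty}\int_{\mathcal S_N}e^{i\operatorname{tr}(J_NU)}\,d\mu_{\Delta,N}(U)=e^{-\Delta L_\infty(\{\operatorname{tr}J^{2p}\}_p)}.$$ Let $\sigma$ be a nonnegative Borel measure on $\mathbb R$ such that $\lim_{\Delta\to0^+}\Delta^{-1}\int_{b>\Delta}f(b)\,d\mu_\Delta(b)=\int_{b>0}f\,d\sigma$ for every continuous $f$ with compact support in $(0,\infty)$, each such $f$ being $\sigma$-integrable there. Then $\int_0^\infty\frac{b}{1+b}\,d\sigma(b)<\infty$ (integrals over $(0,\infty)$), and there is a constant $a\ge0$ such that for all such $J$ $$L_\infty(\{\operatorname{tr}J^{2p}\}_p)=a\operatorname{tr}J^2+\int_0^\infty\bigl(1-e^{-b\operatorname{tr}J^2}\bigr)\,d\sigma(b),$$ the integral being absolutely convergent. -/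

import Mathlib

open MeasureTheory Filter Topology

/-- The space of real symmetric `N × N` matrices, with the entrywise topology and its
Borel σ-algebra. -/
abbrev SymMat (N : ℕ) : Type := {U : Matrix (Fin N) (Fin N) ℝ // U.IsSymm}

noncomputable instance SymMat.instMeasurableSpace (N : ℕ) : MeasurableSpace (SymMat N) :=
  borel (SymMat N)

instance SymMat.instBorelSpace (N : ℕ) : BorelSpace (SymMat N) := ⟨rfl⟩

/-- The action `U ↦ O U Oᵀ` of the orthogonal group on symmetric matrices. -/
def SymMat.conj {N : ℕ} (O : Matrix.orthogonalGroup (Fin N) ℝ) (U : SymMat N) : SymMat N :=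
  ⟨O.1 * U.1 * O.1.transpose, by
    have h : U.1.transpose = U.1 := U.2
    simp [Matrix.IsSymm, Matrix.transpose_mul, h, Matrix.mul_assoc]⟩

/-- `tr (U ^ k)`. -/
def SymMat.trPow {N : ℕ} (U : SymMat N) (k : ℕ) : ℝ := (U.1 ^ k).trace

/-- `tr (J U)`. -/
def SymMat.pair {N : ℕ} (J U : SymMat N) : ℝ := (J.1 * U.1).trace

/-- The sequence `tr J², tr J⁴, tr J⁶, …` of even trace invariants. -/
def SymMat.evenTraces {N : ℕ} (J : SymMat N) : ℕ → ℝ := fun p => J.trPow (2 * (p + 1))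

theorem SymMat.measurable_conj {N : ℕ} (O : Matrix.orthogonalGroup (Fin N) ℝ) :
    Measurable (SymMat.conj O) := by
  have hc : Continuous (SymMat.conj O) := by
    refine Continuous.subtype_mk ?_ _
    fun_prop
  exact hc.measurable

/-- Invariance of a measure on symmetric matrices under conjugation by orthogonal matrices. -/
def OrthInvariant {N : ℕ} (μ : Measure (SymMat N)) : Prop :=
  ∀ O : Matrix.orthogonalGroup (Fin N) ℝ, μ.map (SymMat.conj O) = μ

/-- `Δ⁻¹ ∫_{size > Δ} f dμ_Δ → ∫_{size > 0} f dσ` as `Δ → 0⁺`, for every continuous `f` with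
compact support contained in `{size > 0}`.  Here `size U` is `tr U²` on the symmetric matrices
and `b` itself on the half-line of the variable `b`. -/
def SmallVolumeLimit {X : Type*} [TopologicalSpace X] [MeasurableSpace X]
    (size : X → ℝ) (μ : ℝ → Measure X) (σ : Measure X) : Prop :=
  ∀ f : X → ℝ, Continuous f → HasCompactSupport f → tsupport f ⊆ {x | 0 < size x} →
    IntegrableOn f {x | 0 < size x} σ ∧
    Tendsto (fun Δ : ℝ => Δ⁻¹ * ∫ x in {x | Δ < size x}, f x ∂(μ Δ)) (𝓝[>] 0)
      (𝓝 (∫ x in {x | 0 < size x}, f x ∂σ))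

/-- Symmetric matrices of infinite size whose squared entries are summable (`tr J² < ∞`). -/
abbrev SymMatInf : Type :=
  {J : Matrix ℕ ℕ ℝ // J.IsSymm ∧ Summable fun p : ℕ × ℕ => J p.1 p.2 ^ 2}

/-- The upper left `N × N` corner of an infinite symmetric matrix. -/
def SymMatInf.corner (J : SymMatInf) (N : ℕ) : SymMat N :=
  ⟨fun i j => J.1 i j, by
    ext i j
    exact J.2.1.apply i j⟩

/-- Powers of an infinite matrix, with the products of rows and columns as infinite sums. -/
noncomputable def infPow (J : Matrix ℕ ℕ ℝ) : ℕ → Matrix ℕ ℕ ℝ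
  | 0 => 1
  | k + 1 => fun a c => ∑' b, infPow J k a b * J b c

/-- `tr (J ^ k)` for an infinite matrix. -/
noncomputable def SymMatInf.trPow (J : SymMatInf) (k : ℕ) : ℝ := ∑' a, infPow J.1 k a a

/-- The sequence `tr J², tr J⁴, tr J⁶, …` for an infinite matrix. -/
noncomputable def SymMatInf.evenTraces (J : SymMatInf) : ℕ → ℝ := fun p => J.trPow (2 * (p + 1))

/-- `L` is the exponent, as a function of the even traces of the source `J`, of the
characteristic functions of the measures `μ Δ`:  `exp (-Δ L(J)) = ∫ exp (i tr (J U)) dμ_Δ(U)`. -/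
def IsExponent {N : ℕ} (L : (ℕ → ℝ) → ℂ) (μ : ℝ → Measure (SymMat N)) : Prop :=
  ∀ Δ : ℝ, 0 < Δ → ∀ J : SymMat N,
    Complex.exp (-(Δ : ℂ) * L J.evenTraces) =
      ∫ U, Complex.exp (Complex.I * (J.pair U : ℂ)) ∂(μ Δ)

/-- `L` is the exponent in the limit `N → ∞`:  for every infinite `J` with corners `J_N`,
`exp (-Δ L(J)) = lim_N ∫ exp (i tr (J_N U)) dμ_{Δ,N}(U)`. -/
def IsLimitExponent (L : (ℕ → ℝ) → ℂ) (μ : ℝ → (N : ℕ) → Measure (SymMat N)) : Prop :=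
  ∀ Δ : ℝ, 0 < Δ → ∀ J : SymMatInf,
    Tendsto (fun N : ℕ => ∫ U, Complex.exp (Complex.I * ((J.corner N).pair U : ℂ)) ∂(μ Δ N)) atTop
      (𝓝 (Complex.exp (-(Δ : ℂ) * L J.evenTraces)))

/-- With `tr U² = 2 b N⋆`, `N⋆ = N (N + 1) / 2`, the law of `b` under `μ N` converges weakly
to `ν` as `N → ∞`. -/
def RadialLawTendsto (μ : (N : ℕ) → Measure (SymMat N)) (ν : Measure ℝ) : Prop :=
  ∀ f : BoundedContinuousFunction ℝ ℝ,
    Tendsto (fun N : ℕ => ∫ U : SymMat N, f (U.trPow 2 / ((N : ℝ) * ((N : ℝ) + 1))) ∂(μ N)) atTop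
      (𝓝 (∫ b, f b ∂ν))

/-- `tr U⁴` is negligible with respect to `N⋆²`, `N⋆ = N (N + 1) / 2`, the order of magnitude
of `(tr U²)²`: the quotient tends to `0` in probability as `N → ∞`. -/
def QuarticNegligible (μ : (N : ℕ) → Measure (SymMat N)) : Prop :=
  ∀ ε : ℝ, 0 < ε →
    Tendsto (fun N : ℕ =>
      μ N {U : SymMat N | ε * ((N : ℝ) * ((N : ℝ) + 1) / 2) ^ 2 < U.trPow 4}) atTop (𝓝 0)

/-! Finite `N`. Even traces do not distinguish `J` from `-J`, so the characteristic functions and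
the exponent `L` are real, and `L(J)` is the limit of `Δ⁻¹ ∫ (1 - cos tr JU) dμ_Δ`. The inequality
`1 - exp (-Δ ℓ) ≤ Δ ℓ`, with the continuity of a characteristic function at zero, bounds `Δ⁻¹ μ_Δ`
uniformly against `r / (1 + r)`, `r = tr U²`, and makes its tails uniformly small. Mass can
therefore be lost only at the origin, and test functions of size `O(r²)` see `σ` alone
(`LevyFamily.tendsto_of_le_sq`). The defect `Q(J) = L(J) - ∫ (1 - cos tr JU) dσ` is what the origin
contributes. It is nonnegative, and any linear identity among the squares `(tr JU)²` turns into one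
among values of `Q`, because the corresponding combination of cosines vanishes to fourth order.
Hence `Q` is homogeneous of degree two and satisfies the parallelogram law. Since `Q(J) = lim n⁻²
L(nJ)`, it depends only on even traces. On diagonal matrices with disjoint supports `A + B` and `A -
B` have the same square, so `Q` is additive there, and all the coordinate projections have the same
traces: `Q = a tr J²`.

Infinite `N`. The limiting characteristic function is shown to be the Laplace transform of the law
of `b` at `tr J²` (`limit_charFun_eq_laplace`), after which the same small-`Δ` argument on the
half-line gives the formula. The main tool is integration by parts along orthogonal orbits
(`stein_identity`): for traceless `J` the linear form `tr JU` is an eigenfunction of the Casimir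
operator, and its squared gradient is the squared commutator `tr [U,J][U,J]ᵀ`. Divided by `N`, this
commutator term concentrates at `2 tr U² tr J² / N²`, by a second moment bound for `U²` that uses
the negligibility of `tr U⁴`. An interpolation then compares `exp (i tr JU)` with `exp (-b tr J²)`.
The trace direction needs a separate argument: `tr J_N` may diverge for a Hilbert–Schmidt `J`,
leaving a phase `tr J_N · tr U / N`. Dependence on even traces alone removes it. Comparing
`diag(1,1)` with `diag(1,-1)` shows that `tr U / N` tends to zero in probability. Signs chosen
greedily keep the partial sums of a general diagonal bounded, so its phase is negligible with those
signs, and the comparison carries this back to the original signs. -/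

/-! ### Small-parameter limits of measures governed by a Lévy measure -/

/-- A trapezoidal cutoff: `0` off `[1/n, n + 1]` and `1` on `[2/n, n]`. -/
noncomputable def cutoff (n : ℕ) (r : ℝ) : ℝ := max 0 (min 1 (min (n * r - 1) (n + 1 - r)))

theorem cutoff_nonneg (n : ℕ) (r : ℝ) : 0 ≤ cutoff n r := le_max_left _ _

theorem cutoff_le_one (n : ℕ) (r : ℝ) : cutoff n r ≤ 1 := by
  unfold cutoff
  exact max_le zero_le_one (min_le_left _ _)

theorem continuous_cutoff (n : ℕ) : Continuous (cutoff n) := by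
  unfold cutoff
  fun_prop

theorem cutoff_eq_zero_of_mul_le {n : ℕ} {r : ℝ} (h : n * r ≤ 1) : cutoff n r = 0 := by
  unfold cutoff
  refine max_eq_left ((min_le_right _ _).trans ((min_le_left _ _).trans ?_))
  linarith

theorem cutoff_eq_zero_of_le {n : ℕ} {r : ℝ} (h : n + 1 ≤ r) : cutoff n r = 0 := by
  unfold cutoff
  refine max_eq_left ((min_le_right _ _).trans ((min_le_right _ _).trans ?_))
  linarith

theorem cutoff_eq_one {n : ℕ} {r : ℝ} (h : 2 ≤ n * r) (h' : r ≤ n) : cutoff n r = 1 := by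
  unfold cutoff
  have : min (1 : ℝ) (min (n * r - 1) (n + 1 - r)) = 1 :=
    min_eq_left (le_min (by linarith) (by linarith))
  rw [this]
  exact max_eq_right zero_le_one

theorem tendsto_cutoff {r : ℝ} (hr : 0 < r) : Tendsto (fun n : ℕ => cutoff n r) atTop (𝓝 1) := by
  refine tendsto_const_nhds.congr' ?_
  filter_upwards [eventually_ge_atTop ⌈r⌉₊, eventually_ge_atTop ⌈2 / r⌉₊] with n h1 h2
  refine (cutoff_eq_one ?_ (Nat.ceil_le.1 h1)).symm
  have := Nat.ceil_le.1 h2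
  rwa [div_le_iff₀ hr] at this

/-- A family of probability measures with a Lévy measure `σ` as its small-parameter limit, with the
bounds at the origin and at infinity which ensure that no other mass survives. -/
structure LevyFamily {X : Type*} [TopologicalSpace X] [MeasurableSpace X]
    (size : X → ℝ) (μ : ℝ → Measure X) (σ : Measure X) : Prop where
  continuous : Continuous size
  isCompact : ∀ ε R : ℝ, 0 < ε → IsCompact {x | ε ≤ size x ∧ size x ≤ R}
  prob : ∀ Δ : ℝ, 0 < Δ → IsProbabilityMeasure (μ Δ)
  nonneg : ∀ Δ : ℝ, 0 < Δ → ∀ᵐ x ∂(μ Δ), 0 ≤ size x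
  limit : SmallVolumeLimit size μ σ
  bound : ∃ C : ℝ, ∀ Δ : ℝ, 0 < Δ → ∫ x, size x / (1 + size x) ∂(μ Δ) ≤ C * Δ
  tail : ∀ η : ℝ, 0 < η → ∃ R : ℝ, ∀ Δ : ℝ, 0 < Δ → (μ Δ).real {x | R < size x} ≤ η * Δ

namespace LevyFamily

theorem abs_le_weight_of_le_sq {r y C : ℝ} (hr : 0 ≤ r) (h1 : |y| ≤ C) (h2 : |y| ≤ C * r ^ 2) :
    |y| ≤ 2 * C * (r / (1 + r)) := by
  have hC : 0 ≤ C := (abs_nonneg _).trans h1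
  have hpos : (0 : ℝ) < 1 + r := by linarith
  rw [← mul_div_assoc, le_div_iff₀ hpos]
  rcases le_total r 1 with h | h
  · have : C * r ^ 2 ≤ C * r := by
      refine mul_le_mul_of_nonneg_left ?_ hC
      nlinarith
    nlinarith [abs_nonneg y]
  · nlinarith [abs_nonneg y]

theorem tsupport_mul_cutoff_subset {X : Type*} [TopologicalSpace X] {size : X → ℝ}
    (hs : Continuous size) (ψ : X → ℝ) {n : ℕ} (hn : 0 < n) :
    tsupport (fun x => ψ x * cutoff n (size x)) ⊆ {x | 1 / (n : ℝ) ≤ size x ∧ size x ≤ n + 1} := by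
  have hn' : (0 : ℝ) < n := by exact_mod_cast hn
  refine closure_minimal ?_ ((isClosed_le continuous_const hs).inter
    (isClosed_le hs continuous_const))
  intro x hx
  rw [Function.mem_support] at hx
  by_contra hcon
  apply hx
  by_cases h1 : 1 / (n : ℝ) ≤ size x
  · have h2 : ¬ size x ≤ n + 1 := fun h2 => hcon ⟨h1, h2⟩
    simp only [cutoff_eq_zero_of_le (not_le.1 h2).le, mul_zero]
  · have : (n : ℝ) * size x ≤ 1 := by
      have := (not_le.1 h1).le
      rw [le_div_iff₀ hn'] at this
      linarith
    simp only [cutoff_eq_zero_of_mul_le this, mul_zero]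

/-- The cutoff turns an arbitrary continuous function into an admissible test function. It vanishes
where `size ≤ 1/n`, so the restriction `Δ < size` is vacuous as soon as `Δ < 1/n`. -/
theorem cutoff_limit {X : Type*} [TopologicalSpace X] [MeasurableSpace X]
    {size : X → ℝ} {μ : ℝ → Measure X} {σ : Measure X} (h : LevyFamily size μ σ) {ψ : X → ℝ} (hψ : Continuous ψ) {n : ℕ}
    (hn : 0 < n) :
    IntegrableOn (fun x => ψ x * cutoff n (size x)) {x | 0 < size x} σ ∧
    Tendsto (fun Δ : ℝ => Δ⁻¹ * ∫ x, ψ x * cutoff n (size x) ∂(μ Δ)) (𝓝[>] 0)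
      (𝓝 (∫ x in {x | 0 < size x}, ψ x * cutoff n (size x) ∂σ)) := by
  have hn' : (0 : ℝ) < n := by exact_mod_cast hn
  have hsub := tsupport_mul_cutoff_subset h.continuous ψ hn
  obtain ⟨h1, h2⟩ := h.limit (fun x => ψ x * cutoff n (size x))
    (hψ.mul ((continuous_cutoff n).comp h.continuous))
    ((h.isCompact (1 / n) (n + 1) (by positivity)).of_isClosed_subset (isClosed_tsupport _) hsub)
    (fun x hx => lt_of_lt_of_le (by positivity) (hsub hx).1)
  refine ⟨h1, h2.congr' ?_⟩
  filter_upwards [Ioo_mem_nhdsGT (show (0 : ℝ) < 1 / n by positivity)] with Δ hΔ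
  congr 1
  refine setIntegral_eq_integral_of_forall_compl_eq_zero fun x hx => ?_
  have hx' : size x ≤ Δ := not_lt.1 hx
  rw [cutoff_eq_zero_of_mul_le, mul_zero]
  have : size x ≤ 1 / n := hx'.trans hΔ.2.le
  rw [le_div_iff₀ hn'] at this
  linarith

variable {X : Type*} [TopologicalSpace X] [MeasurableSpace X] [BorelSpace X]
  {size : X → ℝ} {μ : ℝ → Measure X} {σ : Measure X}

theorem measurableSet_pos (h : LevyFamily size μ σ) : MeasurableSet {x | 0 < size x} :=
  (isOpen_lt continuous_const h.continuous).measurableSet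

theorem integrable_of_bound (h : LevyFamily size μ σ) {ψ : X → ℝ} (hψ : Continuous ψ) {C : ℝ}
    (hC : ∀ x, 0 ≤ size x → |ψ x| ≤ C) {Δ : ℝ} (hΔ : 0 < Δ) : Integrable ψ (μ Δ) := by
  have := h.prob Δ hΔ
  refine Integrable.of_bound hψ.aestronglyMeasurable C ?_
  filter_upwards [h.nonneg Δ hΔ] with x hx using hC x hx

theorem measurable_weight (h : LevyFamily size μ σ) :
    Measurable (fun x => size x / (1 + size x)) :=
  h.continuous.measurable.div (measurable_const.add h.continuous.measurable)

/-- The bound `C Δ` on the weight passes to the limit `Δ → 0` under each cutoff, and Fatou's lemma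
removes the cutoff. The absolute values make the weight continuous on all of `X`, where `size` may
be negative. -/
theorem integrableOn_weight (h : LevyFamily size μ σ) :
    IntegrableOn (fun x => size x / (1 + size x)) {x | 0 < size x} σ := by
  obtain ⟨C, hC⟩ := h.bound
  have hm := h.measurableSet_pos
  set w : X → ℝ := fun x => |size x| / (1 + |size x|) with hw
  have hwc : Continuous w :=
    h.continuous.abs.div (continuous_const.add h.continuous.abs) fun x => by positivity
  have hw0 : ∀ x, 0 ≤ w x := fun x => by positivity
  have hw1 : ∀ x, w x ≤ 1 := fun x => by
    simp only [hw]
    rw [div_le_one (by positivity)]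
    linarith
  have hww : ∀ x, 0 ≤ size x → w x = size x / (1 + size x) := fun x hx => by
    simp only [hw, abs_of_nonneg hx]
  have key : ∀ n : ℕ, 0 < n →
      ∫⁻ x in {x | 0 < size x}, ENNReal.ofReal (w x * cutoff n (size x)) ∂σ ≤ ENNReal.ofReal C := by
    intro n hn
    obtain ⟨h1, h2⟩ := h.cutoff_limit hwc hn
    rw [← ofReal_integral_eq_lintegral_ofReal h1
      (Eventually.of_forall fun x => mul_nonneg (hw0 x) (cutoff_nonneg _ _))]
    refine ENNReal.ofReal_le_ofReal (le_of_tendsto h2 ?_)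
    filter_upwards [self_mem_nhdsWithin] with Δ hΔ
    have hΔ' : (0 : ℝ) < Δ := hΔ
    have := h.prob Δ hΔ'
    rw [inv_mul_le_iff₀ hΔ', mul_comm Δ]
    refine le_trans ?_ (hC Δ hΔ')
    have he : ∫ x, size x / (1 + size x) ∂(μ Δ) = ∫ x, w x ∂(μ Δ) := by
      refine integral_congr_ae ?_
      filter_upwards [h.nonneg Δ hΔ'] with x hx using (hww x hx).symm
    rw [he]
    refine integral_mono (h.integrable_of_bound
      (hwc.mul ((continuous_cutoff n).comp h.continuous)) (C := 1) ?_ hΔ')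
      (h.integrable_of_bound hwc (C := 1) ?_ hΔ') ?_
    · intro x _
      change |w x * cutoff n (size x)| ≤ 1
      rw [abs_of_nonneg (mul_nonneg (hw0 x) (cutoff_nonneg _ _))]
      exact mul_le_one₀ (hw1 x) (cutoff_nonneg _ _) (cutoff_le_one _ _)
    · intro x _
      rw [abs_of_nonneg (hw0 x)]
      exact hw1 x
    · intro x
      exact mul_le_of_le_one_right (hw0 x) (cutoff_le_one _ _)
  have hlim : ∫⁻ x in {x | 0 < size x}, ENNReal.ofReal (w x) ∂σ ≤ ENNReal.ofReal C := by
    calc ∫⁻ x in {x | 0 < size x}, ENNReal.ofReal (w x) ∂σ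
        = ∫⁻ x in {x | 0 < size x},
            liminf (fun n : ℕ => ENNReal.ofReal (w x * cutoff n (size x))) atTop ∂σ := by
          refine setLIntegral_congr_fun hm fun x hx => ?_
          have := (ENNReal.continuous_ofReal.tendsto _).comp
            ((tendsto_cutoff (show 0 < size x from hx)).const_mul (w x))
          rw [mul_one] at this
          exact this.liminf_eq.symm
      _ ≤ liminf (fun n : ℕ =>
            ∫⁻ x in {x | 0 < size x}, ENNReal.ofReal (w x * cutoff n (size x)) ∂σ) atTop :=
          lintegral_liminf_le fun n => ENNReal.measurable_ofReal.comp
            (hwc.mul ((continuous_cutoff n).comp h.continuous)).measurable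
      _ ≤ ENNReal.ofReal C := by
          refine liminf_le_of_frequently_le' (Eventually.frequently ?_)
          filter_upwards [eventually_gt_atTop 0] with n hn using key n hn
  have : IntegrableOn w {x | 0 < size x} σ := by
    refine ⟨hwc.aestronglyMeasurable, ?_⟩
    rw [hasFiniteIntegral_iff_ofReal (Eventually.of_forall hw0)]
    exact lt_of_le_of_lt hlim ENNReal.ofReal_lt_top
  exact this.congr_fun (fun x hx => hww x (le_of_lt hx)) hm

theorem integrableOn_of_le (h : LevyFamily size μ σ) {ψ : X → ℝ} (hψ : Continuous ψ) {C : ℝ}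
    (hC : ∀ x, 0 ≤ size x → |ψ x| ≤ C * (size x / (1 + size x))) :
    IntegrableOn ψ {x | 0 < size x} σ := by
  refine (h.integrableOn_weight.const_mul C).mono' hψ.aestronglyMeasurable ?_
  filter_upwards [ae_restrict_mem h.measurableSet_pos] with x hx using hC x (le_of_lt hx)

theorem tendsto_integral_cutoff (h : LevyFamily size μ σ) {ψ : X → ℝ} (hψ : Continuous ψ)
    (hint : IntegrableOn ψ {x | 0 < size x} σ) :
    Tendsto (fun n : ℕ => ∫ x in {x | 0 < size x}, ψ x * cutoff n (size x) ∂σ) atTop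
      (𝓝 (∫ x in {x | 0 < size x}, ψ x ∂σ)) := by
  refine tendsto_integral_of_dominated_convergence (fun x => |ψ x|) (fun n =>
    (hψ.mul ((continuous_cutoff n).comp h.continuous)).aestronglyMeasurable) hint.abs
    (fun n => Eventually.of_forall fun x => ?_) ?_
  · rw [Real.norm_eq_abs, abs_mul, abs_of_nonneg (cutoff_nonneg _ _)]
    exact mul_le_of_le_one_right (abs_nonneg _) (cutoff_le_one _ _)
  · filter_upwards [ae_restrict_mem h.measurableSet_pos] with x hx
    simpa using (tendsto_cutoff (show 0 < size x from hx)).const_mul (ψ x)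

/-- Only an inequality is available at this order of vanishing: inserting the cutoff decreases the
integral, and mass of `Δ⁻¹ μ_Δ` may concentrate at the origin. -/
theorem integral_le_of_tendsto (h : LevyFamily size μ σ) {ψ : X → ℝ} (hψ : Continuous ψ) {C ℓ : ℝ}
    (hψ0 : ∀ x, 0 ≤ size x → 0 ≤ ψ x)
    (hC : ∀ x, 0 ≤ size x → ψ x ≤ C * (size x / (1 + size x)))
    (hℓ : Tendsto (fun Δ : ℝ => Δ⁻¹ * ∫ x, ψ x ∂(μ Δ)) (𝓝[>] 0) (𝓝 ℓ)) :
    ∫ x in {x | 0 < size x}, ψ x ∂σ ≤ ℓ := by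
  have hC' : ∀ x, 0 ≤ size x → |ψ x| ≤ C * (size x / (1 + size x)) := fun x hx => by
    rw [abs_of_nonneg (hψ0 x hx)]
    exact hC x hx
  have hb : ∀ x, 0 ≤ size x → |ψ x| ≤ |C| := fun x hx => by
    refine (hC' x hx).trans ((mul_le_mul_of_nonneg_right (le_abs_self C) (by positivity)).trans ?_)
    refine mul_le_of_le_one_right (abs_nonneg _) ?_
    rw [div_le_one (by positivity)]
    linarith
  refine le_of_tendsto (h.tendsto_integral_cutoff hψ (h.integrableOn_of_le hψ hC')) ?_
  filter_upwards [eventually_gt_atTop 0] with n hn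
  refine le_of_tendsto_of_tendsto (h.cutoff_limit hψ hn).2 hℓ ?_
  filter_upwards [self_mem_nhdsWithin] with Δ hΔ
  have hΔ' : (0 : ℝ) < Δ := hΔ
  refine mul_le_mul_of_nonneg_left ?_ (inv_pos.2 hΔ').le
  refine integral_mono_ae (h.integrable_of_bound
      (hψ.mul ((continuous_cutoff n).comp h.continuous)) (C := |C|) ?_ hΔ')
      (h.integrable_of_bound hψ hb hΔ') ?_
  · intro x hx
    change |ψ x * cutoff n (size x)| ≤ |C|
    rw [abs_mul, abs_of_nonneg (cutoff_nonneg _ _)]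
    exact (mul_le_of_le_one_right (abs_nonneg _) (cutoff_le_one _ _)).trans (hb x hx)
  · filter_upwards [h.nonneg Δ hΔ'] with x hx
    exact mul_le_of_le_one_right (hψ0 x hx) (cutoff_le_one _ _)

/-- Test functions vanishing to second order in `size` see only the Lévy measure. -/
theorem tendsto_of_le_sq (h : LevyFamily size μ σ) {ψ : X → ℝ} (hψ : Continuous ψ) {C : ℝ}
    (hC : ∀ x, 0 ≤ size x → |ψ x| ≤ C) (hC2 : ∀ x, 0 ≤ size x → |ψ x| ≤ C * size x ^ 2) :
    Tendsto (fun Δ : ℝ => Δ⁻¹ * ∫ x, ψ x ∂(μ Δ)) (𝓝[>] 0)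
      (𝓝 (∫ x in {x | 0 < size x}, ψ x ∂σ)) := by
  obtain ⟨B, hB⟩ := h.bound
  have hw : ∀ x, 0 ≤ size x → |ψ x| ≤ 2 * C * (size x / (1 + size x)) := fun x hx =>
    abs_le_weight_of_le_sq hx (hC x hx) (hC2 x hx)
  have hint := h.integrableOn_of_le hψ hw
  have hlim := h.tendsto_integral_cutoff hψ hint
  rw [Metric.tendsto_nhds]
  intro ε hε
  set C' := |C| + 1 with hC'
  have hC'0 : 0 < C' := by positivity
  have hCC : C ≤ C' := (le_abs_self C).trans (by simp [hC'])
  obtain ⟨R, hR⟩ := h.tail (ε / (8 * C')) (by positivity)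
  set B' := |B| + 1 with hB'
  have hB'0 : 0 < B' := by positivity
  have hBB : B ≤ B' := (le_abs_self B).trans (by simp [hB'])
  -- One cutoff level serves all errors: it lies beyond the tail radius `R`, makes the contribution
  -- near the origin at most `ε / 8`, and approximates the integral against `σ`.
  obtain ⟨n, hn0, hnR, hnε, hnσ⟩ : ∃ n : ℕ, 2 ≤ n ∧ R ≤ n ∧ 4 * C' * B' / n ≤ ε / 8 ∧
      dist (∫ x in {x | 0 < size x}, ψ x * cutoff n (size x) ∂σ)
        (∫ x in {x | 0 < size x}, ψ x ∂σ) < ε / 4 := by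
    have e1 : Tendsto (fun n : ℕ => 4 * C' * B' / (n : ℝ)) atTop (𝓝 0) :=
      tendsto_const_div_atTop_nhds_zero_nat _
    have := ((eventually_ge_atTop 2).and ((tendsto_natCast_atTop_atTop (R := ℝ)).eventually
      (eventually_ge_atTop R))).and ((e1.eventually (ge_mem_nhds (show (0 : ℝ) < ε / 8 by
        positivity))).and ((Metric.tendsto_nhds.1 hlim) (ε / 4) (by positivity)))
    obtain ⟨n, ⟨a, b⟩, c, d⟩ := this.exists
    exact ⟨n, a, b, c, d⟩
  have hn' : (2 : ℝ) ≤ n := by exact_mod_cast hn0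
  filter_upwards [self_mem_nhdsWithin, (Metric.tendsto_nhds.1
    (h.cutoff_limit hψ (show 0 < n by omega)).2) (ε / 4) (by positivity)] with Δ hΔ hd
  have hΔ' : (0 : ℝ) < Δ := hΔ
  have := h.prob Δ hΔ'
  have hi1 := h.integrable_of_bound hψ hC hΔ'
  have hi2 : Integrable (fun x => ψ x * cutoff n (size x)) (μ Δ) :=
    h.integrable_of_bound (hψ.mul ((continuous_cutoff n).comp h.continuous)) (C := C) (fun x hx => by
      change |ψ x * cutoff n (size x)| ≤ C
      rw [abs_mul, abs_of_nonneg (cutoff_nonneg _ _)]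
      exact (mul_le_of_le_one_right (abs_nonneg _) (cutoff_le_one _ _)).trans (hC x hx)) hΔ'
  have hmR : MeasurableSet {x | R < size x} :=
    (isOpen_lt continuous_const h.continuous).measurableSet
  have hiw : Integrable (fun x => size x / (1 + size x)) (μ Δ) := by
    refine Integrable.of_bound h.measurable_weight.aestronglyMeasurable 1 ?_
    filter_upwards [h.nonneg Δ hΔ'] with x hx
    rw [Real.norm_eq_abs, abs_of_nonneg (by positivity), div_le_one (by positivity)]
    linarith
  have hiR : Integrable (Set.indicator {x | R < size x} (fun _ => C')) (μ Δ) :=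
    (integrable_const C').indicator hmR
  -- The cutoff changes `ψ` only in two regions. Where `size < 2/n`, one factor of `size ^ 2`
  -- supplies `2/n` and the other is at most twice the weight. Where `size > R`, the tail estimate
  -- applies. In between, `R ≤ n` makes the cutoff equal to one.
  have hmain : |∫ x, ψ x ∂(μ Δ) - ∫ x, ψ x * cutoff n (size x) ∂(μ Δ)| ≤ Δ * (ε / 4) := by
    rw [← integral_sub hi1 hi2]
    calc |∫ x, (ψ x - ψ x * cutoff n (size x)) ∂(μ Δ)|
        ≤ ∫ x, (4 * C' / n * (size x / (1 + size x)) +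
            Set.indicator {x | R < size x} (fun _ => C') x) ∂(μ Δ) := by
          rw [← Real.norm_eq_abs]
          refine norm_integral_le_of_norm_le (show Integrable (fun x =>
            4 * C' / n * (size x / (1 + size x)) +
              Set.indicator {x | R < size x} (fun _ => C') x) (μ Δ) from
            (hiw.const_mul _).add hiR) ?_
          filter_upwards [h.nonneg Δ hΔ'] with x hx
          have hwx : 0 ≤ size x / (1 + size x) := by positivity
          have hfac : ‖ψ x - ψ x * cutoff n (size x)‖ = |ψ x| * (1 - cutoff n (size x)) := by
            rw [← mul_one_sub, Real.norm_eq_abs, abs_mul,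
              abs_of_nonneg (sub_nonneg.2 (cutoff_le_one _ _))]
          have hle : |ψ x| * (1 - cutoff n (size x)) ≤ |ψ x| :=
            mul_le_of_le_one_right (abs_nonneg _) (by linarith [cutoff_nonneg n (size x)])
          rw [hfac]
          by_cases hxR : R < size x
          · rw [Set.indicator_of_mem (show x ∈ {x | R < size x} from hxR)]
            have : 0 ≤ 4 * C' / n * (size x / (1 + size x)) := by positivity
            linarith [hC x hx]
          · rw [Set.indicator_of_notMem (show x ∉ {x | R < size x} from hxR), add_zero]
            by_cases hx2 : 2 ≤ n * size x
            · rw [cutoff_eq_one hx2 ((not_lt.1 hxR).trans hnR), sub_self, mul_zero]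
              positivity
            · have hx3 : size x ≤ 2 / n := by
                rw [le_div_iff₀ (by linarith)]
                linarith
              have hx4 : size x ≤ 1 := hx3.trans (by rw [div_le_one (by linarith)]; exact hn')
              refine hle.trans ((hC2 x hx).trans ?_)
              have h5 : size x ≤ 2 * (size x / (1 + size x)) := by
                rw [← mul_div_assoc, le_div_iff₀ (by linarith)]
                nlinarith
              calc C * size x ^ 2 ≤ C' * size x ^ 2 := by gcongr
                _ = C' * (size x * size x) := by ring
                _ ≤ C' * (2 / n * (2 * (size x / (1 + size x)))) := by gcongr
                _ = 4 * C' / n * (size x / (1 + size x)) := by ring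
      _ = 4 * C' / n * ∫ x, size x / (1 + size x) ∂(μ Δ) + (μ Δ).real {x | R < size x} * C' := by
          rw [integral_add (hiw.const_mul _) hiR, integral_const_mul, integral_indicator hmR,
            setIntegral_const, smul_eq_mul]
      _ ≤ 4 * C' / n * (B' * Δ) + ε / (8 * C') * Δ * C' := by
          gcongr
          · exact (hB Δ hΔ').trans (by gcongr)
          · exact hR Δ hΔ'
      _ = (4 * C' * B' / n + ε / 8) * Δ := by
          field_simp
      _ ≤ (ε / 8 + ε / 8) * Δ := by gcongr
      _ = Δ * (ε / 4) := by ring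
  have h3 : dist (Δ⁻¹ * ∫ x, ψ x ∂(μ Δ)) (Δ⁻¹ * ∫ x, ψ x * cutoff n (size x) ∂(μ Δ)) ≤ ε / 4 := by
    rw [Real.dist_eq, ← mul_sub, abs_mul, abs_of_pos (inv_pos.2 hΔ'), inv_mul_le_iff₀ hΔ']
    exact hmain
  calc dist (Δ⁻¹ * ∫ x, ψ x ∂(μ Δ)) (∫ x in {x | 0 < size x}, ψ x ∂σ)
      ≤ dist (Δ⁻¹ * ∫ x, ψ x ∂(μ Δ)) (Δ⁻¹ * ∫ x, ψ x * cutoff n (size x) ∂(μ Δ)) +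
        (dist (Δ⁻¹ * ∫ x, ψ x * cutoff n (size x) ∂(μ Δ))
          (∫ x in {x | 0 < size x}, ψ x * cutoff n (size x) ∂σ) +
        dist (∫ x in {x | 0 < size x}, ψ x * cutoff n (size x) ∂σ)
          (∫ x in {x | 0 < size x}, ψ x ∂σ)) :=
        (dist_triangle _ _ _).trans (add_le_add_right (dist_triangle _ _ _) _)
    _ < ε := by linarith

/-- Continuous symmetries of the measures are symmetries of the Lévy measure. -/
theorem map_restrict_eq [HasOuterApproxClosed X] (h : LevyFamily size μ σ) {T : X → X}
    (hT : Continuous T) (hTs : ∀ x, size (T x) = size x)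
    (hTμ : ∀ Δ : ℝ, 0 < Δ → (μ Δ).map T = μ Δ) :
    (σ.restrict {x | 0 < size x}).map T = σ.restrict {x | 0 < size x} := by
  have hm := h.measurableSet_pos
  set ρ := σ.restrict {x | 0 < size x} with hρ
  set w : X → ℝ := fun x => |size x| / (1 + |size x|) with hw
  have hwc : Continuous w :=
    h.continuous.abs.div (continuous_const.add h.continuous.abs) fun x => by positivity
  have hw0 : ∀ x, 0 ≤ w x := fun x => by positivity
  have hwT : ∀ x, w (T x) = w x := fun x => by simp only [hw, hTs]
  have hww : ∀ x, 0 ≤ size x → w x = size x / (1 + size x) := fun x hx => by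
    simp only [hw, abs_of_nonneg hx]
  have hwint : Integrable w ρ := h.integrableOn_weight.congr_fun
    (fun x hx => (hww x (le_of_lt hx)).symm) hm
  set k : X → ENNReal := fun x => ENNReal.ofReal (w x) with hk
  have hkm : Measurable k := ENNReal.measurable_ofReal.comp hwc.measurable
  have hkT : ∀ x, k (T x) = k x := fun x => by simp only [hk, hwT]
  -- `σ` may have infinite mass near the origin, whereas bounded continuous functions determine
  -- finite measures. The weight is integrable and invariant under `T`, so invariance is proved for
  -- the weighted measure; the density is positive and finite on `size > 0` and can be divided out
  -- afterwards.
  set τ := ρ.withDensity k with hτ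
  have hτf : IsFiniteMeasure τ := isFiniteMeasure_withDensity_ofReal hwint.2
  have hint : ∀ g : BoundedContinuousFunction X ℝ, ∫ x, g x ∂τ = ∫ x, w x * g x ∂ρ := by
    intro g
    rw [hτ, integral_withDensity_eq_integral_toReal_smul hkm
      (Eventually.of_forall fun x => ENNReal.ofReal_lt_top)]
    refine integral_congr_ae (Eventually.of_forall fun x => ?_)
    simp only [hk, ENNReal.toReal_ofReal (hw0 x), smul_eq_mul]
  have hlim : ∀ g : X → ℝ, Continuous g → (∃ C, ∀ x, |g x| ≤ C) →
      Tendsto (fun n : ℕ => ∫ x in {x | 0 < size x}, (w x * g x) * cutoff n (size x) ∂σ) atTop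
        (𝓝 (∫ x, w x * g x ∂ρ)) := by
    rintro g hg ⟨C, hC⟩
    refine h.tendsto_integral_cutoff (hwc.mul hg) (h.integrableOn_of_le (hwc.mul hg) (C := C) ?_)
    intro x hx
    rw [abs_mul, abs_of_nonneg (hw0 x), mul_comm, hww x hx]
    exact mul_le_mul_of_nonneg_right (hC x) (by positivity)
  have hτT : τ.map T = τ := by
    refine ext_of_forall_integral_eq_of_IsFiniteMeasure fun g => ?_
    rw [integral_map hT.measurable.aemeasurable g.continuous.aestronglyMeasurable]
    have e1 : ∫ x, g (T x) ∂τ = ∫ x, w x * g (T x) ∂ρ :=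
      hint (g.compContinuous ⟨T, hT⟩)
    rw [e1, hint g]
    have hgb : ∃ C, ∀ x, |g x| ≤ C := ⟨‖g‖, fun x => g.norm_coe_le_norm x⟩
    refine tendsto_nhds_unique (hlim (fun x => g (T x)) (g.continuous.comp hT)
      ⟨hgb.choose, fun x => hgb.choose_spec (T x)⟩) ((hlim g g.continuous hgb).congr' ?_)
    filter_upwards [eventually_gt_atTop 0] with n hn
    -- For fixed `n` both integrals against `σ` are limits of integrals against `μ Δ`, and those
    -- agree by invariance.
    refine tendsto_nhds_unique (h.cutoff_limit (hwc.mul g.continuous) hn).2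
      ((h.cutoff_limit (hwc.mul (g.continuous.comp hT)) hn).2.congr' ?_)
    filter_upwards [self_mem_nhdsWithin] with Δ hΔ
    congr 1
    have hc : Continuous fun x => w x * g x * cutoff n (size x) :=
      (hwc.mul g.continuous).mul ((continuous_cutoff n).comp h.continuous)
    have := integral_map (μ := μ Δ) hT.measurable.aemeasurable
      (f := fun x => w x * g x * cutoff n (size x)) hc.aestronglyMeasurable
    rw [hTμ Δ hΔ] at this
    change _ = ∫ x, w x * g x * cutoff n (size x) ∂μ Δ
    rw [this]
    simp only [hwT, hTs]
    rfl
  have hinv : τ.withDensity k⁻¹ = ρ := by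
    refine withDensity_inv_same hkm ?_ (Eventually.of_forall fun x => ENNReal.ofReal_ne_top)
    filter_upwards [ae_restrict_mem hm] with x hx
    have hx' : 0 < size x := hx
    simp only [hk, ne_eq, ENNReal.ofReal_eq_zero, not_le, hww x hx'.le]
    positivity
  rw [← hinv]
  ext A hA
  rw [Measure.map_apply hT.measurable hA, withDensity_apply _ (hT.measurable hA),
    withDensity_apply _ hA]
  conv_rhs => rw [← hτT]
  rw [setLIntegral_map hA hkm.inv hT.measurable]
  refine lintegral_congr fun x => ?_
  simp only [Pi.inv_apply, hkT]

end LevyFamily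

/-! ### Symmetric matrices: trace pairing, topology and conjugation -/

namespace SymMat

variable {N : ℕ}

instance : Neg (SymMat N) := ⟨fun U => ⟨-U.1, by
  have h : U.1.transpose = U.1 := U.2
  simp [Matrix.IsSymm, h]⟩⟩

instance : Add (SymMat N) := ⟨fun U V => ⟨U.1 + V.1, U.2.add V.2⟩⟩

instance : Sub (SymMat N) := ⟨fun U V => ⟨U.1 - V.1, U.2.sub V.2⟩⟩

instance : SMul ℝ (SymMat N) := ⟨fun t U => ⟨t • U.1, U.2.smul t⟩⟩

theorem val_neg (U : SymMat N) : (-U).1 = -U.1 := rfl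

theorem val_add (U V : SymMat N) : (U + V).1 = U.1 + V.1 := rfl

theorem val_sub (U V : SymMat N) : (U - V).1 = U.1 - V.1 := rfl

theorem val_smul (t : ℝ) (U : SymMat N) : (t • U).1 = t • U.1 := rfl

theorem apply_symm (U : SymMat N) (i j : Fin N) : U.1 i j = U.1 j i := (U.2.apply i j).symm

/-- The diagonal matrix as an element of `SymMat N`. -/
def diag (d : Fin N → ℝ) : SymMat N := ⟨Matrix.diagonal d, Matrix.isSymm_diagonal d⟩

/-- The symmetric matrix dual to the entry `(i, j)`. -/
noncomputable def entry (i j : Fin N) : SymMat N :=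
  ⟨(1 / 2 : ℝ) • (Matrix.single i j 1 + Matrix.single j i 1), by
    simp [Matrix.IsSymm, Matrix.transpose_single, add_comm]⟩

theorem pair_eq_sum (J U : SymMat N) : J.pair U = ∑ i, ∑ j, J.1 i j * U.1 i j := by
  simp only [pair, Matrix.trace, Matrix.diag, Matrix.mul_apply]
  exact Finset.sum_congr rfl fun i _ => Finset.sum_congr rfl fun j _ => by rw [U.apply_symm j i]

theorem trPow_two_eq_pair (U : SymMat N) : U.trPow 2 = U.pair U := by
  rw [trPow, pow_two, pair]

theorem trPow_two_eq_sum (U : SymMat N) : U.trPow 2 = ∑ i, ∑ j, U.1 i j ^ 2 := by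
  rw [trPow_two_eq_pair, pair_eq_sum]
  simp only [pow_two]

theorem trPow_two_nonneg (U : SymMat N) : 0 ≤ U.trPow 2 := by
  rw [trPow_two_eq_sum]
  positivity

theorem sq_apply_le_trPow_two (U : SymMat N) (i j : Fin N) : U.1 i j ^ 2 ≤ U.trPow 2 := by
  rw [trPow_two_eq_sum]
  exact (Finset.single_le_sum (f := fun j => U.1 i j ^ 2) (fun _ _ => sq_nonneg _)
    (Finset.mem_univ j)).trans (Finset.single_le_sum (f := fun i => ∑ j, U.1 i j ^ 2)
      (fun _ _ => Finset.sum_nonneg fun _ _ => sq_nonneg _) (Finset.mem_univ i))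

theorem trPow_four_eq_sum (U : SymMat N) : U.trPow 4 = ∑ i, ∑ j, (U.1 * U.1) i j ^ 2 := by
  have hs : (U.1 * U.1).IsSymm := by
    have h : U.1.transpose = U.1 := U.2
    simp [Matrix.IsSymm, Matrix.transpose_mul, h]
  have := trPow_two_eq_sum (⟨U.1 * U.1, hs⟩ : SymMat N)
  rw [← this]
  simp only [trPow, ← pow_two, ← pow_mul]
  norm_num

theorem pair_comm (J U : SymMat N) : J.pair U = U.pair J := Matrix.trace_mul_comm _ _

theorem sq_pair_le (J U : SymMat N) : J.pair U ^ 2 ≤ J.trPow 2 * U.trPow 2 := by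
  simp only [pair_eq_sum, trPow_two_eq_sum, ← Finset.sum_product']
  exact Finset.sum_mul_sq_le_sq_mul_sq _ _ _

theorem pair_add_left (J K U : SymMat N) : (J + K).pair U = J.pair U + K.pair U := by
  simp only [pair, val_add, add_mul, Matrix.trace_add]

theorem pair_sub_left (J K U : SymMat N) : (J - K).pair U = J.pair U - K.pair U := by
  simp only [pair, val_sub, sub_mul, Matrix.trace_sub]

theorem pair_smul_left (t : ℝ) (J U : SymMat N) : (t • J).pair U = t * J.pair U := by
  simp only [pair, val_smul, Matrix.smul_mul, Matrix.trace_smul, smul_eq_mul]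

theorem pair_neg_left (J U : SymMat N) : (-J).pair U = -J.pair U := by
  simp only [pair, val_neg, Matrix.neg_mul, Matrix.trace_neg]

theorem pair_neg_right (J U : SymMat N) : J.pair (-U) = -J.pair U := by
  simp only [pair, val_neg, Matrix.mul_neg, Matrix.trace_neg]

theorem pair_entry (i j : Fin N) (U : SymMat N) : (entry i j).pair U = U.1 i j := by
  simp only [pair, entry, Matrix.smul_mul, Matrix.trace_smul, add_mul, Matrix.trace_add,
    Matrix.trace_single_mul, smul_eq_mul, one_mul, U.apply_symm j i]
  ring

theorem continuous_val : Continuous (fun U : SymMat N => U.1) := continuous_subtype_val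

theorem continuous_apply (i j : Fin N) : Continuous (fun U : SymMat N => U.1 i j) :=
  continuous_val.matrix_elem i j

theorem continuous_trPow (k : ℕ) : Continuous (fun U : SymMat N => U.trPow k) :=
  (continuous_val.pow k).matrix_trace

theorem continuous_pair (J : SymMat N) : Continuous (fun U : SymMat N => J.pair U) :=
  (continuous_const.matrix_mul continuous_val).matrix_trace

theorem continuous_conj (O : Matrix.orthogonalGroup (Fin N) ℝ) : Continuous (conj O) := by
  refine Continuous.subtype_mk ?_ _
  exact (continuous_const.matrix_mul continuous_val).matrix_mul continuous_const

theorem continuous_neg : Continuous (fun U : SymMat N => -U) :=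
  Continuous.subtype_mk continuous_val.neg _

theorem isClosedEmbedding_val : IsClosedEmbedding (fun U : SymMat N => U.1) := by
  refine IsClosed.isClosedEmbedding_subtypeVal ?_
  exact isClosed_eq (continuous_id.matrix_transpose) continuous_id

theorem isCompact_trPow_two_le (R : ℝ) : IsCompact {U : SymMat N | U.trPow 2 ≤ R} := by
  have hK : IsCompact (Set.univ.pi fun _ : Fin N => Set.univ.pi fun _ : Fin N =>
      Set.Icc (-√R) (√R) : Set (Fin N → Fin N → ℝ)) :=
    isCompact_univ_pi fun _ => isCompact_univ_pi fun _ => isCompact_Icc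
  have hK' := isClosedEmbedding_val.isCompact_preimage
    (show IsCompact (X := Matrix (Fin N) (Fin N) ℝ) _ from hK)
  refine hK'.of_isClosed_subset (isClosed_le (continuous_trPow 2) continuous_const) ?_
  intro U hU i _ j _
  exact abs_le.1 (Real.abs_le_sqrt ((U.sq_apply_le_trPow_two i j).trans hU))

theorem trace_conj_pow (O : Matrix.orthogonalGroup (Fin N) ℝ) (M : Matrix (Fin N) (Fin N) ℝ)
    (k : ℕ) : ((O.1 * M * O.1.transpose) ^ k).trace = (M ^ k).trace := by
  have hO : O.1.transpose * O.1 = 1 := (Matrix.mem_orthogonalGroup_iff' (Fin N) ℝ).1 O.2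
  have hpow : (O.1 * M * O.1.transpose) ^ k * O.1 = O.1 * M ^ k := by
    induction k with
    | zero => simp
    | succ k ih =>
      rw [pow_succ, pow_succ, Matrix.mul_assoc, Matrix.mul_assoc (O.1 * M), hO, Matrix.mul_one,
        ← Matrix.mul_assoc, ih, Matrix.mul_assoc]
  have hO' : O.1 * O.1.transpose = 1 := (Matrix.mem_orthogonalGroup_iff (Fin N) ℝ).1 O.2
  calc ((O.1 * M * O.1.transpose) ^ k).trace
      = ((O.1 * M * O.1.transpose) ^ k * O.1 * O.1.transpose).trace := by
        rw [Matrix.mul_assoc (_ ^ k), hO', Matrix.mul_one]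
    _ = (M ^ k).trace := by
        rw [hpow, Matrix.trace_mul_comm, ← Matrix.mul_assoc, hO, Matrix.one_mul]

theorem trPow_conj (O : Matrix.orthogonalGroup (Fin N) ℝ) (U : SymMat N) (k : ℕ) :
    (conj O U).trPow k = U.trPow k := trace_conj_pow O U.1 k

theorem trPow_two_neg (U : SymMat N) : (-U).trPow 2 = U.trPow 2 := by
  simp only [trPow, val_neg, even_two.neg_pow]

theorem trPow_smul (t : ℝ) (U : SymMat N) (k : ℕ) : (t • U).trPow k = t ^ k * U.trPow k := by
  simp only [trPow, val_smul, smul_pow, Matrix.trace_smul, smul_eq_mul]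

theorem evenTraces_congr {A B : SymMat N} (h : A.1 * A.1 = B.1 * B.1) :
    A.evenTraces = B.evenTraces := by
  funext p
  simp only [evenTraces, trPow, pow_mul, pow_two, h]

theorem evenTraces_neg (A : SymMat N) : (-A).evenTraces = A.evenTraces :=
  evenTraces_congr (by simp [val_neg])

theorem evenTraces_smul_congr {A B : SymMat N} (h : A.evenTraces = B.evenTraces) (t : ℝ) :
    (t • A).evenTraces = (t • B).evenTraces := by
  funext p
  have := congrFun h p
  simp only [evenTraces] at this ⊢
  rw [trPow_smul, trPow_smul, this]

/-- The spectral theorem: the eigenvectors form an orthogonal matrix, and traces of powers are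
conjugation invariant. -/
theorem exists_diag (J : SymMat N) : ∃ d : Fin N → ℝ, J.evenTraces = (diag d).evenTraces := by
  have hJ : J.1.IsHermitian := by
    have h : J.1.transpose = J.1 := J.2
    rw [Matrix.IsHermitian, Matrix.conjTranspose_eq_transpose_of_trivial, h]
  refine ⟨hJ.eigenvalues, ?_⟩
  have h := hJ.spectral_theorem
  have h' : J.1 = (hJ.eigenvectorUnitary : Matrix (Fin N) (Fin N) ℝ) *
      Matrix.diagonal hJ.eigenvalues *
      (hJ.eigenvectorUnitary : Matrix (Fin N) (Fin N) ℝ).transpose := by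
    conv_lhs => rw [h]
    rw [Unitary.conjStarAlgAut_apply, Matrix.star_eq_conjTranspose,
      Matrix.conjTranspose_eq_transpose_of_trivial]
    rfl
  funext p
  simp only [evenTraces, trPow]
  conv_lhs => rw [h']
  exact trace_conj_pow hJ.eigenvectorUnitary _ _

end SymMat

/-! ### Exponents of characteristic functions: reality, Fourier uniqueness, tail bounds -/

theorem tendsto_inv_mul_one_sub_exp (ℓ : ℝ) :
    Tendsto (fun Δ : ℝ => Δ⁻¹ * (1 - Real.exp (-Δ * ℓ))) (𝓝[>] 0) (𝓝 ℓ) := by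
  have h : HasDerivAt (fun Δ : ℝ => 1 - Real.exp (-Δ * ℓ)) ℓ 0 := by
    have h1 : HasDerivAt (fun Δ : ℝ => -Δ * ℓ) (-1 * ℓ) 0 := (hasDerivAt_neg 0).mul_const ℓ
    simpa using (h1.exp).const_sub 1
  have := h.tendsto_slope_zero_right
  simpa using this

theorem one_sub_exp_neg_mul_le (Δ ℓ : ℝ) : 1 - Real.exp (-Δ * ℓ) ≤ Δ * ℓ := by
  linarith [Real.add_one_le_exp (-Δ * ℓ)]

/-- A complex number is real as soon as all `exp (-Δ z)`, `Δ > 0`, are real. -/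
theorem im_eq_zero_of_exp_neg_mul {z : ℂ}
    (h : ∀ Δ : ℝ, 0 < Δ → (Complex.exp (-(Δ : ℂ) * z)).im = 0) : z.im = 0 := by
  by_contra hz
  have hpos : 0 < |z.im| := abs_pos.2 hz
  -- This `Δ` rotates the phase `Δ · z.im` to `±π/2`, where the sine is not zero.
  have h1 := h (Real.pi / (2 * |z.im|)) (by positivity)
  rw [Complex.exp_im] at h1
  have h2 : Real.sin (-((Real.pi / (2 * |z.im|) : ℝ) : ℂ) * z).im = 0 :=
    (mul_eq_zero.1 h1).resolve_left (Real.exp_ne_zero _)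
  rw [← Complex.ofReal_neg, Complex.im_ofReal_mul] at h2
  rcases abs_choice z.im with habs | habs
  · have : -(Real.pi / (2 * |z.im|)) * z.im = -(Real.pi / 2) := by
      rw [habs]
      field_simp
    rw [this, Real.sin_neg, Real.sin_pi_div_two] at h2
    norm_num at h2
  · have : -(Real.pi / (2 * |z.im|)) * z.im = Real.pi / 2 := by
      rw [habs]
      field_simp
    rw [this, Real.sin_pi_div_two] at h2
    norm_num at h2

theorem SymMat.integrable_exp_pair {N : ℕ} (J : SymMat N) (μ : Measure (SymMat N))
    [IsFiniteMeasure μ] : Integrable (fun U => Complex.exp (Complex.I * (J.pair U : ℂ))) μ := by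
  refine Integrable.of_bound (C := 1) ?_ (Eventually.of_forall fun U => ?_)
  · have := SymMat.continuous_pair J
    exact Continuous.aestronglyMeasurable (by fun_prop)
  · rw [mul_comm, Complex.norm_exp_ofReal_mul_I]

theorem SymMat.integrable_cos_pair {N : ℕ} (J : SymMat N) (μ : Measure (SymMat N))
    [IsFiniteMeasure μ] : Integrable (fun U => Real.cos (J.pair U)) μ := by
  refine Integrable.of_bound (C := 1) ?_ (Eventually.of_forall fun U => Real.abs_cos_le_one _)
  have := SymMat.continuous_pair J
  exact Continuous.aestronglyMeasurable (by fun_prop)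

theorem exp_I_mul_re (x : ℝ) : (Complex.exp (Complex.I * (x : ℂ))).re = Real.cos x := by
  rw [mul_comm, Complex.exp_ofReal_mul_I_re]

theorem exp_I_mul_im (x : ℝ) : (Complex.exp (Complex.I * (x : ℂ))).im = Real.sin x := by
  rw [mul_comm, Complex.exp_ofReal_mul_I_im]

/-- Fourier uniqueness on the symmetric matrices. -/
theorem SymMat.ext_of_charFun {N : ℕ} {μ ν : Measure (SymMat N)} [IsFiniteMeasure μ]
    [IsFiniteMeasure ν] (h : ∀ J : SymMat N, ∫ U, Complex.exp (Complex.I * (J.pair U : ℂ)) ∂μ =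
      ∫ U, Complex.exp (Complex.I * (J.pair U : ℂ)) ∂ν) : μ = ν := by
  let e : SymMat N → EuclideanSpace ℝ (Fin N × Fin N) :=
    fun U => WithLp.toLp 2 fun p => U.1 p.1 p.2
  have he : Continuous e := by
    refine (PiLp.continuous_toLp 2 _).comp (continuous_pi fun p => SymMat.continuous_apply p.1 p.2)
  -- Symmetrization is a left inverse of the embedding `e`, and also its adjoint: a frequency `t` on
  -- all `N²` entries acts on symmetric matrices as its symmetric part. Hence the given trace
  -- pairings already determine every Euclidean frequency.
  let g : EuclideanSpace ℝ (Fin N × Fin N) → SymMat N := fun t =>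
    ⟨fun i j => (1 / 2 : ℝ) * (t (i, j) + t (j, i)), by
      ext i j
      change (1 / 2 : ℝ) * (t (j, i) + t (i, j)) = 1 / 2 * (t (i, j) + t (j, i))
      ring⟩
  have hg : Continuous g := by
    refine Continuous.subtype_mk (continuous_matrix fun i j => ?_) _
    fun_prop
  have hge : ∀ U, g (e U) = U := fun U => by
    refine Subtype.ext (Matrix.ext fun i j => ?_)
    change (1 / 2 : ℝ) * (U.1 i j + U.1 j i) = U.1 i j
    rw [U.apply_symm j i]
    ring
  have hpair : ∀ (U : SymMat N) (t : EuclideanSpace ℝ (Fin N × Fin N)),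
      inner ℝ (e U) t = (g t).pair U := fun U t => by
    rw [SymMat.pair_eq_sum, PiLp.inner_apply, ← Finset.univ_product_univ, Finset.sum_product]
    change ∑ i, ∑ j, inner ℝ (U.1 i j) (t (i, j)) =
      ∑ i, ∑ j, (1 / 2 : ℝ) * (t (i, j) + t (j, i)) * U.1 i j
    have h1 : ∑ i, ∑ j, t (i, j) * U.1 i j = ∑ i, ∑ j, t (j, i) * U.1 i j := by
      rw [Finset.sum_comm]
      exact Finset.sum_congr rfl fun i _ => Finset.sum_congr rfl fun j _ => by
        rw [U.apply_symm]
    have h2 : ∑ i, ∑ j, (1 / 2 : ℝ) * (t (i, j) + t (j, i)) * U.1 i j =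
        (1 / 2) * (∑ i, ∑ j, t (i, j) * U.1 i j) + (1 / 2) * ∑ i, ∑ j, t (j, i) * U.1 i j := by
      simp only [Finset.mul_sum, ← Finset.sum_add_distrib]
      exact Finset.sum_congr rfl fun i _ => Finset.sum_congr rfl fun j _ => by ring
    rw [h2, ← h1]
    simp only [RCLike.inner_apply, conj_trivial]
    ring
  have key : μ.map e = ν.map e := by
    refine Measure.ext_of_charFun ?_
    funext t
    have hc : Continuous fun x : EuclideanSpace ℝ (Fin N × Fin N) =>
        Complex.exp ((inner ℝ x t : ℝ) * Complex.I) := by fun_prop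
    rw [charFun_apply, charFun_apply, integral_map he.measurable.aemeasurable
      hc.aestronglyMeasurable, integral_map he.measurable.aemeasurable hc.aestronglyMeasurable]
    simp only [hpair]
    have := h (g t)
    simp only [mul_comm Complex.I] at this
    exact this
  have hback : ∀ m : Measure (SymMat N), (m.map e).map g = m := fun m => by
    rw [Measure.map_map hg.measurable he.measurable]
    have : g ∘ e = id := funext hge
    rw [this, Measure.map_id]
  rw [← hback μ, key, hback]

/-- The tail of an entry in terms of the exponent of the characteristic function. -/
theorem measureReal_abs_gt_le_of_exponent {X : Type*} [MeasurableSpace X] (μ : Measure X)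
    [IsProbabilityMeasure μ] {Y : X → ℝ} (hY : Measurable Y) {φ : ℝ → ℂ}
    (hφ : ∀ t : ℝ, ∫ x, Complex.exp (Complex.I * ((t * Y x : ℝ) : ℂ)) ∂μ = φ t) {r B : ℝ}
    (hr : 0 < r) (hB : ∀ t : ℝ, |t| ≤ 2 / r → ‖1 - φ t‖ ≤ B) :
    μ.real {x | r < |Y x|} ≤ 2 * B := by
  have := Measure.isProbabilityMeasure_map (μ := μ) hY.aemeasurable
  have hchar : ∀ t : ℝ, charFun (μ.map Y) t = φ t := fun t => by
    have hc : Continuous fun x : ℝ => Complex.exp (t * x * Complex.I) := by fun_prop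
    rw [charFun_apply_real, integral_map hY.aemeasurable hc.aestronglyMeasurable, ← hφ t]
    refine integral_congr_ae (Eventually.of_forall fun x => ?_)
    push_cast
    ring_nf
  have h1 := measureReal_abs_gt_le_integral_charFun (μ := μ.map Y) hr
  have hm : MeasurableSet {y : ℝ | r < |y|} := measurableSet_lt measurable_const measurable_norm
  rw [map_measureReal_apply hY hm] at h1
  refine h1.trans ?_
  have h2 : ‖∫ t in (-2 * r⁻¹)..(2 * r⁻¹), 1 - charFun (μ.map Y) t‖ ≤
      B * |2 * r⁻¹ - (-2 * r⁻¹)| := by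
    refine intervalIntegral.norm_integral_le_of_norm_le_const fun t ht => ?_
    rw [Set.uIoc_of_le (by have : 0 < r⁻¹ := inv_pos.2 hr
                           linarith)] at ht
    rw [hchar]
    refine hB t (abs_le.2 ⟨?_, ?_⟩)
    · have := ht.1.le
      rw [div_eq_mul_inv]
      linarith
    · rw [div_eq_mul_inv]
      exact ht.2
  have h3 : |2 * r⁻¹ - (-2 * r⁻¹)| = 4 * r⁻¹ := by
    rw [abs_of_nonneg] <;> ring_nf
    positivity
  rw [h3] at h2
  calc 2⁻¹ * r * ‖∫ t in (-2 * r⁻¹)..(2 * r⁻¹), 1 - charFun (μ.map Y) t‖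
      ≤ 2⁻¹ * r * (B * (4 * r⁻¹)) := by gcongr
    _ = 2 * B := by field_simp; ring

section Exponent

variable {N : ℕ} {L : (ℕ → ℝ) → ℂ} {μ : ℝ → Measure (SymMat N)}

/-- Replacing `J` by `-J` conjugates the characteristic function but leaves the even traces
unchanged. -/
theorem IsExponent.im_eq_zero (hL : IsExponent L μ) (J : SymMat N) : (L J.evenTraces).im = 0 := by
  refine im_eq_zero_of_exp_neg_mul fun Δ hΔ => ?_
  have h1 := hL Δ hΔ (-J)
  have h2 := hL Δ hΔ J
  rw [SymMat.evenTraces_neg] at h1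
  have h3 : (starRingEnd ℂ) (∫ U, Complex.exp (Complex.I * (J.pair U : ℂ)) ∂(μ Δ)) =
      ∫ U, Complex.exp (Complex.I * ((-J).pair U : ℂ)) ∂(μ Δ) := by
    rw [← integral_conj]
    refine integral_congr_ae (Eventually.of_forall fun U => ?_)
    simp only [← Complex.exp_conj, map_mul, Complex.conj_I, Complex.conj_ofReal,
      SymMat.pair_neg_left, Complex.ofReal_neg, mul_neg, neg_mul]
  rw [← h1, ← h2] at h3
  exact Complex.conj_eq_iff_im.1 h3

theorem IsExponent.ofReal_re (hL : IsExponent L μ) (J : SymMat N) :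
    (((L J.evenTraces).re : ℝ) : ℂ) = L J.evenTraces :=
  Complex.ext (by simp) (by simp [hL.im_eq_zero J])

theorem IsExponent.integral_exp (hL : IsExponent L μ) {Δ : ℝ} (hΔ : 0 < Δ) (J : SymMat N) :
    ∫ U, Complex.exp (Complex.I * (J.pair U : ℂ)) ∂(μ Δ) =
      ((Real.exp (-Δ * (L J.evenTraces).re) : ℝ) : ℂ) := by
  rw [← hL Δ hΔ J, Complex.ofReal_exp, Complex.ofReal_mul, hL.ofReal_re, Complex.ofReal_neg]

theorem IsExponent.integral_cos (hL : IsExponent L μ) {Δ : ℝ} (hΔ : 0 < Δ)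
    (hp : IsProbabilityMeasure (μ Δ)) (J : SymMat N) :
    ∫ U, Real.cos (J.pair U) ∂(μ Δ) = Real.exp (-Δ * (L J.evenTraces).re) := by
  have h := congrArg Complex.re (hL.integral_exp hΔ J)
  rw [Complex.ofReal_re] at h
  rw [← h]
  have := (J.integrable_exp_pair (μ Δ)).re
  have h2 := integral_re (J.integrable_exp_pair (μ Δ))
  simp only [RCLike.re_to_complex, exp_I_mul_re] at h2
  exact h2

theorem IsExponent.integral_one_sub_cos (hL : IsExponent L μ) {Δ : ℝ} (hΔ : 0 < Δ)
    (hp : IsProbabilityMeasure (μ Δ)) (J : SymMat N) :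
    ∫ U, (1 - Real.cos (J.pair U)) ∂(μ Δ) = 1 - Real.exp (-Δ * (L J.evenTraces).re) := by
  rw [integral_sub (integrable_const _) (J.integrable_cos_pair _), hL.integral_cos hΔ hp]
  simp

theorem IsExponent.re_nonneg (hL : IsExponent L μ) (hp : IsProbabilityMeasure (μ 1))
    (J : SymMat N) : 0 ≤ (L J.evenTraces).re := by
  have h := hL.integral_one_sub_cos one_pos hp J
  have h0 : 0 ≤ ∫ U, (1 - Real.cos (J.pair U)) ∂(μ 1) :=
    integral_nonneg fun U => sub_nonneg.2 (Real.cos_le_one _)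
  rw [h, sub_nonneg, Real.exp_le_one_iff] at h0
  linarith

/-- The characteristic function of the single measure `μ 1` is continuous at zero, and `L` is minus
its logarithm. This is what later yields tail bounds uniform in `Δ`. -/
theorem IsExponent.tendsto_smul (hL : IsExponent L μ) (hp : IsProbabilityMeasure (μ 1))
    (J : SymMat N) : Tendsto (fun t : ℝ => (L (t • J).evenTraces).re) (𝓝 0) (𝓝 0) := by
  have h1 : Tendsto (fun t : ℝ => ∫ U, Real.cos ((t • J).pair U) ∂(μ 1)) (𝓝 0)
      (𝓝 (∫ U : SymMat N, (1 : ℝ) ∂(μ 1))) := by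
    refine tendsto_integral_filter_of_dominated_convergence (fun _ => 1)
      (Eventually.of_forall fun t => ((t • J).integrable_cos_pair (μ 1)).aestronglyMeasurable)
      (Eventually.of_forall fun t => Eventually.of_forall fun U => Real.abs_cos_le_one _)
      (integrable_const _) (Eventually.of_forall fun U => ?_)
    simp only [SymMat.pair_smul_left]
    have : Continuous fun t : ℝ => Real.cos (t * J.pair U) := by fun_prop
    simpa using this.tendsto 0
  simp only [hL.integral_cos one_pos hp] at h1
  have h2 : ∫ U : SymMat N, (1 : ℝ) ∂(μ 1) = 1 := by simp
  rw [h2] at h1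
  have h3 := ((Real.continuousAt_log one_ne_zero).tendsto.comp h1).neg
  simpa using h3

/-- Uniform smallness of the tails of the entries. -/
theorem IsExponent.tail_entry (hL : IsExponent L μ)
    (hp : ∀ Δ : ℝ, 0 < Δ → IsProbabilityMeasure (μ Δ)) (i j : Fin N) {η : ℝ} (hη : 0 < η) :
    ∀ᶠ r in atTop, ∀ Δ : ℝ, 0 < Δ → (μ Δ).real {U | r < |U.1 i j|} ≤ η * Δ := by
  have h1 := (hL.tendsto_smul (hp 1 one_pos) (SymMat.entry i j)).eventually
    (ge_mem_nhds (show (0 : ℝ) < η / 2 by positivity))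
  obtain ⟨δ, hδ, hδ'⟩ := Metric.eventually_nhds_iff.1 h1
  filter_upwards [eventually_gt_atTop (2 / δ)] with r hr Δ hΔ
  have hr0 : 0 < r := lt_trans (by positivity) hr
  have := hp Δ hΔ
  refine (measureReal_abs_gt_le_of_exponent (μ Δ)
    (φ := fun t => ((Real.exp (-Δ * (L (t • SymMat.entry i j).evenTraces).re) : ℝ) : ℂ))
    (SymMat.continuous_apply i j).measurable (fun t => ?_) hr0 (B := Δ * (η / 2)) ?_).trans_eq
    (by ring)
  · rw [← hL.integral_exp hΔ]
    simp only [SymMat.pair_smul_left, SymMat.pair_entry]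
  · intro t ht
    have h2 := hδ' (y := t) (by
      rw [Real.dist_eq, sub_zero]
      refine ht.trans_lt ?_
      rw [div_lt_iff₀ hr0, ← div_lt_iff₀' hδ]
      exact hr)
    have h3 := hL.re_nonneg (hp 1 one_pos) (t • SymMat.entry i j)
    rw [← Complex.ofReal_one, ← Complex.ofReal_sub, Complex.norm_real, Real.norm_eq_abs,
      abs_of_nonneg]
    · exact (one_sub_exp_neg_mul_le _ _).trans (mul_le_mul_of_nonneg_left h2 hΔ.le)
    · rw [sub_nonneg, Real.exp_le_one_iff]
      nlinarith

/-- The bound `1 - cos y ≥ 2 y² / π²`, valid for `|y| ≤ π`, applied to `y = x / R`, which lies in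
`[-1, 1]`. -/
theorem min_one_sq_le {R x : ℝ} (hR : 1 ≤ R) (hx : |x| ≤ R) :
    x ^ 2 ≤ Real.pi ^ 2 / 2 * R ^ 2 * (1 - Real.cos (R⁻¹ * x)) := by
  have hR0 : 0 < R := by linarith
  have h1 : |R⁻¹ * x| ≤ Real.pi := by
    rw [abs_mul, abs_of_pos (inv_pos.2 hR0), inv_mul_le_iff₀ hR0]
    nlinarith [Real.pi_gt_three]
  have h2 := Real.cos_le_one_sub_mul_cos_sq h1
  have h3 : 2 / Real.pi ^ 2 * (R⁻¹ * x) ^ 2 ≤ 1 - Real.cos (R⁻¹ * x) := by linarith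
  calc x ^ 2 = Real.pi ^ 2 / 2 * R ^ 2 * (2 / Real.pi ^ 2 * (R⁻¹ * x) ^ 2) := by
        field_simp
    _ ≤ _ := by gcongr

/-- Both uniform bounds are obtained entry by entry: moderate entries are controlled by `∫ (1 - cos)
≤ Δ L`, large ones by `IsExponent.tail_entry`. -/
theorem IsExponent.levyFamily (hL : IsExponent L μ)
    (hp : ∀ Δ : ℝ, 0 < Δ → IsProbabilityMeasure (μ Δ)) {σ : Measure (SymMat N)}
    (hσ : SmallVolumeLimit (fun U : SymMat N => U.trPow 2) μ σ) :
    LevyFamily (fun U : SymMat N => U.trPow 2) μ σ where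
  continuous := SymMat.continuous_trPow 2
  isCompact ε R _ := (SymMat.isCompact_trPow_two_le R).of_isClosed_subset
    ((isClosed_le continuous_const (SymMat.continuous_trPow 2)).inter
      (isClosed_le (SymMat.continuous_trPow 2) continuous_const)) fun _ hU => hU.2
  prob := hp
  nonneg _ _ := Eventually.of_forall fun U => U.trPow_two_nonneg
  limit := hσ
  bound := by
    have h1 : ∀ᶠ r in atTop, ∀ i j : Fin N, ∀ Δ : ℝ, 0 < Δ →
        (μ Δ).real {U | r < |U.1 i j|} ≤ 1 * Δ :=
      eventually_all.2 fun i => eventually_all.2 fun j => hL.tail_entry hp i j one_pos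
    obtain ⟨R, hR, hR1⟩ := (h1.and (eventually_ge_atTop 1)).exists
    -- The cosine term dominates `U_ij²` when all entries are at most `R`. Otherwise the weight is
    -- at most one, and the event that a given entry exceeds `R` has probability at most `Δ`, which
    -- accounts for the summand `1`.
    refine ⟨∑ i : Fin N, ∑ j : Fin N, (Real.pi ^ 2 / 2 * R ^ 2 *
      (L (R⁻¹ • SymMat.entry i j).evenTraces).re + 1), fun Δ hΔ => ?_⟩
    have := hp Δ hΔ
    set F : Fin N → Fin N → SymMat N → ℝ := fun i j U =>
      Real.pi ^ 2 / 2 * R ^ 2 * (1 - Real.cos ((R⁻¹ • SymMat.entry i j).pair U)) +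
        Set.indicator {U : SymMat N | R < |U.1 i j|} (fun _ => (1 : ℝ)) U with hF
    have hm : ∀ i j, MeasurableSet {U : SymMat N | R < |U.1 i j|} := fun i j =>
      (isOpen_lt continuous_const (SymMat.continuous_apply i j).abs).measurableSet
    have hi1 : ∀ i j, Integrable (fun U => Real.pi ^ 2 / 2 * R ^ 2 *
        (1 - Real.cos ((R⁻¹ • SymMat.entry i j).pair U))) (μ Δ) := fun i j =>
      ((integrable_const _).sub (SymMat.integrable_cos_pair _ _)).const_mul _
    have hi2 : ∀ i j, Integrable
        (Set.indicator {U : SymMat N | R < |U.1 i j|} (fun _ => (1 : ℝ))) (μ Δ) := fun i j =>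
      (integrable_const _).indicator (hm i j)
    have hFi : ∀ i j, Integrable (F i j) (μ Δ) := fun i j => (hi1 i j).add (hi2 i j)
    have hF0 : ∀ i j U, 0 ≤ F i j U := fun i j U => by
      have h1 := Real.cos_le_one ((R⁻¹ • SymMat.entry i j).pair U)
      have h2 : 0 ≤ Set.indicator {U : SymMat N | R < |U.1 i j|} (fun _ => (1 : ℝ)) U :=
        Set.indicator_nonneg (fun _ _ => zero_le_one) U
      have : 0 ≤ 1 - Real.cos ((R⁻¹ • SymMat.entry i j).pair U) := by linarith
      positivity
    calc ∫ U, U.trPow 2 / (1 + U.trPow 2) ∂(μ Δ) ≤ ∫ U, ∑ i, ∑ j, F i j U ∂(μ Δ) := by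
          refine integral_mono_of_nonneg (Eventually.of_forall fun U => ?_)
            (integrable_finsetSum _ fun i _ => integrable_finsetSum _ fun j _ => hFi i j)
            (Eventually.of_forall fun U => ?_)
          · have := U.trPow_two_nonneg
            exact div_nonneg this (by linarith)
          · have h0 := U.trPow_two_nonneg
            by_cases hU : ∀ i j, |U.1 i j| ≤ R
            · calc U.trPow 2 / (1 + U.trPow 2) ≤ U.trPow 2 :=
                    div_le_self h0 (by linarith)
                _ = ∑ i, ∑ j, U.1 i j ^ 2 := U.trPow_two_eq_sum
                _ ≤ ∑ i, ∑ j, F i j U := by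
                    refine Finset.sum_le_sum fun i _ => Finset.sum_le_sum fun j _ => ?_
                    have h2 : 0 ≤ Set.indicator {U : SymMat N | R < |U.1 i j|}
                      (fun _ => (1 : ℝ)) U := Set.indicator_nonneg (fun _ _ => zero_le_one) U
                    have h3 := min_one_sq_le hR1 (hU i j)
                    simp only [hF, SymMat.pair_smul_left, SymMat.pair_entry]
                    linarith
            · push Not at hU
              obtain ⟨i, j, hij⟩ := hU
              calc U.trPow 2 / (1 + U.trPow 2) ≤ 1 := by
                    rw [div_le_one (by linarith)]
                    linarith
                _ ≤ F i j U := by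
                    have h1 := Real.cos_le_one ((R⁻¹ • SymMat.entry i j).pair U)
                    have h4 : 0 ≤ 1 - Real.cos ((R⁻¹ • SymMat.entry i j).pair U) := by linarith
                    simp only [hF]
                    rw [Set.indicator_of_mem (show U ∈ {U : SymMat N | R < |U.1 i j|} from hij)]
                    have : 0 ≤ Real.pi ^ 2 / 2 * R ^ 2 *
                      (1 - Real.cos ((R⁻¹ • SymMat.entry i j).pair U)) := by positivity
                    linarith
                _ ≤ ∑ j, F i j U := Finset.single_le_sum (f := fun j => F i j U)
                    (fun j _ => hF0 i j U) (Finset.mem_univ j)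
                _ ≤ ∑ i, ∑ j, F i j U := Finset.single_le_sum (f := fun i => ∑ j, F i j U)
                    (fun i _ => Finset.sum_nonneg fun j _ => hF0 i j U) (Finset.mem_univ i)
      _ = ∑ i, ∑ j, ∫ U, F i j U ∂(μ Δ) := by
          rw [integral_finsetSum _ fun i _ => integrable_finsetSum _ fun j _ => hFi i j]
          exact Finset.sum_congr rfl fun i _ => integral_finsetSum _ fun j _ => hFi i j
      _ ≤ (∑ i, ∑ j, (Real.pi ^ 2 / 2 * R ^ 2 *
            (L (R⁻¹ • SymMat.entry i j).evenTraces).re + 1)) * Δ := by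
          rw [Finset.sum_mul]
          refine Finset.sum_le_sum fun i _ => ?_
          rw [Finset.sum_mul]
          refine Finset.sum_le_sum fun j _ => ?_
          rw [integral_add (hi1 i j) (hi2 i j), integral_const_mul,
            hL.integral_one_sub_cos hΔ this, integral_indicator (hm i j), setIntegral_const,
            smul_eq_mul, mul_one, add_mul]
          refine add_le_add ?_ (hR i j Δ hΔ)
          refine (mul_le_mul_of_nonneg_left (one_sub_exp_neg_mul_le _ _)
            (show 0 ≤ Real.pi ^ 2 / 2 * R ^ 2 by positivity)).trans_eq ?_
          ring
  tail η hη := by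
    -- The tail budget is shared among the `N²` entries in a union bound; adding `1` keeps the
    -- denominator positive when `N = 0`.
    set η' : ℝ := η / (N * N + 1) with hη'
    have hη'0 : 0 < η' := by positivity
    have h1 : ∀ᶠ r in atTop, ∀ i j : Fin N, ∀ Δ : ℝ, 0 < Δ →
        (μ Δ).real {U | r < |U.1 i j|} ≤ η' * Δ :=
      eventually_all.2 fun i => eventually_all.2 fun j => hL.tail_entry hp i j hη'0
    obtain ⟨r, hr, hr0⟩ := (h1.and (eventually_ge_atTop (0 : ℝ))).exists
    refine ⟨∑ _i : Fin N, ∑ _j : Fin N, r ^ 2, fun Δ hΔ => ?_⟩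
    have := hp Δ hΔ
    calc (μ Δ).real {U : SymMat N | ∑ _i : Fin N, ∑ _j : Fin N, r ^ 2 < U.trPow 2}
        ≤ (μ Δ).real (⋃ p ∈ (Finset.univ : Finset (Fin N × Fin N)),
            {U : SymMat N | r < |U.1 p.1 p.2|}) := by
          refine measureReal_mono (fun U hU => ?_) (measure_ne_top _ _)
          simp only [Set.mem_iUnion, Finset.mem_univ, exists_prop, true_and]
          by_contra hcon
          push Not at hcon
          have hU' : ∑ _i : Fin N, ∑ _j : Fin N, r ^ 2 < U.trPow 2 := hU
          rw [U.trPow_two_eq_sum] at hU'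
          refine absurd hU' (not_lt.2 (Finset.sum_le_sum fun i _ => Finset.sum_le_sum fun j _ => ?_))
          have : ¬ r < |U.1 i j| := fun h => hcon (i, j) h
          exact sq_le_sq' (by linarith [abs_le.1 (not_lt.1 this)]) (abs_le.1 (not_lt.1 this)).2
      _ ≤ ∑ p : Fin N × Fin N, (μ Δ).real {U : SymMat N | r < |U.1 p.1 p.2|} :=
          measureReal_biUnion_finset_le _ _
      _ ≤ ∑ p : Fin N × Fin N, η' * Δ := Finset.sum_le_sum fun p _ => hr p.1 p.2 Δ hΔ
      _ = (N * N) * η' * Δ := by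
          simp [Fintype.card_prod]
          ring
      _ ≤ η * Δ := by
          gcongr
          rw [hη', mul_div_assoc', div_le_iff₀ (by positivity)]
          nlinarith

end Exponent

/-- Needed so that finite measures on `SymMat N` are determined by their integrals of bounded
continuous functions. -/
instance SymMat.instPseudoMetrizableSpace (N : ℕ) :
    TopologicalSpace.PseudoMetrizableSpace (SymMat N) := by
  have : TopologicalSpace.PseudoMetrizableSpace (Matrix (Fin N) (Fin N) ℝ) :=
    inferInstanceAs (TopologicalSpace.PseudoMetrizableSpace (Fin N → Fin N → ℝ))
  exact SymMat.isClosedEmbedding_val.isEmbedding.isInducing.pseudoMetrizableSpace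

theorem abs_one_sub_cos_sub_le (x : ℝ) : |1 - Real.cos x - x ^ 2 / 2| ≤ x ^ 4 / 2 := by
  rcases le_total |x| 1 with h | h
  · have h1 := Real.cos_bound h
    have h2 : |1 - Real.cos x - x ^ 2 / 2| = |Real.cos x - (1 - x ^ 2 / 2)| := by
      rw [abs_sub_comm (Real.cos x)]
      ring_nf
    have h3 : |x| ^ 4 = x ^ 4 := by rw [← abs_pow, abs_of_nonneg (by positivity)]
    rw [h2]
    rw [h3] at h1
    have : 0 ≤ x ^ 4 := by positivity
    linarith
  · have h1 := Real.one_sub_sq_div_two_le_cos (x := x)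
    have h2 := Real.cos_le_one x
    have h3 : 1 ≤ x ^ 2 := by
      rw [← sq_abs]
      nlinarith
    rw [abs_le]
    constructor <;> nlinarith

namespace SymMat

variable {N : ℕ}

theorem one_sub_cos_pair_le (J U : SymMat N) :
    1 - Real.cos (J.pair U) ≤ (2 + J.trPow 2) * (U.trPow 2 / (1 + U.trPow 2)) := by
  have h0 := U.trPow_two_nonneg
  have h1 := Real.one_sub_sq_div_two_le_cos (x := J.pair U)
  have h2 := Real.neg_one_le_cos (J.pair U)
  have h3 := sq_pair_le J U
  have h4 := J.trPow_two_nonneg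
  have h5 := Real.cos_le_one (J.pair U)
  rw [← mul_div_assoc, le_div_iff₀ (by linarith)]
  nlinarith [mul_nonneg h4 h0]

theorem abs_one_sub_cos_pair_le (J U : SymMat N) :
    |1 - Real.cos (J.pair U)| ≤ (2 + J.trPow 2) * (U.trPow 2 / (1 + U.trPow 2)) := by
  rw [abs_of_nonneg (sub_nonneg.2 (Real.cos_le_one _))]
  exact one_sub_cos_pair_le J U

theorem continuous_one_sub_cos_pair (J : SymMat N) :
    Continuous fun U : SymMat N => 1 - Real.cos (J.pair U) := by
  have := continuous_pair J
  fun_prop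

end SymMat

/-! ### The contribution of the origin is a multiple of `tr J²` -/

section GaussPart

variable {N : ℕ} {L : (ℕ → ℝ) → ℂ} {μ : ℝ → Measure (SymMat N)} {σ : Measure (SymMat N)}

/-- The part of the exponent which is not accounted for by the Lévy measure. -/
noncomputable def gaussPart (L : (ℕ → ℝ) → ℂ) (σ : Measure (SymMat N)) (J : SymMat N) : ℝ :=
  (L J.evenTraces).re - ∫ U in {U : SymMat N | 0 < U.trPow 2}, (1 - Real.cos (J.pair U)) ∂σ

theorem LevyFamily.integrableOn_one_sub_cos
    (h : LevyFamily (fun U : SymMat N => U.trPow 2) μ σ) (J : SymMat N) :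
    IntegrableOn (fun U : SymMat N => 1 - Real.cos (J.pair U)) {U : SymMat N | 0 < U.trPow 2} σ :=
  h.integrableOn_of_le J.continuous_one_sub_cos_pair fun U _ => J.abs_one_sub_cos_pair_le U

theorem IsExponent.tendsto_one_sub_cos (hL : IsExponent L μ)
    (hp : ∀ Δ : ℝ, 0 < Δ → IsProbabilityMeasure (μ Δ)) (J : SymMat N) :
    Tendsto (fun Δ : ℝ => Δ⁻¹ * ∫ U, (1 - Real.cos (J.pair U)) ∂(μ Δ)) (𝓝[>] 0)
      (𝓝 (L J.evenTraces).re) := by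
  refine (tendsto_inv_mul_one_sub_exp _).congr' ?_
  filter_upwards [self_mem_nhdsWithin] with Δ hΔ
  rw [hL.integral_one_sub_cos hΔ (hp Δ hΔ)]

theorem gaussPart_nonneg (hL : IsExponent L μ)
    (h : LevyFamily (fun U : SymMat N => U.trPow 2) μ σ) (J : SymMat N) :
    0 ≤ gaussPart L σ J :=
  sub_nonneg.2 (h.integral_le_of_tendsto J.continuous_one_sub_cos_pair
    (fun _ _ => sub_nonneg.2 (Real.cos_le_one _)) (fun U _ => J.one_sub_cos_pair_le U)
    (hL.tendsto_one_sub_cos h.prob J))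

/-- `gaussPart` satisfies all the linear identities which squares of linear forms satisfy. -/
theorem sum_mul_gaussPart_eq_zero (hL : IsExponent L μ)
    (h : LevyFamily (fun U : SymMat N => U.trPow 2) μ σ) {ι : Type*} [Fintype ι] (c : ι → ℝ)
    (K : ι → SymMat N) (hc : ∀ U : SymMat N, ∑ k, c k * (K k).pair U ^ 2 = 0) :
    ∑ k, c k * gaussPart L σ (K k) = 0 := by
  set ψ : SymMat N → ℝ := fun U => ∑ k, c k * (1 - Real.cos ((K k).pair U)) with hψ
  have hψc : Continuous ψ :=
    continuous_finsetSum _ fun k _ => continuous_const.mul (K k).continuous_one_sub_cos_pair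
  -- One constant for two estimates: `2` bounds `1 - cos`, and the other term comes from the quartic
  -- Taylor remainder combined with Cauchy–Schwarz.
  set C : ℝ := ∑ k, |c k| * (2 + (K k).trPow 2 ^ 2 / 2) with hC
  have h1 : ∀ U, |ψ U| ≤ C := fun U => by
    refine (Finset.abs_sum_le_sum_abs _ _).trans (Finset.sum_le_sum fun k _ => ?_)
    rw [abs_mul]
    refine mul_le_mul_of_nonneg_left ?_ (abs_nonneg _)
    have h1 := Real.neg_one_le_cos ((K k).pair U)
    have h2 := Real.cos_le_one ((K k).pair U)
    rw [abs_of_nonneg (by linarith)]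
    have : 0 ≤ (K k).trPow 2 ^ 2 / 2 := by positivity
    linarith
  have h2 : ∀ U : SymMat N, |ψ U| ≤ C * U.trPow 2 ^ 2 := fun U => by
    -- The quadratic Taylor terms add up to zero by `hc`, so subtracting them changes nothing and
    -- leaves only quartic remainders.
    have he : ψ U = ∑ k, c k * (1 - Real.cos ((K k).pair U) - (K k).pair U ^ 2 / 2) := by
      have : ∑ k, c k * (1 - Real.cos ((K k).pair U) - (K k).pair U ^ 2 / 2) =
          ψ U - (∑ k, c k * (K k).pair U ^ 2) / 2 := by
        rw [hψ, Finset.sum_div, ← Finset.sum_sub_distrib]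
        exact Finset.sum_congr rfl fun k _ => by ring
      rw [this, hc]
      ring
    rw [he, hC, Finset.sum_mul]
    refine (Finset.abs_sum_le_sum_abs _ _).trans (Finset.sum_le_sum fun k _ => ?_)
    rw [abs_mul, mul_assoc]
    refine mul_le_mul_of_nonneg_left ((abs_one_sub_cos_sub_le _).trans ?_) (abs_nonneg _)
    have h3 := (K k).sq_pair_le U
    have h4 : (K k).pair U ^ 4 ≤ (K k).trPow 2 ^ 2 * U.trPow 2 ^ 2 := by
      calc (K k).pair U ^ 4 = ((K k).pair U ^ 2) ^ 2 := by ring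
        _ ≤ ((K k).trPow 2 * U.trPow 2) ^ 2 := by gcongr
        _ = _ := by ring
    have : 0 ≤ U.trPow 2 ^ 2 := by positivity
    nlinarith
  have hlim := h.tendsto_of_le_sq hψc (fun U _ => h1 U) (fun U _ => h2 U)
  have hlim2 : Tendsto (fun Δ : ℝ => Δ⁻¹ * ∫ U, ψ U ∂(μ Δ)) (𝓝[>] 0)
      (𝓝 (∑ k, c k * (L (K k).evenTraces).re)) := by
    have := tendsto_finsetSum Finset.univ fun k _ =>
      (hL.tendsto_one_sub_cos h.prob (K k)).const_mul (c k)
    refine this.congr' ?_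
    filter_upwards [self_mem_nhdsWithin] with Δ hΔ
    have := h.prob Δ hΔ
    have hi : ∀ k, Integrable (fun U => c k * (1 - Real.cos ((K k).pair U))) (μ Δ) := fun k =>
      ((integrable_const _).sub ((K k).integrable_cos_pair _)).const_mul _
    rw [hψ, integral_finsetSum _ fun k _ => hi k, Finset.mul_sum]
    refine Finset.sum_congr rfl fun k _ => ?_
    rw [integral_const_mul]
    ring
  have heq := tendsto_nhds_unique hlim2 hlim
  have hint : ∫ U in {U : SymMat N | 0 < U.trPow 2}, ψ U ∂σ =
      ∑ k, c k * ∫ U in {U : SymMat N | 0 < U.trPow 2}, (1 - Real.cos ((K k).pair U)) ∂σ := by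
    rw [hψ, integral_finsetSum _ fun k _ => (h.integrableOn_one_sub_cos (K k)).const_mul _]
    exact Finset.sum_congr rfl fun k _ => integral_const_mul _ _
  rw [hint] at heq
  simp only [gaussPart, mul_sub, Finset.sum_sub_distrib, heq, sub_self]

theorem gaussPart_smul (hL : IsExponent L μ) (h : LevyFamily (fun U : SymMat N => U.trPow 2) μ σ)
    (t : ℝ) (J : SymMat N) : gaussPart L σ (t • J) = t ^ 2 * gaussPart L σ J := by
  have := sum_mul_gaussPart_eq_zero hL h ![1, -t ^ 2] ![t • J, J] fun U => by
    simp [Fin.sum_univ_two, SymMat.pair_smul_left]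
    ring
  simp [Fin.sum_univ_two] at this
  linarith

theorem gaussPart_parallelogram (hL : IsExponent L μ)
    (h : LevyFamily (fun U : SymMat N => U.trPow 2) μ σ) (A B : SymMat N) :
    gaussPart L σ (A + B) + gaussPart L σ (A - B) =
      2 * (gaussPart L σ A + gaussPart L σ B) := by
  have := sum_mul_gaussPart_eq_zero hL h ![1, 1, -2, -2] ![A + B, A - B, A, B] fun U => by
    simp [Fin.sum_univ_four, SymMat.pair_add_left, SymMat.pair_sub_left]
    ring
  simp [Fin.sum_univ_four] at this
  linarith

/-- The `σ`-integral in `gaussPart` is not visibly a function of even traces. It is however `o(n²)`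
along `n J`, by dominated convergence with the Lévy weight, so homogeneity gives `gaussPart L σ J =
lim n⁻² L(nJ)`, which is such a function. -/
theorem gaussPart_congr (hL : IsExponent L μ) (h : LevyFamily (fun U : SymMat N => U.trPow 2) μ σ)
    {A B : SymMat N} (hAB : A.evenTraces = B.evenTraces) : gaussPart L σ A = gaussPart L σ B := by
  have key : ∀ J : SymMat N, Tendsto (fun n : ℕ => ((n : ℝ) ^ 2)⁻¹ *
      (L ((n : ℝ) • J).evenTraces).re) atTop (𝓝 (gaussPart L σ J)) := by
    intro J
    have h1 : Tendsto (fun n : ℕ => ∫ U in {U : SymMat N | 0 < U.trPow 2},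
        ((n : ℝ) ^ 2)⁻¹ * (1 - Real.cos ((n : ℝ) * J.pair U)) ∂σ) atTop
        (𝓝 (∫ U in {U : SymMat N | 0 < U.trPow 2}, (0 : ℝ) ∂σ)) := by
      refine tendsto_integral_filter_of_dominated_convergence
        (fun U => (2 + J.trPow 2) * (U.trPow 2 / (1 + U.trPow 2)))
        (Eventually.of_forall fun n => ?_) ?_ (h.integrableOn_weight.const_mul _)
        (Eventually.of_forall fun U => ?_)
      · have := J.continuous_pair
        exact Continuous.aestronglyMeasurable (by fun_prop)
      · filter_upwards [eventually_ge_atTop 1] with n hn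
        refine Eventually.of_forall fun U => ?_
        have hn1 : (1 : ℝ) ≤ n := by exact_mod_cast hn
        have hn2 : (1 : ℝ) ≤ (n : ℝ) ^ 2 := by nlinarith
        have h0 := U.trPow_two_nonneg
        have h1 := Real.one_sub_sq_div_two_le_cos (x := n * J.pair U)
        have h2 := Real.neg_one_le_cos (n * J.pair U)
        have h3 := J.sq_pair_le U
        have h4 := J.trPow_two_nonneg
        have h5 := Real.cos_le_one (n * J.pair U)
        have h6 : 0 ≤ ((n : ℝ) ^ 2)⁻¹ * (1 - Real.cos ((n : ℝ) * J.pair U)) := by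
          have : 0 ≤ 1 - Real.cos ((n : ℝ) * J.pair U) := by linarith
          positivity
        rw [Real.norm_eq_abs, abs_of_nonneg h6, inv_mul_le_iff₀ (by positivity),
          ← mul_div_assoc, ← mul_div_assoc, le_div_iff₀ (by linarith)]
        have h7 : 1 - Real.cos (n * J.pair U) ≤ n ^ 2 * (J.trPow 2 * U.trPow 2) := by
          have : (n : ℝ) ^ 2 * J.pair U ^ 2 ≤ n ^ 2 * (J.trPow 2 * U.trPow 2) := by gcongr
          nlinarith [mul_nonneg h4 h0, sq_nonneg ((n : ℝ) * J.pair U)]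
        have h8 : (1 - Real.cos (n * J.pair U)) * U.trPow 2 ≤ n ^ 2 * (2 * U.trPow 2) := by
          nlinarith
        nlinarith
      · refine squeeze_zero_norm (a := fun n : ℕ => ((n : ℝ) ^ 2)⁻¹ * 2) (fun n => ?_) ?_
        · rw [norm_mul, Real.norm_of_nonneg (by positivity : (0 : ℝ) ≤ ((n : ℝ) ^ 2)⁻¹)]
          refine mul_le_mul_of_nonneg_left ?_ (by positivity)
          have h2 := Real.neg_one_le_cos (n * J.pair U)
          have h5 := Real.cos_le_one (n * J.pair U)
          rw [Real.norm_of_nonneg (by linarith)]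
          linarith
        · have := (tendsto_inv_atTop_zero.comp ((tendsto_pow_atTop (α := ℝ)
            two_ne_zero).comp tendsto_natCast_atTop_atTop)).mul_const (2 : ℝ)
          simpa using this
    rw [integral_zero] at h1
    have h2 := h1.const_add (gaussPart L σ J)
    rw [add_zero] at h2
    refine h2.congr' ?_
    filter_upwards [eventually_ge_atTop 1] with n hn
    have hn1 : (n : ℝ) ≠ 0 := by
      have : (1 : ℝ) ≤ n := by exact_mod_cast hn
      positivity
    have h3 := gaussPart_smul hL h n J
    have h4 : gaussPart L σ J = ((n : ℝ) ^ 2)⁻¹ * gaussPart L σ ((n : ℝ) • J) := by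
      rw [h3]
      field_simp
    rw [h4, gaussPart, integral_const_mul, mul_sub]
    simp only [SymMat.pair_smul_left]
    ring
  refine tendsto_nhds_unique (key A) ((key B).congr fun n => ?_)
  rw [SymMat.evenTraces_smul_congr hAB]

theorem SymMat.evenTraces_diag (d : Fin N → ℝ) (p : ℕ) :
    (SymMat.diag d).evenTraces p = ∑ i, d i ^ (2 * (p + 1)) := by
  simp [SymMat.evenTraces, SymMat.trPow, SymMat.diag, Matrix.diagonal_pow, Matrix.trace_diagonal]

/-- One diagonal entry is added at a time. The parallelogram law becomes additivity once the values
at `A + B` and `A - B` are known to agree. -/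
theorem gaussPart_diag (hL : IsExponent L μ) (h : LevyFamily (fun U : SymMat N => U.trPow 2) μ σ)
    (d : Fin N → ℝ) : gaussPart L σ (SymMat.diag d) =
      ∑ i, d i ^ 2 * gaussPart L σ (SymMat.diag (Pi.single i 1)) := by
  have key : ∀ S : Finset (Fin N), gaussPart L σ (SymMat.diag fun i => if i ∈ S then d i else 0) =
      ∑ i ∈ S, d i ^ 2 * gaussPart L σ (SymMat.diag (Pi.single i 1)) := by
    intro S
    induction S using Finset.induction_on with
    | empty =>
      have h0 : (SymMat.diag fun i : Fin N => if i ∈ (∅ : Finset (Fin N)) then d i else 0) =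
          (0 : ℝ) • SymMat.diag fun i : Fin N => if i ∈ (∅ : Finset (Fin N)) then d i else 0 := by
        refine Subtype.ext ?_
        simp [SymMat.val_smul, SymMat.diag]
      rw [h0, gaussPart_smul hL h]
      simp
    | insert i S hi ih =>
      set A := SymMat.diag fun i => if i ∈ S then d i else 0 with hA
      set B := (d i) • SymMat.diag (N := N) (Pi.single i 1) with hB
      have hBv : B.1 = Matrix.diagonal (Pi.single i (d i)) := by
        rw [hB, SymMat.val_smul, SymMat.diag, ← Matrix.diagonal_smul]
        congr 1
        funext j
        by_cases hj : j = i
        · subst hj; simp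
        · simp [hj]
      have hAB : A.1 * B.1 = 0 ∧ B.1 * A.1 = 0 := by
        have hz : ∀ j, (if j ∈ S then d j else 0) * (Pi.single i (d i) : Fin N → ℝ) j = 0 := by
          intro j
          by_cases hj : j = i
          · subst hj; simp [hi]
          · simp [hj]
        rw [hBv, hA, SymMat.diag, Matrix.diagonal_mul_diagonal, Matrix.diagonal_mul_diagonal]
        refine ⟨?_, ?_⟩
        · simp only [hz]; exact Matrix.diagonal_zero
        · simp only [mul_comm ((Pi.single i (d i) : Fin N → ℝ) _), hz]; exact Matrix.diagonal_zero
      have hsum : (SymMat.diag fun j => if j ∈ insert i S then d j else 0) = A + B := by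
        refine Subtype.ext ?_
        rw [SymMat.val_add, hBv, hA, SymMat.diag, SymMat.diag, Matrix.diagonal_add]
        refine congrArg Matrix.diagonal (funext fun j => ?_)
        by_cases hj : j = i
        · subst hj; simp [hi]
        · simp [hj]
      -- Disjoint supports give `AB = BA = 0`, so the two matrices have the same square and the same
      -- even traces.
      have hflip : gaussPart L σ (A + B) = gaussPart L σ (A - B) := by
        refine gaussPart_congr hL h (SymMat.evenTraces_congr ?_)
        rw [SymMat.val_add, SymMat.val_sub]
        simp only [add_mul, mul_add, sub_mul, mul_sub, hAB.1, hAB.2]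
        abel
      have hpar := gaussPart_parallelogram hL h A B
      rw [← hflip] at hpar
      rw [hsum, Finset.sum_insert hi, ← ih, ← gaussPart_smul hL h]
      linarith
  simpa using key Finset.univ

/-- Diagonalization reduces to `gaussPart_diag`. The coefficients there coincide because every even
trace of a coordinate projection is `1`. -/
theorem exists_gaussPart_eq (hL : IsExponent L μ)
    (h : LevyFamily (fun U : SymMat N => U.trPow 2) μ σ) :
    ∃ a : ℝ, 0 ≤ a ∧ ∀ J : SymMat N, gaussPart L σ J = a * J.trPow 2 := by
  have hred : ∀ a : ℝ, (∀ i, gaussPart L σ (SymMat.diag (Pi.single i 1)) = a) →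
      ∀ J : SymMat N, gaussPart L σ J = a * J.trPow 2 := by
    intro a ha J
    obtain ⟨d, hd⟩ := J.exists_diag
    have h2 : J.trPow 2 = ∑ i, d i ^ 2 := by
      have := congrFun hd 0
      rw [SymMat.evenTraces_diag] at this
      simpa [SymMat.evenTraces] using this
    rw [gaussPart_congr hL h hd, gaussPart_diag hL h, h2, Finset.mul_sum]
    exact Finset.sum_congr rfl fun i _ => by rw [ha, mul_comm]
  rcases isEmpty_or_nonempty (Fin N) with hN | ⟨⟨i₀⟩⟩
  · exact ⟨0, le_rfl, hred 0 fun i => hN.elim i⟩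
  · refine ⟨gaussPart L σ (SymMat.diag (Pi.single i₀ 1)), gaussPart_nonneg hL h _,
      hred _ fun i => gaussPart_congr hL h ?_⟩
    have : ∀ (i : Fin N) (p : ℕ), (SymMat.diag (Pi.single i (1 : ℝ))).evenTraces p = 1 := by
      intro i p
      rw [SymMat.evenTraces_diag, Finset.sum_eq_single i]
      · simp
      · intro j _ hj
        simp [hj]
      · simp
    funext p
    rw [this, this]

end GaussPart

/-! ### The formula at finite `N` -/

theorem levy_khintchine_finite {N : ℕ} (L : (ℕ → ℝ) → ℂ) (μ : ℝ → Measure (SymMat N))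
    (σ : Measure (SymMat N)) (hp : ∀ Δ : ℝ, 0 < Δ → IsProbabilityMeasure (μ Δ))
    (hO : ∀ Δ : ℝ, 0 < Δ → OrthInvariant (μ Δ)) (hL : IsExponent L μ)
    (hσ : SmallVolumeLimit (fun U : SymMat N => U.trPow 2) μ σ) :
    OrthInvariant (σ.restrict {U : SymMat N | 0 < U.trPow 2}) ∧
      IntegrableOn (fun U : SymMat N => U.trPow 2 / (1 + U.trPow 2))
        {U : SymMat N | 0 < U.trPow 2} σ ∧
      ∃ a : ℝ, 0 ≤ a ∧ ∀ J : SymMat N,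
        IntegrableOn (fun U : SymMat N => 1 - Real.cos (J.pair U))
          {U : SymMat N | 0 < U.trPow 2} σ ∧
        L J.evenTraces =
          ((a * J.trPow 2 +
            ∫ U in {U : SymMat N | 0 < U.trPow 2}, (1 - Real.cos (J.pair U)) ∂σ : ℝ) : ℂ) ∧
        (∀ ε : ℝ, 0 < ε →
          IntegrableOn (fun U : SymMat N => 1 - Complex.exp (Complex.I * (J.pair U : ℂ)))
            {U : SymMat N | ε < U.trPow 2} σ) ∧
        Tendsto (fun ε : ℝ => ((a * J.trPow 2 : ℝ) : ℂ) +
            ∫ U in {U : SymMat N | ε < U.trPow 2},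
              (1 - Complex.exp (Complex.I * (J.pair U : ℂ))) ∂σ)
          (𝓝[>] 0) (𝓝 (L J.evenTraces)) := by
  have h := hL.levyFamily hp hσ
  have hmε : ∀ ε : ℝ, MeasurableSet {U : SymMat N | ε < U.trPow 2} := fun ε =>
    (isOpen_lt continuous_const (SymMat.continuous_trPow 2)).measurableSet
  have hsub : ∀ ε : ℝ, 0 < ε →
      {U : SymMat N | ε < U.trPow 2} ⊆ {U : SymMat N | 0 < U.trPow 2} :=
    fun ε hε U hU => hε.trans hU
  obtain ⟨a, ha, hQ⟩ := exists_gaussPart_eq hL h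
  -- The reflection `U ↦ -U` is not a conjugation, so orthogonal invariance does not give this
  -- symmetry. It comes from Fourier uniqueness: the characteristic functions are even in `J`.
  have hneg : (σ.restrict {U : SymMat N | 0 < U.trPow 2}).map (fun U => -U) =
      σ.restrict {U : SymMat N | 0 < U.trPow 2} := by
    refine h.map_restrict_eq SymMat.continuous_neg SymMat.trPow_two_neg fun Δ hΔ => ?_
    have := hp Δ hΔ
    have := Measure.isProbabilityMeasure_map (μ := μ Δ)
      (SymMat.continuous_neg (N := N)).measurable.aemeasurable
    refine SymMat.ext_of_charFun fun J => ?_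
    have hc : Continuous fun U : SymMat N => Complex.exp (Complex.I * (J.pair U : ℂ)) := by
      have := J.continuous_pair
      fun_prop
    rw [integral_map SymMat.continuous_neg.measurable.aemeasurable hc.aestronglyMeasurable]
    simp only [SymMat.pair_neg_right, ← SymMat.pair_neg_left]
    rw [hL.integral_exp hΔ, hL.integral_exp hΔ, SymMat.evenTraces_neg]
  refine ⟨fun O => h.map_restrict_eq (SymMat.continuous_conj O)
    (fun U => SymMat.trPow_conj O U 2) (fun Δ hΔ => hO Δ hΔ O), h.integrableOn_weight, a, ha,
    fun J => ?_⟩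
  have hic := h.integrableOn_one_sub_cos J
  have hform : L J.evenTraces = ((a * J.trPow 2 +
      ∫ U in {U : SymMat N | 0 < U.trPow 2}, (1 - Real.cos (J.pair U)) ∂σ : ℝ) : ℂ) := by
    rw [← hL.ofReal_re J, ← hQ J, gaussPart]
    congr 1
    ring
  have hie : ∀ ε : ℝ, 0 < ε →
      IntegrableOn (fun U : SymMat N => 1 - Complex.exp (Complex.I * (J.pair U : ℂ)))
        {U : SymMat N | ε < U.trPow 2} σ := by
    intro ε hε
    -- The integrand is bounded by `2`, and the weight is at least `ε / (1 + ε)` on this set.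
    refine ((h.integrableOn_weight.mono_set (hsub ε hε)).const_mul (2 * ((1 + ε) / ε))).mono' ?_ ?_
    · have := J.continuous_pair
      exact Continuous.aestronglyMeasurable (by fun_prop)
    · filter_upwards [ae_restrict_mem (hmε ε)] with U hU
      have hU' : ε < U.trPow 2 := hU
      have h1 : ‖1 - Complex.exp (Complex.I * (J.pair U : ℂ))‖ ≤ 2 := by
        refine (norm_sub_le _ _).trans ?_
        rw [mul_comm, Complex.norm_exp_ofReal_mul_I]
        norm_num
      refine h1.trans ?_
      rw [mul_assoc]
      refine le_mul_of_one_le_right zero_le_two ?_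
      rw [div_mul_div_comm, one_le_div (by nlinarith)]
      nlinarith
  refine ⟨hic, hform, hie, ?_⟩
  have hreal : ∀ ε : ℝ, 0 < ε → ∫ U in {U : SymMat N | ε < U.trPow 2},
      (1 - Complex.exp (Complex.I * (J.pair U : ℂ))) ∂σ =
      ((∫ U in {U : SymMat N | ε < U.trPow 2}, (1 - Real.cos (J.pair U)) ∂σ : ℝ) : ℂ) := by
    intro ε hε
    refine Complex.ext ?_ ?_
    · have h1 := integral_re (hie ε hε)
      simp only [RCLike.re_to_complex, Complex.sub_re, Complex.one_re, exp_I_mul_re] at h1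
      rw [Complex.ofReal_re]
      exact h1.symm
    · have h1 := integral_im (hie ε hε)
      simp only [RCLike.im_to_complex, Complex.sub_im, Complex.one_im, exp_I_mul_im,
        zero_sub] at h1
      rw [Complex.ofReal_im, ← h1]
      set g : SymMat N → ℝ := Set.indicator {U : SymMat N | ε < U.trPow 2}
        (fun U => -Real.sin (J.pair U)) with hg
      have hgm : Measurable g := by
        have := J.continuous_pair
        exact Measurable.indicator (Continuous.measurable (by fun_prop)) (hmε ε)
      have h2 : ∫ U in {U : SymMat N | ε < U.trPow 2}, -Real.sin (J.pair U) ∂σ =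
          ∫ U in {U : SymMat N | 0 < U.trPow 2}, g U ∂σ := by
        rw [hg, setIntegral_indicator (hmε ε), Set.inter_eq_self_of_subset_right (hsub ε hε)]
      -- The truncated sine is odd and the restricted Lévy measure is symmetric, so the imaginary
      -- part equals its own negative.
      have h3 : ∫ U in {U : SymMat N | 0 < U.trPow 2}, g U ∂σ =
          -∫ U in {U : SymMat N | 0 < U.trPow 2}, g U ∂σ := by
        conv_lhs => rw [← hneg]
        rw [integral_map SymMat.continuous_neg.measurable.aemeasurable hgm.aestronglyMeasurable,
          ← integral_neg]
        refine integral_congr_ae (Eventually.of_forall fun U => ?_)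
        simp only [hg, Set.indicator_apply, Set.mem_ofPred_eq, SymMat.trPow_two_neg,
          SymMat.pair_neg_right, Real.sin_neg]
        split_ifs <;> simp
      rw [h2]
      linarith
  have hlim : Tendsto (fun ε : ℝ => ∫ U in {U : SymMat N | ε < U.trPow 2},
      (1 - Real.cos (J.pair U)) ∂σ) (𝓝[>] 0)
      (𝓝 (∫ U in {U : SymMat N | 0 < U.trPow 2}, (1 - Real.cos (J.pair U)) ∂σ)) := by
    have h1 : Tendsto (fun ε : ℝ => ∫ U in {U : SymMat N | 0 < U.trPow 2},
        Set.indicator {U : SymMat N | ε < U.trPow 2} (fun U => 1 - Real.cos (J.pair U)) U ∂σ)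
        (𝓝[>] 0)
        (𝓝 (∫ U in {U : SymMat N | 0 < U.trPow 2}, (1 - Real.cos (J.pair U)) ∂σ)) := by
      refine tendsto_integral_filter_of_dominated_convergence
        (fun U => ‖1 - Real.cos (J.pair U)‖) (Eventually.of_forall fun ε => ?_)
        (Eventually.of_forall fun ε => Eventually.of_forall fun U => norm_indicator_le_norm_self _ _)
        hic.norm ?_
      · exact (J.continuous_one_sub_cos_pair.measurable.indicator (hmε ε)).aestronglyMeasurable
      · filter_upwards [ae_restrict_mem (hmε 0)] with U hU
        refine tendsto_const_nhds.congr' ?_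
        filter_upwards [Ioo_mem_nhdsGT (show (0 : ℝ) < U.trPow 2 from hU)] with ε hε
        rw [Set.indicator_of_mem (show U ∈ {U : SymMat N | ε < U.trPow 2} from hε.2)]
    refine h1.congr' ?_
    filter_upwards [self_mem_nhdsWithin] with ε hε
    rw [setIntegral_indicator (hmε ε), Set.inter_eq_self_of_subset_right (hsub ε hε)]
  have hlim2 := ((Complex.continuous_ofReal.tendsto _).comp hlim).const_add
    ((a * J.trPow 2 : ℝ) : ℂ)
  rw [hform, Complex.ofReal_add]
  refine hlim2.congr' ?_
  filter_upwards [self_mem_nhdsWithin] with ε hε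
  rw [hreal ε hε]
  rfl

/-! ### Integration by parts along the orbits of the orthogonal group -/

theorem integrable_of_isCompact {X E : Type*} [TopologicalSpace X] [MeasurableSpace X]
    [OpensMeasurableSpace X] [NormedAddCommGroup E] [SecondCountableTopology E] {μ : Measure X}
    [IsFiniteMeasure μ] {K : Set X} (hK : IsCompact K) (hμ : ∀ᵐ x ∂μ, x ∈ K) {f : X → E}
    (hf : Continuous f) : Integrable f μ := by
  obtain ⟨C, hC⟩ := hK.exists_bound_of_continuousOn hf.continuousOn
  exact Integrable.of_bound hf.aestronglyMeasurable C (hμ.mono hC)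

theorem hasDerivAt_integral_of_isCompact {X : Type*} [TopologicalSpace X] [MeasurableSpace X]
    [OpensMeasurableSpace X] {μ : Measure X} [IsFiniteMeasure μ] {K : Set X} (hK : IsCompact K)
    (hμ : ∀ᵐ x ∂μ, x ∈ K) {F F' : ℝ → X → ℂ} (hF : ∀ t, Continuous (F t))
    (hF' : Continuous fun p : ℝ × X => F' p.1 p.2)
    (hd : ∀ t x, HasDerivAt (fun t => F t x) (F' t x) t) (t₀ : ℝ) :
    HasDerivAt (fun t => ∫ x, F t x ∂μ) (∫ x, F' t₀ x ∂μ) t₀ := by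
  obtain ⟨C, hC⟩ := ((isCompact_Icc (a := t₀ - 1) (b := t₀ + 1)).prod hK).exists_bound_of_continuousOn
    hF'.continuousOn
  refine (hasDerivAt_integral_of_dominated_loc_of_deriv_le
    (Icc_mem_nhds (show t₀ - 1 < t₀ by linarith) (show t₀ < t₀ + 1 by linarith))
    (Eventually.of_forall fun t => (hF t).aestronglyMeasurable)
    (integrable_of_isCompact hK hμ (hF t₀))
    (hF'.comp (Continuous.prodMk_right t₀)).aestronglyMeasurable (bound := fun _ => C) ?_
    (integrable_const C) (Eventually.of_forall fun x t _ => hd t x)).2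
  filter_upwards [hμ] with x hx t ht using hC (t, x) ⟨ht, hx⟩

section RotationTrace

variable {n : Type*} [Fintype n]

/-- `tr (B R M Rᵀ)` for `R = rot A θ`, as a trigonometric polynomial. -/
noncomputable def rotTrace (A B M : Matrix n n ℝ) (θ : ℝ) : ℝ :=
  (B * M).trace + Real.sin θ * (B * (A * M - M * A)).trace +
    (1 - Real.cos θ) * (B * (A * A * M + M * (A * A))).trace -
    Real.sin θ ^ 2 * (B * (A * M * A)).trace +
    Real.sin θ * (1 - Real.cos θ) * (B * (A * M * (A * A) - A * A * M * A)).trace +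
    (1 - Real.cos θ) ^ 2 * (B * (A * A * M * (A * A))).trace

noncomputable def rotTraceDeriv (A B M : Matrix n n ℝ) (θ : ℝ) : ℝ :=
  Real.cos θ * (B * (A * M - M * A)).trace +
    Real.sin θ * (B * (A * A * M + M * (A * A))).trace -
    2 * Real.sin θ * Real.cos θ * (B * (A * M * A)).trace +
    (Real.cos θ * (1 - Real.cos θ) + Real.sin θ * Real.sin θ) *
      (B * (A * M * (A * A) - A * A * M * A)).trace +
    2 * (1 - Real.cos θ) * Real.sin θ * (B * (A * A * M * (A * A))).trace

theorem hasDerivAt_rotTrace (A B M : Matrix n n ℝ) (θ : ℝ) :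
    HasDerivAt (rotTrace A B M) (rotTraceDeriv A B M θ) θ := by
  have hs := Real.hasDerivAt_sin θ
  have hc := (Real.hasDerivAt_cos θ).const_sub 1
  have h := (((((hs.mul_const (B * (A * M - M * A)).trace).const_add (B * M).trace).add
    (hc.mul_const (B * (A * A * M + M * (A * A))).trace)).sub
    ((hs.pow 2).mul_const (B * (A * M * A)).trace)).add
    ((hs.mul hc).mul_const (B * (A * M * (A * A) - A * A * M * A)).trace)).add
    ((hc.pow 2).mul_const (B * (A * A * M * (A * A))).trace)
  refine h.congr_deriv ?_
  simp only [rotTraceDeriv]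
  push_cast
  ring

theorem rotTrace_zero (A B M : Matrix n n ℝ) : rotTrace A B M 0 = (B * M).trace := by
  simp [rotTrace]

theorem rotTraceDeriv_zero (A B M : Matrix n n ℝ) :
    rotTraceDeriv A B M 0 = (B * (A * M - M * A)).trace := by
  simp [rotTraceDeriv]

end RotationTrace

section Rotation

variable {n : Type*} [DecidableEq n]

/-- The infinitesimal rotation in the coordinate plane `(i, j)`. -/
def skew (i j : n) : Matrix n n ℝ := Matrix.single i j 1 - Matrix.single j i 1

theorem skew_transpose (i j : n) : (skew i j).transpose = -skew i j := by
  simp [skew, Matrix.transpose_single]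

variable [Fintype n]

/-- This identity collapses the exponential series of `θ A` to the three terms of `rot`. It includes
`i = j`, where the generator is zero, so sums may run over all pairs. -/
theorem skew_cube (i j : n) : skew i j * skew i j * skew i j = -skew i j := by
  by_cases h : i = j
  · subst h
    simp [skew]
  · have h' : j ≠ i := fun h2 => h h2.symm
    simp [skew, sub_mul, mul_sub, h, h']
    abel

/-- `exp (θ A)` for `A` with `A³ = -A`. -/
noncomputable def rot (A : Matrix n n ℝ) (θ : ℝ) : Matrix n n ℝ :=
  1 + Real.sin θ • A + (1 - Real.cos θ) • (A * A)

theorem rot_transpose {A : Matrix n n ℝ} (hA : A.transpose = -A) (θ : ℝ) :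
    (rot A θ).transpose = 1 - Real.sin θ • A + (1 - Real.cos θ) • (A * A) := by
  simp [rot, Matrix.transpose_add, Matrix.transpose_smul, Matrix.transpose_mul, hA, sub_eq_add_neg]

theorem rot_mem {A : Matrix n n ℝ} (hA : A.transpose = -A) (hA3 : A * A * A = -A) (θ : ℝ) :
    rot A θ ∈ Matrix.orthogonalGroup n ℝ := by
  rw [Matrix.mem_orthogonalGroup_iff, rot_transpose hA, rot]
  have h4 : A * A * (A * A) = -(A * A) := by
    rw [← Matrix.mul_assoc, hA3, Matrix.neg_mul]
  have h5 : A * (A * A) = -A := by rw [← Matrix.mul_assoc, hA3]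
  simp only [add_mul, mul_add, mul_sub, Matrix.smul_mul, Matrix.mul_smul, Matrix.one_mul,
    Matrix.mul_one, h4, h5, hA3]
  have hs := Real.sin_sq_add_cos_sq θ
  -- This is the coefficient of `A²` in the product of the rotation with its transpose.
  have key : (2 * (1 - Real.cos θ) - Real.sin θ * Real.sin θ -
      (1 - Real.cos θ) * (1 - Real.cos θ)) = 0 := by nlinarith
  have : (1 : Matrix n n ℝ) = 1 + (2 * (1 - Real.cos θ) - Real.sin θ * Real.sin θ -
      (1 - Real.cos θ) * (1 - Real.cos θ)) • (A * A) := by rw [key]; simp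
  conv_rhs => rw [this]
  module

theorem trace_mul_rot {A : Matrix n n ℝ} (hA : A.transpose = -A) (B M : Matrix n n ℝ) (θ : ℝ) :
    (B * (rot A θ * M * (rot A θ).transpose)).trace = rotTrace A B M θ := by
  have h : rot A θ * M * (rot A θ).transpose = M + Real.sin θ • (A * M - M * A) +
      (1 - Real.cos θ) • (A * A * M + M * (A * A)) - (Real.sin θ ^ 2) • (A * M * A) +
      (Real.sin θ * (1 - Real.cos θ)) • (A * M * (A * A) - A * A * M * A) +
      ((1 - Real.cos θ) ^ 2) • (A * A * M * (A * A)) := by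
    rw [rot_transpose hA, rot]
    simp only [add_mul, mul_add, mul_sub, Matrix.smul_mul, Matrix.mul_smul, Matrix.one_mul,
      Matrix.mul_one]
    module
  rw [h]
  simp only [mul_add (a := B), mul_sub (a := B), Matrix.mul_smul, Matrix.trace_add,
    Matrix.trace_sub, Matrix.trace_smul, smul_eq_mul, rotTrace]

theorem trace_skew_mul (i j : n) (X : Matrix n n ℝ) : (skew i j * X).trace = X j i - X i j := by
  simp [skew, sub_mul, Matrix.trace_sub, Matrix.trace_single_mul]

theorem mul_single_mul_apply (Y Z : Matrix n n ℝ) (k l a b : n) :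
    (Y * Matrix.single k l (1 : ℝ) * Z) a b = Y a k * Z l b := by
  rw [Matrix.mul_apply, Finset.sum_eq_single l]
  · simp
  · intro m _ hm
    rw [Matrix.mul_single_apply_of_ne _ _ _ _ _ hm, zero_mul]
  · simp

/-- Contraction over a basis of antisymmetric matrices, each coordinate plane being counted twice
since the pairs are ordered. -/
theorem sum_trace_skew (Y Z : Matrix n n ℝ) :
    ∑ i, ∑ j, (skew i j * (Y * skew i j * Z)).trace =
      2 * (Y * Z.transpose).trace - 2 * (Y.trace * Z.trace) := by
  have h : ∀ i j, (skew i j * (Y * skew i j * Z)).trace =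
      Y j i * Z j i + Y i j * Z i j - (Y j j * Z i i + Y i i * Z j j) := by
    intro i j
    rw [trace_skew_mul, skew]
    simp only [mul_sub, sub_mul, Matrix.sub_apply, mul_single_mul_apply]
    ring
  have h1 : (Y * Z.transpose).trace = ∑ i, ∑ j, Y i j * Z i j := by
    simp [Matrix.trace, Matrix.mul_apply]
  have h2 : Y.trace * Z.trace = ∑ i, ∑ j, Y i i * Z j j := by
    simp [Matrix.trace, Finset.sum_mul_sum]
  have h3 : ∑ i, ∑ j, Y j i * Z j i = ∑ i, ∑ j, Y i j * Z i j := Finset.sum_comm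
  have h4 : ∑ i, ∑ j, Y j j * Z i i = ∑ i, ∑ j, Y i i * Z j j := Finset.sum_comm
  simp only [h, Finset.sum_sub_distrib, Finset.sum_add_distrib, h3, h4, h1, h2]
  ring

end Rotation

namespace SymMat

variable {N : ℕ}

/-- `tr [U, J] [U, J]ᵀ`. -/
def commSq (U J : SymMat N) : ℝ := ∑ i, ∑ j, (U.1 * J.1 - J.1 * U.1) i j ^ 2

theorem continuous_commSq (J : SymMat N) : Continuous fun U : SymMat N => commSq U J := by
  unfold commSq
  have h : Continuous fun U : SymMat N => U.1 * J.1 - J.1 * U.1 :=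
    (continuous_val.matrix_mul continuous_const).sub (continuous_const.matrix_mul continuous_val)
  exact continuous_finsetSum _ fun i _ => continuous_finsetSum _ fun j _ =>
    (h.matrix_elem i j).pow 2

/-- The sum of the second derivatives of `tr JU` along the rotations. The term `tr U tr J` produced
by the contraction disappears because `J` is traceless, which makes the linear form an
eigenfunction. -/
theorem sum_casimir (J U : SymMat N) (hJ : J.1.trace = 0) :
    ∑ i, ∑ j, ((J.1 * skew i j - skew i j * J.1) * (skew i j * U.1 - U.1 * skew i j)).trace =
      -(4 * N * J.pair U) := by
  have hJt : J.1.transpose = J.1 := J.2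
  have hUt : U.1.transpose = U.1 := U.2
  have h : ∀ i j, ((J.1 * skew i j - skew i j * J.1) *
      (skew i j * U.1 - U.1 * skew i j)).trace =
      (skew i j * (1 * skew i j * (U.1 * J.1))).trace -
      (skew i j * (U.1 * skew i j * J.1)).trace -
      (skew i j * (J.1 * skew i j * U.1)).trace +
      (skew i j * (1 * skew i j * (J.1 * U.1))).trace := by
    intro i j
    generalize skew i j = A
    have e1 : (A * (1 * A * (U.1 * J.1))).trace = (J.1 * A * (A * U.1)).trace := by
      rw [Matrix.one_mul, ← Matrix.mul_assoc A U.1, ← Matrix.mul_assoc, Matrix.trace_mul_comm,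
        Matrix.mul_assoc J.1]
    have e2 : (A * (U.1 * A * J.1)).trace = (J.1 * A * (U.1 * A)).trace := by
      rw [← Matrix.mul_assoc, Matrix.trace_mul_comm, Matrix.mul_assoc]
    have e3 : (A * (J.1 * A * U.1)).trace = (A * J.1 * (A * U.1)).trace := by
      simp only [Matrix.mul_assoc]
    have e4 : (A * (1 * A * (J.1 * U.1))).trace = (A * J.1 * (U.1 * A)).trace := by
      rw [Matrix.one_mul, Matrix.trace_mul_comm]
      simp only [Matrix.mul_assoc]
    rw [e1, e2, e3, e4]
    simp only [sub_mul, mul_sub, Matrix.trace_sub]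
    ring
  simp only [h, Finset.sum_add_distrib, Finset.sum_sub_distrib, sum_trace_skew]
  simp only [Matrix.transpose_mul, hJt, hUt, Matrix.one_mul, Matrix.trace_one, Fintype.card_fin,
    hJ]
  have e : (U.1 * J.1).trace = (J.1 * U.1).trace := Matrix.trace_mul_comm _ _
  rw [e, pair]
  ring

/-- The squared gradient of `tr JU` along the orbit. Each factor is the derivative `tr (A [U,J])`
for a generator `A`; as the commutator is antisymmetric, this is `-2` times one of its entries. -/
theorem sum_carre (J U : SymMat N) :
    ∑ i, ∑ j, ((J.1 * skew i j - skew i j * J.1) * U.1).trace *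
      (J.1 * (skew i j * U.1 - U.1 * skew i j)).trace = 4 * commSq U J := by
  have hJt : J.1.transpose = J.1 := J.2
  have hUt : U.1.transpose = U.1 := U.2
  have hC : ∀ i j, (U.1 * J.1 - J.1 * U.1) j i = -(U.1 * J.1 - J.1 * U.1) i j := by
    intro i j
    have : (U.1 * J.1 - J.1 * U.1).transpose = -(U.1 * J.1 - J.1 * U.1) := by
      simp [Matrix.transpose_sub, Matrix.transpose_mul, hJt, hUt]
    exact congrFun (congrFun this i) j
  rw [commSq, Finset.mul_sum]
  refine Finset.sum_congr rfl fun i _ => ?_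
  rw [Finset.mul_sum]
  refine Finset.sum_congr rfl fun j _ => ?_
  have h1 : ((J.1 * skew i j - skew i j * J.1) * U.1).trace =
      (skew i j * (U.1 * J.1 - J.1 * U.1)).trace := by
    simp only [sub_mul, mul_sub, Matrix.trace_sub]
    rw [Matrix.mul_assoc J.1, Matrix.trace_mul_comm J.1, ← Matrix.mul_assoc, ← Matrix.mul_assoc]
  have h2 : (J.1 * (skew i j * U.1 - U.1 * skew i j)).trace =
      (skew i j * (U.1 * J.1 - J.1 * U.1)).trace := by
    simp only [mul_sub, Matrix.trace_sub]
    rw [Matrix.trace_mul_comm J.1, Matrix.mul_assoc, ← Matrix.mul_assoc J.1,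
      Matrix.trace_mul_comm (J.1 * U.1)]
  rw [h1, h2, trace_skew_mul, hC i j]
  ring

end SymMat

section Stein

variable {N : ℕ} {μ : Measure (SymMat N)} [IsFiniteMeasure μ] {K : Set (SymMat N)}

theorem SymMat.continuous_trace_mul (B : Matrix (Fin N) (Fin N) ℝ)
    {f : SymMat N → Matrix (Fin N) (Fin N) ℝ} (hf : Continuous f) :
    Continuous fun U => (B * f U).trace :=
  (continuous_const.matrix_mul hf).matrix_trace

/-- By invariance the integral of the rotated integrand is constant in the angle; the integrand
displayed here is its derivative at angle zero. The factor `H`, being invariant, is not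
differentiated. -/
theorem integral_skew_eq_zero (hμ : OrthInvariant μ) (hK : IsCompact K) (hμK : ∀ᵐ U ∂μ, U ∈ K)
    {A : Matrix (Fin N) (Fin N) ℝ} (hA : A.transpose = -A) (hA3 : A * A * A = -A)
    (B J : Matrix (Fin N) (Fin N) ℝ) {g g' : ℝ → ℂ} (hg : ∀ x, HasDerivAt g (g' x) x)
    (hg' : Continuous g') {H : SymMat N → ℂ} (hH : Continuous H)
    (hHO : ∀ O U, H (SymMat.conj O U) = H U) :
    ∫ U, H U * (((B * (A * U.1 - U.1 * A)).trace : ℂ) * g (J * U.1).trace +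
      ((B * U.1).trace : ℂ) * (g' (J * U.1).trace * ((J * (A * U.1 - U.1 * A)).trace : ℂ))) ∂μ
      = 0 := by
  have hgc : Continuous g := continuous_iff_continuousAt.2 fun x => (hg x).continuousAt
  have hv := SymMat.continuous_val (N := N)
  have hc : ∀ B : Matrix (Fin N) (Fin N) ℝ,
      (Continuous fun p : ℝ × SymMat N => rotTrace A B p.2.1 p.1) ∧
      (Continuous fun p : ℝ × SymMat N => rotTraceDeriv A B p.2.1 p.1) := by
    intro B
    have c0 : Continuous fun p : ℝ × SymMat N => (B * p.2.1).trace :=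
      (SymMat.continuous_trace_mul B hv).comp continuous_snd
    have c1 : Continuous fun p : ℝ × SymMat N => (B * (A * p.2.1 - p.2.1 * A)).trace :=
      (SymMat.continuous_trace_mul B ((continuous_const.matrix_mul hv).sub
        (hv.matrix_mul continuous_const))).comp continuous_snd
    have c2 : Continuous fun p : ℝ × SymMat N =>
        (B * (A * A * p.2.1 + p.2.1 * (A * A))).trace :=
      (SymMat.continuous_trace_mul B ((continuous_const.matrix_mul hv).add
        (hv.matrix_mul continuous_const))).comp continuous_snd
    have c3 : Continuous fun p : ℝ × SymMat N => (B * (A * p.2.1 * A)).trace :=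
      (SymMat.continuous_trace_mul B ((continuous_const.matrix_mul hv).matrix_mul
        continuous_const)).comp continuous_snd
    have c4 : Continuous fun p : ℝ × SymMat N =>
        (B * (A * p.2.1 * (A * A) - A * A * p.2.1 * A)).trace :=
      (SymMat.continuous_trace_mul B (((continuous_const.matrix_mul hv).matrix_mul
        continuous_const).sub ((continuous_const.matrix_mul hv).matrix_mul
        continuous_const))).comp continuous_snd
    have c5 : Continuous fun p : ℝ × SymMat N => (B * (A * A * p.2.1 * (A * A))).trace :=
      (SymMat.continuous_trace_mul B ((continuous_const.matrix_mul hv).matrix_mul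
        continuous_const)).comp continuous_snd
    unfold rotTrace rotTraceDeriv
    exact ⟨by fun_prop, by fun_prop⟩
  set F : ℝ → SymMat N → ℂ := fun θ U =>
    H U * ((rotTrace A B U.1 θ : ℂ) * g (rotTrace A J U.1 θ)) with hF
  set F' : ℝ → SymMat N → ℂ := fun θ U =>
    H U * ((rotTraceDeriv A B U.1 θ : ℂ) * g (rotTrace A J U.1 θ) +
      (rotTrace A B U.1 θ : ℂ) * (g' (rotTrace A J U.1 θ) * (rotTraceDeriv A J U.1 θ : ℂ))) with hF'
  have hinv : ∀ θ, ∫ U, F θ U ∂μ = ∫ U, F 0 U ∂μ := by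
    intro θ
    let O : Matrix.orthogonalGroup (Fin N) ℝ := ⟨rot A θ, rot_mem hA hA3 θ⟩
    have hFO : ∀ U, F θ U = F 0 (SymMat.conj O U) := by
      intro U
      have h1 : ∀ B, rotTrace A B (SymMat.conj O U).1 0 = rotTrace A B U.1 θ := by
        intro B
        rw [rotTrace_zero, ← trace_mul_rot hA]
        rfl
      simp only [hF, h1, hHO]
    have hFc : Continuous (F 0) := by
      have h1 := ((hc B).1).comp (Continuous.prodMk_right (0 : ℝ) (Y := SymMat N))
      have h2 := ((hc J).1).comp (Continuous.prodMk_right (0 : ℝ) (Y := SymMat N))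
      exact hH.mul ((Complex.continuous_ofReal.comp h1).mul (hgc.comp h2))
    have := integral_map (μ := μ) (SymMat.measurable_conj O).aemeasurable
      (f := F 0) hFc.aestronglyMeasurable
    rw [hμ O] at this
    rw [this]
    exact integral_congr_ae (Eventually.of_forall hFO)
  have hder := hasDerivAt_integral_of_isCompact (F := F) (F' := F') hK hμK (fun θ => by
      have h1 := ((hc B).1).comp (Continuous.prodMk_right θ (Y := SymMat N))
      have h2 := ((hc J).1).comp (Continuous.prodMk_right θ (Y := SymMat N))
      exact hH.mul ((Complex.continuous_ofReal.comp h1).mul (hgc.comp h2)))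
    (by
      have c1 := Complex.continuous_ofReal.comp (hc B).1
      have c2 := Complex.continuous_ofReal.comp (hc B).2
      have c3 := hgc.comp (hc J).1
      have c4 := Complex.continuous_ofReal.comp (hc J).2
      have c5 := hg'.comp (hc J).1
      exact (hH.comp continuous_snd).mul ((c2.mul c3).add (c1.mul (c5.mul c4))))
    (fun θ U => by
      have h1 := (hasDerivAt_rotTrace A B U.1 θ).ofReal_comp
      have h2 := (hasDerivAt_rotTrace A J U.1 θ)
      have h3 := HasDerivAt.scomp θ (hg _) h2
      refine ((h1.mul h3).const_mul (H U)).congr_deriv ?_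
      simp only [hF', Function.comp_apply, Complex.real_smul]
      ring) 0
  have hconst : (fun θ => ∫ U, F θ U ∂μ) = fun _ => ∫ U, F 0 U ∂μ := funext hinv
  rw [hconst] at hder
  have := hder.unique (hasDerivAt_const (0 : ℝ) _)
  simpa only [hF', rotTrace_zero, rotTraceDeriv_zero] using this

/-- The contribution of the coordinate plane `(i, j)` to `stein_identity`. -/
noncomputable def steinTerm (J : SymMat N) (g g' : ℝ → ℂ) (i j : Fin N) (U : SymMat N) : ℂ :=
  (((J.1 * skew i j - skew i j * J.1) * (skew i j * U.1 - U.1 * skew i j)).trace : ℂ) *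
    g (J.1 * U.1).trace + (((J.1 * skew i j - skew i j * J.1) * U.1).trace : ℂ) *
    (g' (J.1 * U.1).trace * ((J.1 * (skew i j * U.1 - U.1 * skew i j)).trace : ℂ))

theorem continuous_steinTerm (J : SymMat N) {g g' : ℝ → ℂ} (hg : Continuous g)
    (hg' : Continuous g') (i j : Fin N) : Continuous (steinTerm J g g' i j) := by
  have hv := SymMat.continuous_val (N := N)
  have hcm : Continuous fun U : SymMat N => skew i j * U.1 - U.1 * skew i j :=
    (continuous_const.matrix_mul hv).sub (hv.matrix_mul continuous_const)
  have c1 := Complex.continuous_ofReal.comp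
    (SymMat.continuous_trace_mul (J.1 * skew i j - skew i j * J.1) hcm)
  have c2 := Complex.continuous_ofReal.comp
    (SymMat.continuous_trace_mul (J.1 * skew i j - skew i j * J.1) hv)
  have c3 := Complex.continuous_ofReal.comp (SymMat.continuous_trace_mul J.1 hcm)
  have c4 := SymMat.continuous_trace_mul J.1 hv
  exact (c1.mul (hg.comp c4)).add (c2.mul ((hg'.comp c4).mul c3))

theorem sum_sum_mul_add {ι : Type*} [Fintype ι] (a b c : ι → ι → ℂ) (x y : ℂ) :
    ∑ i, ∑ j, (a i j * x + b i j * (y * c i j)) =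
      (∑ i, ∑ j, a i j) * x + (∑ i, ∑ j, b i j * c i j) * y := by
  simp only [Finset.sum_mul, ← Finset.sum_add_distrib]
  exact Finset.sum_congr rfl fun i _ => Finset.sum_congr rfl fun j _ => by ring

theorem sum_steinTerm {J : SymMat N} (hJ : J.1.trace = 0) (g g' : ℝ → ℂ) (U : SymMat N) :
    ∑ i, ∑ j, steinTerm J g g' i j U =
      -4 * (N * ((J.pair U : ℂ) * g (J.pair U))) +
        4 * ((SymMat.commSq U J : ℂ) * g' (J.pair U)) := by
  have h1 := congrArg (fun x : ℝ => (x : ℂ)) (SymMat.sum_casimir J U hJ)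
  have h2 := congrArg (fun x : ℝ => (x : ℂ)) (SymMat.sum_carre J U)
  simp only [Complex.ofReal_sum, Complex.ofReal_mul, Complex.ofReal_neg, Complex.ofReal_natCast,
    Complex.ofReal_ofNat] at h1 h2
  have h3 := sum_sum_mul_add (fun i j => (((J.1 * skew i j - skew i j * J.1) *
      (skew i j * U.1 - U.1 * skew i j)).trace : ℂ))
    (fun i j => (((J.1 * skew i j - skew i j * J.1) * U.1).trace : ℂ))
    (fun i j => ((J.1 * (skew i j * U.1 - U.1 * skew i j)).trace : ℂ)) (g (J.pair U))
    (g' (J.pair U))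
  rw [h1, h2] at h3
  refine h3.trans ?_
  ring

/-- Integration by parts along the orbits of the orthogonal group. -/
theorem stein_identity (hμ : OrthInvariant μ) (hK : IsCompact K) (hμK : ∀ᵐ U ∂μ, U ∈ K)
    {J : SymMat N} (hJ : J.1.trace = 0) {g g' : ℝ → ℂ} (hg : ∀ x, HasDerivAt g (g' x) x)
    (hg' : Continuous g') {H : SymMat N → ℂ} (hH : Continuous H)
    (hHO : ∀ O U, H (SymMat.conj O U) = H U) :
    (N : ℂ) * ∫ U, H U * ((J.pair U : ℂ) * g (J.pair U)) ∂μ =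
      ∫ U, H U * ((SymMat.commSq U J : ℂ) * g' (J.pair U)) ∂μ := by
  have hgc : Continuous g := continuous_iff_continuousAt.2 fun x => (hg x).continuousAt
  have hp := J.continuous_pair
  have hcs := SymMat.continuous_commSq J
  -- Here the free matrix `B` is `[J, A]`, so that `tr BU` is the derivative of `tr JU` along `A`.
  -- Differentiating once more gives the Casimir term, and differentiating `g` gives the squared
  -- gradient.
  have hzero : ∀ i j, ∫ U, H U * steinTerm J g g' i j U ∂μ = 0 := fun i j =>
    integral_skew_eq_zero hμ hK hμK (skew_transpose i j) (skew_cube i j) _ _ hg hg' hH hHO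
  have hint : ∀ i j, Integrable (fun U => H U * steinTerm J g g' i j U) μ := fun i j =>
    integrable_of_isCompact hK hμK (hH.mul (continuous_steinTerm J hgc hg' i j))
  have hsum : ∫ U, ∑ i, ∑ j, H U * steinTerm J g g' i j U ∂μ = 0 := by
    rw [integral_finsetSum _ fun i _ => integrable_finsetSum _ fun j _ => hint i j]
    refine Finset.sum_eq_zero fun i _ => ?_
    rw [integral_finsetSum _ fun j _ => hint i j]
    exact Finset.sum_eq_zero fun j _ => hzero i j
  have h1 : Integrable (fun U => H U * ((J.pair U : ℂ) * g (J.pair U))) μ :=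
    integrable_of_isCompact hK hμK (by fun_prop)
  have h2 : Integrable (fun U => H U * ((SymMat.commSq U J : ℂ) * g' (J.pair U))) μ :=
    integrable_of_isCompact hK hμK (by fun_prop)
  have hpt : ∀ U, ∑ i, ∑ j, H U * steinTerm J g g' i j U =
      (-4 * N : ℂ) * (H U * ((J.pair U : ℂ) * g (J.pair U))) +
        4 * (H U * ((SymMat.commSq U J : ℂ) * g' (J.pair U))) := by
    intro U
    simp only [← Finset.mul_sum]
    rw [sum_steinTerm hJ]
    ring
  simp only [hpt] at hsum
  rw [integral_add (h1.const_mul _) (h2.const_mul _), integral_const_mul,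
    integral_const_mul] at hsum
  linear_combination (-1 / 4 : ℂ) * hsum

end Stein

/-! ### Traceless parts and estimates for the squared commutator -/

namespace SymMat

variable {N : ℕ}

/-- The normalized trace. -/
noncomputable def mean (U : SymMat N) : ℝ := U.1.trace / N

/-- The traceless part. -/
noncomputable def dev (U : SymMat N) : SymMat N :=
  ⟨U.1 - U.mean • (1 : Matrix (Fin N) (Fin N) ℝ), U.2.sub (Matrix.isSymm_one.smul _)⟩

/-- The square, as a symmetric matrix. -/
def sq (U : SymMat N) : SymMat N := ⟨U.1 * U.1, by
  have h : U.1.transpose = U.1 := U.2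
  simp [Matrix.IsSymm, Matrix.transpose_mul, h]⟩

theorem val_dev (U : SymMat N) : U.dev.1 = U.1 - U.mean • (1 : Matrix (Fin N) (Fin N) ℝ) := rfl

theorem val_sq (U : SymMat N) : U.sq.1 = U.1 * U.1 := rfl

theorem natCast_mul_mean (hN : 0 < N) (U : SymMat N) : (N : ℝ) * U.mean = U.1.trace := by
  have : (N : ℝ) ≠ 0 := by exact_mod_cast hN.ne'
  rw [mean]
  field_simp

theorem trace_dev (hN : 0 < N) (U : SymMat N) : U.dev.1.trace = 0 := by
  rw [val_dev, Matrix.trace_sub, Matrix.trace_smul, Matrix.trace_one, Fintype.card_fin,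
    smul_eq_mul, mul_comm, natCast_mul_mean hN, sub_self]

theorem pair_dev_right (J U : SymMat N) : J.pair U.dev = J.pair U - J.1.trace * U.mean := by
  simp only [pair, val_dev, mul_sub, Matrix.mul_smul, Matrix.mul_one, Matrix.trace_sub,
    Matrix.trace_smul, smul_eq_mul]
  ring

theorem pair_dev_left (J U : SymMat N) : J.dev.pair U = J.pair U.dev := by
  rw [pair_comm, pair_dev_right, pair_dev_right, pair_comm, mean, mean]
  ring

theorem trPow_two_dev (hN : 0 < N) (U : SymMat N) :
    U.dev.trPow 2 = U.trPow 2 - N * U.mean ^ 2 := by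
  rw [trPow_two_eq_pair, pair_dev_right, trace_dev hN, pair_comm, pair_dev_right,
    ← trPow_two_eq_pair, ← natCast_mul_mean hN]
  ring

theorem trPow_two_dev_le (hN : 0 < N) (U : SymMat N) : U.dev.trPow 2 ≤ U.trPow 2 := by
  rw [trPow_two_dev hN]
  have : 0 ≤ (N : ℝ) * U.mean ^ 2 := by positivity
  linarith

theorem trace_sq (U : SymMat N) : U.sq.1.trace = U.trPow 2 := by
  rw [val_sq, trPow, pow_two]

theorem trPow_two_sq (U : SymMat N) : U.sq.trPow 2 = U.trPow 4 := by
  rw [trPow, trPow, val_sq, ← pow_two, ← pow_mul]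

theorem mean_conj (O : Matrix.orthogonalGroup (Fin N) ℝ) (U : SymMat N) :
    (conj O U).mean = U.mean := by
  have := trPow_conj O U 1
  simp only [trPow, pow_one] at this
  rw [mean, mean, this]

theorem dev_conj (O : Matrix.orthogonalGroup (Fin N) ℝ) (U : SymMat N) :
    (conj O U).dev = conj O U.dev := by
  have hO' : O.1 * O.1.transpose = 1 := (Matrix.mem_orthogonalGroup_iff (Fin N) ℝ).1 O.2
  refine Subtype.ext ?_
  change O.1 * U.1 * O.1.transpose - (conj O U).mean • (1 : Matrix (Fin N) (Fin N) ℝ) =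
    O.1 * (U.1 - U.mean • (1 : Matrix (Fin N) (Fin N) ℝ)) * O.1.transpose
  rw [mean_conj, mul_sub, sub_mul, Matrix.mul_smul, Matrix.smul_mul, Matrix.mul_one, hO']

theorem sq_conj (O : Matrix.orthogonalGroup (Fin N) ℝ) (U : SymMat N) :
    (conj O U).sq = conj O U.sq := by
  have hO : O.1.transpose * O.1 = 1 := (Matrix.mem_orthogonalGroup_iff' (Fin N) ℝ).1 O.2
  refine Subtype.ext ?_
  change O.1 * U.1 * O.1.transpose * (O.1 * U.1 * O.1.transpose) =
    O.1 * (U.1 * U.1) * O.1.transpose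
  calc _ = O.1 * U.1 * (O.1.transpose * O.1) * U.1 * O.1.transpose := by
        simp only [Matrix.mul_assoc]
    _ = _ := by
        rw [hO, Matrix.mul_one]
        simp only [Matrix.mul_assoc]

theorem continuous_mean : Continuous fun U : SymMat N => U.mean :=
  continuous_val.matrix_trace.div_const _

theorem continuous_dev : Continuous fun U : SymMat N => U.dev :=
  Continuous.subtype_mk (continuous_val.sub (continuous_mean.smul continuous_const)) _

theorem continuous_sq : Continuous fun U : SymMat N => U.sq :=
  Continuous.subtype_mk (continuous_val.matrix_mul continuous_val) _

theorem commSq_dev_right (U J : SymMat N) : commSq U J.dev = commSq U.dev J := by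
  simp only [commSq, val_dev, mul_sub, sub_mul, Matrix.mul_smul, Matrix.smul_mul, Matrix.mul_one,
    Matrix.one_mul]
  refine Finset.sum_congr rfl fun i _ => Finset.sum_congr rfl fun j _ => ?_
  simp only [Matrix.sub_apply, Matrix.smul_apply]
  ring

theorem sum_sq_mul (U J : SymMat N) :
    ∑ i, ∑ j, (U.1 * J.1) i j ^ 2 = J.sq.pair U.sq := by
  have hJt : J.1.transpose = J.1 := J.2
  have hUt : U.1.transpose = U.1 := U.2
  have h : ∑ i, ∑ j, (U.1 * J.1) i j ^ 2 = (U.1 * J.1 * (U.1 * J.1).transpose).trace := by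
    simp only [Matrix.trace, Matrix.diag, Matrix.mul_apply (M := U.1 * J.1), Matrix.transpose_apply,
      pow_two]
  rw [h, Matrix.transpose_mul, hJt, hUt, pair, val_sq, val_sq, ← Matrix.mul_assoc,
    Matrix.trace_mul_comm, Matrix.trace_mul_comm (J.1 * J.1)]
  simp only [Matrix.mul_assoc]

theorem mul_swap_apply (U J : SymMat N) (i j : Fin N) : (J.1 * U.1) i j = (U.1 * J.1) j i := by
  have hJt : J.1.transpose = J.1 := J.2
  have hUt : U.1.transpose = U.1 := U.2
  have : (U.1 * J.1).transpose = J.1 * U.1 := by rw [Matrix.transpose_mul, hJt, hUt]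
  rw [← this, Matrix.transpose_apply]

theorem commSq_eq (U J : SymMat N) :
    commSq U J = 2 * (J.sq.pair U.sq - (U.1 * J.1 * (U.1 * J.1)).trace) := by
  have h1 := sum_sq_mul U J
  have h1' : ∑ i, ∑ j, (U.1 * J.1) j i ^ 2 = J.sq.pair U.sq := by rw [Finset.sum_comm, h1]
  have h2 : (U.1 * J.1 * (U.1 * J.1)).trace =
      ∑ i, ∑ j, (U.1 * J.1) i j * (U.1 * J.1) j i := by
    simp only [Matrix.trace, Matrix.diag, Matrix.mul_apply (M := U.1 * J.1)]
  have h3 : commSq U J = ∑ i, ∑ j, ((U.1 * J.1) i j ^ 2 + (U.1 * J.1) j i ^ 2 -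
      2 * ((U.1 * J.1) i j * (U.1 * J.1) j i)) := by
    rw [commSq]
    refine Finset.sum_congr rfl fun i _ => Finset.sum_congr rfl fun j _ => ?_
    rw [Matrix.sub_apply, mul_swap_apply U J i j]
    ring
  rw [h3]
  simp only [Finset.sum_sub_distrib, Finset.sum_add_distrib, ← Finset.mul_sum]
  rw [h1, h1', h2]
  ring

theorem commSq_le (U J : SymMat N) : commSq U J ≤ 4 * J.sq.pair U.sq := by
  have h1 := sum_sq_mul U J
  have h1' : ∑ i, ∑ j, (U.1 * J.1) j i ^ 2 = J.sq.pair U.sq := by rw [Finset.sum_comm, h1]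
  calc commSq U J ≤ ∑ i, ∑ j, (2 * (U.1 * J.1) i j ^ 2 + 2 * (U.1 * J.1) j i ^ 2) := by
        rw [commSq]
        refine Finset.sum_le_sum fun i _ => Finset.sum_le_sum fun j _ => ?_
        rw [Matrix.sub_apply, mul_swap_apply U J i j]
        nlinarith [sq_nonneg ((U.1 * J.1) i j + (U.1 * J.1) j i)]
    _ = 4 * J.sq.pair U.sq := by
        simp only [Finset.sum_add_distrib, ← Finset.mul_sum]
        rw [h1, h1']
        ring

theorem sq_trace_le (U : SymMat N) : U.1.trace ^ 2 ≤ N * U.trPow 2 := by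
  have h1 : U.1.trace ^ 2 ≤ N * ∑ i, U.1 i i ^ 2 := by
    have := sq_sum_le_card_mul_sum_sq (s := (Finset.univ : Finset (Fin N))) (f := fun i => U.1 i i)
    simpa [Matrix.trace] using this
  refine h1.trans (mul_le_mul_of_nonneg_left ?_ (Nat.cast_nonneg N))
  rw [trPow_two_eq_sum]
  exact Finset.sum_le_sum fun i _ => Finset.single_le_sum (f := fun j => U.1 i j ^ 2)
    (fun _ _ => sq_nonneg _) (Finset.mem_univ i)

theorem sq_mean_le (hN : 0 < N) (U : SymMat N) : U.mean ^ 2 ≤ U.trPow 2 / N := by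
  have hN' : (0 : ℝ) < N := by exact_mod_cast hN
  have := sq_trace_le U
  rw [mean, div_pow, le_div_iff₀ hN', div_mul_eq_mul_div, div_le_iff₀ (by positivity)]
  nlinarith

theorem sq_trPow_two_le (U : SymMat N) : U.trPow 2 ^ 2 ≤ N * U.trPow 4 := by
  have := sq_trace_le U.sq
  rwa [trace_sq, trPow_two_sq] at this

theorem trPow_four_le (U : SymMat N) : U.trPow 4 ≤ U.trPow 2 ^ 2 := by
  rw [trPow_four_eq_sum, trPow_two_eq_sum]
  calc ∑ i, ∑ j, (U.1 * U.1) i j ^ 2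
      ≤ ∑ i, ∑ j, (∑ k, U.1 i k ^ 2) * ∑ k, U.1 j k ^ 2 := by
        refine Finset.sum_le_sum fun i _ => Finset.sum_le_sum fun j _ => ?_
        rw [Matrix.mul_apply]
        simp only [U.apply_symm _ j]
        exact Finset.sum_mul_sq_le_sq_mul_sq _ _ _
    _ = (∑ i, ∑ k, U.1 i k ^ 2) ^ 2 := by
        rw [pow_two, Finset.sum_mul_sum]

/-- With `s` the normalized trace, the squared traceless part is `U² - 2sU + s²`; the three-term
square inequality gives `3 (1 + 4 + 1) = 18`. The last two terms are absorbed using `s² ≤ tr U² / N`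
and `(tr U²)² ≤ N tr U⁴`. -/
theorem trPow_four_dev_le (hN : 0 < N) (U : SymMat N) : U.dev.trPow 4 ≤ 18 * U.trPow 4 := by
  have hN' : (0 : ℝ) < N := by exact_mod_cast hN
  set s := U.mean with hs
  have hW : ∀ i j, (U.dev.1 * U.dev.1) i j =
      (U.1 * U.1) i j - 2 * s * U.1 i j + s ^ 2 * (1 : Matrix (Fin N) (Fin N) ℝ) i j := by
    intro i j
    simp only [val_dev, mul_sub, sub_mul, Matrix.mul_smul, Matrix.smul_mul, Matrix.mul_one,
      Matrix.one_mul, Matrix.sub_apply, Matrix.smul_apply, smul_eq_mul, ← hs]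
    ring
  have h1 : U.dev.trPow 4 ≤ 3 * (U.trPow 4 + 4 * s ^ 2 * U.trPow 2 + s ^ 4 * N) := by
    have e : ∑ i, ∑ j, (1 : Matrix (Fin N) (Fin N) ℝ) i j ^ 2 = N := by
      simp [Matrix.one_apply]
    calc U.dev.trPow 4 = ∑ i, ∑ j, (U.dev.1 * U.dev.1) i j ^ 2 := trPow_four_eq_sum _
      _ ≤ ∑ i, ∑ j, (3 * (U.1 * U.1) i j ^ 2 + 12 * s ^ 2 * U.1 i j ^ 2 +
            3 * s ^ 4 * (1 : Matrix (Fin N) (Fin N) ℝ) i j ^ 2) := by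
          refine Finset.sum_le_sum fun i _ => Finset.sum_le_sum fun j _ => ?_
          rw [hW]
          generalize (U.1 * U.1) i j = a
          generalize (1 : Matrix (Fin N) (Fin N) ℝ) i j = c
          generalize U.1 i j = b
          nlinarith [sq_nonneg (a + 2 * s * b), sq_nonneg (a - s ^ 2 * c),
            sq_nonneg (2 * s * b + s ^ 2 * c)]
      _ = 3 * (U.trPow 4 + 4 * s ^ 2 * U.trPow 2 + s ^ 4 * N) := by
          simp only [Finset.sum_add_distrib, ← Finset.mul_sum]
          rw [e, ← trPow_four_eq_sum, ← trPow_two_eq_sum]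
          ring
  have hp := sq_trPow_two_le U
  have hp0 := trPow_two_nonneg U
  have hsm := sq_mean_le hN U
  have hpN : U.trPow 2 / N * U.trPow 2 ≤ U.trPow 4 := by
    rw [div_mul_eq_mul_div, div_le_iff₀ hN']
    nlinarith
  have h2 : s ^ 2 * U.trPow 2 ≤ U.trPow 4 :=
    (mul_le_mul_of_nonneg_right hsm hp0).trans hpN
  have h3 : s ^ 4 * N ≤ U.trPow 4 := by
    calc s ^ 4 * N = s ^ 2 * (s ^ 2 * N) := by ring
      _ ≤ s ^ 2 * U.trPow 2 := by
          refine mul_le_mul_of_nonneg_left ?_ (sq_nonneg s)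
          rwa [← le_div_iff₀ hN']
      _ ≤ _ := h2
  linarith

theorem trPow_two_entry_le (i j : Fin N) : (entry i j).trPow 2 ≤ 1 := by
  have h : (entry i j).trPow 2 = (entry i j).1 i j := by
    rw [trPow_two_eq_pair, pair_entry]
  rw [h]
  simp only [entry, Matrix.smul_apply, Matrix.add_apply, Matrix.single_apply, smul_eq_mul]
  split_ifs <;> norm_num

/-- When `J` is supported in a fixed block, only finitely many entries of `X` contribute, and their
second moments suffice to control this cross term of the commutator. -/
theorem abs_trace_cross_le (X J : SymMat N) : |(X.1 * J.1 * (X.1 * J.1)).trace| ≤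
    ∑ p : (Fin N × Fin N), ∑ q : (Fin N × Fin N), |J.1 p.1 p.2| * |J.1 q.1 q.2| *
      ((X.1 q.2 p.1 ^ 2 + X.1 p.2 q.1 ^ 2) / 2) := by
  have h : (X.1 * J.1 * (X.1 * J.1)).trace = ∑ p : (Fin N × Fin N), ∑ q : (Fin N × Fin N),
      J.1 p.1 p.2 * J.1 q.1 q.2 * (X.1 q.2 p.1 * X.1 p.2 q.1) := by
    have e : (X.1 * J.1 * (X.1 * J.1)).trace = (J.1 * X.1 * (J.1 * X.1)).trace := by
      rw [Matrix.mul_assoc, Matrix.trace_mul_comm]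
      simp only [Matrix.mul_assoc]
    rw [e]
    simp only [Matrix.trace, Matrix.diag, Matrix.mul_apply, Finset.sum_mul_sum,
      Fintype.sum_prod_type]
    refine Finset.sum_congr rfl fun i _ => ?_
    rw [Finset.sum_comm]
    refine Finset.sum_congr rfl fun k _ => Finset.sum_congr rfl fun j _ =>
      Finset.sum_congr rfl fun l _ => ?_
    ring
  rw [h]
  refine (Finset.abs_sum_le_sum_abs _ _).trans (Finset.sum_le_sum fun p _ => ?_)
  refine (Finset.abs_sum_le_sum_abs _ _).trans (Finset.sum_le_sum fun q _ => ?_)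
  rw [abs_mul, abs_mul]
  refine mul_le_mul_of_nonneg_left ?_ (by positivity)
  rw [abs_le]
  constructor <;> nlinarith [sq_nonneg (X.1 q.2 p.1 + X.1 p.2 q.1),
    sq_nonneg (X.1 q.2 p.1 - X.1 p.2 q.1)]

end SymMat

/-! ### Second moments and comparison with a Gaussian mixture -/

section Moments

variable {N : ℕ} {μ : Measure (SymMat N)} [IsFiniteMeasure μ] {K : Set (SymMat N)}

theorem OrthInvariant.map {μ : Measure (SymMat N)} (hμ : OrthInvariant μ)
    {T : SymMat N → SymMat N} (hT : Continuous T)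
    (hTO : ∀ O U, T (SymMat.conj O U) = SymMat.conj O (T U)) : OrthInvariant (μ.map T) := by
  intro O
  have h : SymMat.conj O ∘ T = T ∘ SymMat.conj O := funext fun U => (hTO O U).symm
  rw [Measure.map_map (SymMat.measurable_conj O) hT.measurable, h,
    ← Measure.map_map hT.measurable (SymMat.measurable_conj O), hμ O]

theorem ae_map_mem_image {X : Type*} [TopologicalSpace X] [MeasurableSpace X] [BorelSpace X]
    [T2Space X] {μ : Measure X} {K : Set X} (hK : IsCompact K) (hμK : ∀ᵐ x ∂μ, x ∈ K) {T : X → X}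
    (hT : Continuous T) : ∀ᵐ x ∂(μ.map T), x ∈ T '' K := by
  refine (ae_map_iff hT.measurable.aemeasurable (hK.image hT).measurableSet).2 ?_
  filter_upwards [hμK] with x hx using Set.mem_image_of_mem T hx

/-- The Stein identity for a constant `g`, whose derivative term is zero. -/
theorem integral_pair_dev (hN : 0 < N) (hμ : OrthInvariant μ) (hK : IsCompact K)
    (hμK : ∀ᵐ U ∂μ, U ∈ K) (J : SymMat N) : ∫ U, J.dev.pair U ∂μ = 0 := by
  have h := stein_identity hμ hK hμK (J.trace_dev hN) (g := fun _ => 1) (g' := fun _ => 0)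
    (fun x => hasDerivAt_const _ _) continuous_const (H := fun _ => 1) continuous_const
    (fun _ _ => rfl)
  have hN' : (N : ℂ) ≠ 0 := by exact_mod_cast hN.ne'
  simp only [mul_one, one_mul, mul_zero, integral_zero, mul_eq_zero, hN', false_or] at h
  rw [integral_complex_ofReal] at h
  exact_mod_cast h

/-- The Stein identity for `g(x) = x` expresses the second moment through the squared commutator,
which is at most four times the pairing of `J²` with the squared traceless part of `U`. In that
pairing the traceless part of `J²` averages to zero, since the image of `μ` under this squaring is
again invariant; what remains involves only `tr J² tr U² / N`. -/
theorem integral_sq_pair_dev_le (hN : 0 < N) (hμ : OrthInvariant μ) (hK : IsCompact K)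
    (hμK : ∀ᵐ U ∂μ, U ∈ K) (J : SymMat N) :
    ∫ U, J.dev.pair U ^ 2 ∂μ ≤ 4 / N ^ 2 * J.trPow 2 * ∫ U, U.trPow 2 ∂μ := by
  have hN' : (0 : ℝ) < N := by exact_mod_cast hN
  have hcp := J.dev.continuous_pair
  have h := stein_identity hμ hK hμK (J.trace_dev hN) (g := fun x => (x : ℂ)) (g' := fun _ => 1)
    (fun x => (hasDerivAt_id x).ofReal_comp) continuous_const (H := fun _ => 1) continuous_const
    (fun _ _ => rfl)
  simp only [mul_one, one_mul, ← Complex.ofReal_mul] at h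
  rw [integral_complex_ofReal, integral_complex_ofReal] at h
  have h1 : (N : ℝ) * ∫ U, J.dev.pair U ^ 2 ∂μ = ∫ U, SymMat.commSq U J.dev ∂μ := by
    simp only [pow_two]
    exact_mod_cast h
  set T : SymMat N → SymMat N := fun U => U.dev.sq with hT
  have hTc : Continuous T := SymMat.continuous_sq.comp SymMat.continuous_dev
  have hTO : ∀ O U, T (SymMat.conj O U) = SymMat.conj O (T U) := fun O U => by
    simp only [hT, SymMat.dev_conj, SymMat.sq_conj]
  have hz := integral_pair_dev hN (hμ.map hTc hTO) (hK.image hTc) (ae_map_mem_image hK hμK hTc) J.sq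
  rw [integral_map hTc.measurable.aemeasurable
    (SymMat.continuous_pair _).aestronglyMeasurable] at hz
  have hi1 : Integrable (fun U => J.sq.dev.pair (T U)) μ :=
    integrable_of_isCompact hK hμK ((SymMat.continuous_pair _).comp hTc)
  have hi2 : Integrable (fun U : SymMat N => U.trPow 2) μ :=
    integrable_of_isCompact hK hμK (SymMat.continuous_trPow 2)
  have h2 : ∫ U, SymMat.commSq U J.dev ∂μ ≤
      ∫ U : SymMat N, (4 * J.sq.dev.pair (T U) + 4 * J.trPow 2 / N * U.trPow 2) ∂μ := by
    refine integral_mono (integrable_of_isCompact hK hμK (SymMat.continuous_commSq _))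
      ((hi1.const_mul 4).add (hi2.const_mul _)) fun U => ?_
    rw [SymMat.commSq_dev_right]
    refine (SymMat.commSq_le _ _).trans ?_
    have e : J.sq.pair U.dev.sq = J.sq.dev.pair (T U) + J.trPow 2 / N * U.dev.trPow 2 := by
      rw [SymMat.pair_dev_left, SymMat.pair_dev_right, SymMat.trace_sq, SymMat.mean,
        SymMat.trace_sq]
      ring
    rw [e, mul_add]
    have h3 := SymMat.trPow_two_dev_le hN U
    have h4 : J.trPow 2 / N * U.dev.trPow 2 ≤ J.trPow 2 / N * U.trPow 2 :=
      mul_le_mul_of_nonneg_left h3 (div_nonneg J.trPow_two_nonneg hN'.le)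
    have h5 : 4 * J.trPow 2 / N * U.trPow 2 = 4 * (J.trPow 2 / N * U.trPow 2) := by ring
    linarith
  rw [integral_add (hi1.const_mul 4) (hi2.const_mul _), integral_const_mul, integral_const_mul, hz,
    mul_zero, zero_add] at h2
  have h6 : ∫ U, J.dev.pair U ^ 2 ∂μ = (∫ U, SymMat.commSq U J.dev ∂μ) / N := by
    rw [← h1]
    field_simp
  rw [h6, div_le_iff₀ hN']
  refine h2.trans_eq ?_
  field_simp

/-- Interpolation between the characteristic function and the Gaussian mixture. -/
theorem norm_integral_exp_sub_le (hN : 0 < N) (hμ : OrthInvariant μ) (hK : IsCompact K)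
    (hμK : ∀ᵐ U ∂μ, U ∈ K) (J : SymMat N) (τ : ℝ) :
    ‖∫ U, Complex.exp (Complex.I * ((J.dev.pair U + τ * U.mean : ℝ) : ℂ)) ∂μ -
      ∫ U, Complex.exp (((-(U.dev.trPow 2 / N ^ 2 * J.trPow 2) : ℝ) : ℂ) +
        Complex.I * ((τ * U.mean : ℝ) : ℂ)) ∂μ‖ ≤
      ∫ U, |SymMat.commSq U.dev J / N - 2 * (U.dev.trPow 2 / N ^ 2 * J.trPow 2)| ∂μ := by
  have hN' : (N : ℂ) ≠ 0 := by exact_mod_cast hN.ne'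
  set β : SymMat N → ℝ := fun U => U.dev.trPow 2 / N ^ 2 * J.trPow 2 with hβ
  have hβc : Continuous β :=
    (((SymMat.continuous_trPow 2).comp SymMat.continuous_dev).div_const _).mul continuous_const
  have hβ0 : ∀ U, 0 ≤ β U := fun U =>
    mul_nonneg (div_nonneg U.dev.trPow_two_nonneg (by positivity)) J.trPow_two_nonneg
  have hβO : ∀ O U, β (SymMat.conj O U) = β U := fun O U => by
    simp only [hβ, SymMat.dev_conj, SymMat.trPow_conj]
  have hp := J.dev.continuous_pair
  have hm := SymMat.continuous_mean (N := N)
  have hcs : Continuous fun U : SymMat N => SymMat.commSq U.dev J :=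
    (SymMat.continuous_commSq J).comp SymMat.continuous_dev
  -- At `t = 1` the damping `β` is absent, at `t = 0` the linear form is. On `[0, 1]` the modulus
  -- stays at most one because `β ≥ 0`.
  set F : ℝ → SymMat N → ℂ := fun t U =>
    Complex.exp (((t ^ 2 - 1) * β U : ℝ) + Complex.I * ((t * J.dev.pair U + τ * U.mean : ℝ) : ℂ))
    with hF
  set F' : ℝ → SymMat N → ℂ := fun t U =>
    F t U * (((2 * t * β U : ℝ) : ℂ) + Complex.I * (J.dev.pair U : ℂ)) with hF'
  have hFc : Continuous fun p : ℝ × SymMat N => F p.1 p.2 := by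
    have c1 := hβc.comp (continuous_snd (X := ℝ) (Y := SymMat N))
    have c2 := hp.comp (continuous_snd (X := ℝ) (Y := SymMat N))
    have c3 := hm.comp (continuous_snd (X := ℝ) (Y := SymMat N))
    simp only [Function.comp_def] at c1 c2 c3
    simp only [hF]
    fun_prop
  have hF'c : Continuous fun p : ℝ × SymMat N => F' p.1 p.2 := by
    have c1 := hβc.comp (continuous_snd (X := ℝ) (Y := SymMat N))
    have c2 := hp.comp (continuous_snd (X := ℝ) (Y := SymMat N))
    simp only [Function.comp_def] at c1 c2
    simp only [hF']
    exact hFc.mul (by fun_prop)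
  have hFt : ∀ t, Continuous (F t) := fun t => hFc.comp (Continuous.prodMk_right t)
  have hder : ∀ t, HasDerivAt (fun t => ∫ U, F t U ∂μ) (∫ U, F' t U ∂μ) t :=
    hasDerivAt_integral_of_isCompact hK hμK hFt hF'c fun t U => by
      have h1 : HasDerivAt (fun t : ℝ => (t ^ 2 - 1) * β U) (2 * t * β U) t := by
        simpa using ((hasDerivAt_pow 2 t).sub_const 1).mul_const (β U)
      have h2 : HasDerivAt (fun t : ℝ => t * J.dev.pair U + τ * U.mean) (J.dev.pair U) t := by
        simpa using ((hasDerivAt_id t).mul_const (J.dev.pair U)).add_const (τ * U.mean)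
      exact (h1.ofReal_comp.add (h2.ofReal_comp.const_mul Complex.I)).cexp
  have hF1 : ∀ t, |t| ≤ 1 → ∀ U, ‖F t U‖ ≤ 1 := by
    intro t ht U
    have hre : ((((t ^ 2 - 1) * β U : ℝ) : ℂ) +
        Complex.I * ((t * J.dev.pair U + τ * U.mean : ℝ) : ℂ)).re = (t ^ 2 - 1) * β U := by
      simp [-Complex.ofReal_mul, -Complex.ofReal_add]
    rw [hF, Complex.norm_exp, hre, Real.exp_le_one_iff]
    have : t ^ 2 ≤ 1 := by
      rw [← sq_abs]
      nlinarith [abs_nonneg t]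
    nlinarith [hβ0 U]
  have hE : Integrable (fun U => |SymMat.commSq U.dev J / N - 2 * β U|) μ :=
    integrable_of_isCompact hK hμK (by fun_prop)
  have hbound : ∀ t ∈ Set.Ico (0 : ℝ) 1, ‖∫ U, F' t U ∂μ‖ ≤
      ∫ U, |SymMat.commSq U.dev J / N - 2 * β U| ∂μ := by
    intro t ht
    have ht1 : |t| ≤ 1 := by
      rw [abs_of_nonneg ht.1]
      exact ht.2.le
    set H : SymMat N → ℂ := fun U =>
      Complex.exp (((t ^ 2 - 1) * β U : ℝ) + Complex.I * ((τ * U.mean : ℝ) : ℂ)) with hH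
    have hHc : Continuous H := by
      simp only [hH]
      fun_prop
    -- For `g(x) = i exp (itx)` the identity trades the factor `i tr JU` in the derivative of `F`
    -- for `-t` times the squared commutator over `N`. The damping contributes `2tβ`, so only their
    -- discrepancy remains.
    have hs := stein_identity hμ hK hμK (J.trace_dev hN)
      (g := fun x => Complex.I * Complex.exp (Complex.I * ((t * x : ℝ) : ℂ)))
      (g' := fun x => -(t : ℂ) * Complex.exp (Complex.I * ((t * x : ℝ) : ℂ)))
      (fun x => by
        have h1 : HasDerivAt (fun x : ℝ => t * x) t x := by
          simpa using (hasDerivAt_id x).const_mul t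
        refine (((h1.ofReal_comp.const_mul Complex.I).cexp).const_mul Complex.I).congr_deriv ?_
        linear_combination (t : ℂ) * Complex.exp (Complex.I * ((t * x : ℝ) : ℂ)) *
          Complex.I_mul_I)
      (by fun_prop) (H := H) hHc
      (fun O U => by simp only [hH, hβO, SymMat.mean_conj])
    have hHF : ∀ U, H U * Complex.exp (Complex.I * ((t * J.dev.pair U : ℝ) : ℂ)) = F t U := by
      intro U
      simp only [hH, hF, ← Complex.exp_add]
      congr 1
      push_cast
      ring
    have e1 : ∫ U, H U * ((J.dev.pair U : ℂ) * (Complex.I *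
        Complex.exp (Complex.I * ((t * J.dev.pair U : ℝ) : ℂ)))) ∂μ =
        ∫ U, F t U * (Complex.I * (J.dev.pair U : ℂ)) ∂μ := by
      refine integral_congr_ae (Eventually.of_forall fun U => ?_)
      simp only [← hHF]
      ring
    have e2 : ∫ U, H U * ((SymMat.commSq U J.dev : ℂ) * (-(t : ℂ) *
        Complex.exp (Complex.I * ((t * J.dev.pair U : ℝ) : ℂ)))) ∂μ =
        (N : ℂ) * ∫ U, F t U * ((-t * (SymMat.commSq U.dev J / N) : ℝ) : ℂ) ∂μ := by
      rw [← integral_const_mul]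
      refine integral_congr_ae (Eventually.of_forall fun U => ?_)
      simp only [← hHF, SymMat.commSq_dev_right]
      push_cast
      field_simp
    rw [e1, e2] at hs
    have hs' := mul_left_cancel₀ hN' hs
    have i1 : Integrable (fun U => F t U * ((2 * t * β U : ℝ) : ℂ)) μ :=
      integrable_of_isCompact hK hμK ((hFt t).mul (by fun_prop))
    have i2 : Integrable (fun U => F t U * (Complex.I * (J.dev.pair U : ℂ))) μ :=
      integrable_of_isCompact hK hμK ((hFt t).mul (by fun_prop))
    have i3 : Integrable (fun U => F t U * ((-t * (SymMat.commSq U.dev J / N) : ℝ) : ℂ)) μ :=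
      integrable_of_isCompact hK hμK ((hFt t).mul (by fun_prop))
    have e3 : ∫ U, F' t U ∂μ = ∫ U, F t U *
        ((-t * (SymMat.commSq U.dev J / N - 2 * β U) : ℝ) : ℂ) ∂μ := by
      simp only [hF', mul_add]
      rw [integral_add i1 i2, hs', ← integral_add i1 i3]
      refine integral_congr_ae (Eventually.of_forall fun U => ?_)
      push_cast
      ring
    rw [e3]
    refine norm_integral_le_of_norm_le hE (Eventually.of_forall fun U => ?_)
    rw [norm_mul, Complex.norm_real, Real.norm_eq_abs, abs_mul, abs_neg]
    have := hF1 t ht1 U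
    have h3 := abs_nonneg (SymMat.commSq U.dev J / N - 2 * β U)
    calc ‖F t U‖ * (|t| * |SymMat.commSq U.dev J / N - 2 * β U|)
        ≤ 1 * (1 * |SymMat.commSq U.dev J / N - 2 * β U|) := by gcongr
      _ = _ := by ring
  have hfin := norm_image_sub_le_of_norm_deriv_le_segment_01'
    (f := fun t => ∫ U, F t U ∂μ) (f' := fun t => ∫ U, F' t U ∂μ)
    (fun t _ => (hder t).hasDerivWithinAt) hbound
  have h1 : ∀ U, F 1 U = Complex.exp (Complex.I * ((J.dev.pair U + τ * U.mean : ℝ) : ℂ)) := by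
    intro U
    simp only [hF]
    norm_num
  have h0 : ∀ U, F 0 U = Complex.exp (((-(β U) : ℝ) : ℂ) +
      Complex.I * ((τ * U.mean : ℝ) : ℂ)) := by
    intro U
    simp only [hF]
    norm_num
  simp only [h1, h0] at hfin
  exact hfin

theorem integral_abs_sq_le {X : Type*} [MeasurableSpace X] {μ : Measure X} [IsFiniteMeasure μ]
    (hμ1 : μ.real Set.univ ≤ 1) {f : X → ℝ} (hf : Integrable f μ)
    (hf2 : Integrable (fun x => f x ^ 2) μ) : ∫ x, |f x| ∂μ ≤ √(∫ x, f x ^ 2 ∂μ) := by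
  refine Real.le_sqrt_of_sq_le ?_
  set m := ∫ x, |f x| ∂μ with hm
  have h : 0 ≤ ∫ x, (|f x| - m) ^ 2 ∂μ := integral_nonneg fun x => sq_nonneg _
  have e : ∀ x, (|f x| - m) ^ 2 = (f x ^ 2 - 2 * m * |f x|) + m ^ 2 := fun x => by
    rw [sub_sq, sq_abs]
    ring
  simp only [e] at h
  have h1 : Integrable (fun x => 2 * m * |f x|) μ := hf.abs.const_mul _
  have h2 : Integrable (fun x => f x ^ 2 - 2 * m * |f x|) μ := hf2.sub h1
  rw [integral_add h2 (integrable_const _), integral_sub hf2 h1, integral_const_mul, ← hm, integral_const,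
    smul_eq_mul] at h
  nlinarith [sq_nonneg m]

theorem integral_le_of_ae_le (hK : IsCompact K) (hμK : ∀ᵐ U ∂μ, U ∈ K) (hμ1 : μ.real Set.univ ≤ 1)
    {f : SymMat N → ℝ} {C : ℝ} (hC : 0 ≤ C) (hf : Continuous f) (hfC : ∀ᵐ U ∂μ, f U ≤ C) :
    ∫ U, f U ∂μ ≤ C := by
  calc ∫ U, f U ∂μ ≤ ∫ _U, C ∂μ :=
        integral_mono_ae (integrable_of_isCompact hK hμK hf) (integrable_const C) hfC
    _ = μ.real Set.univ * C := by simp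
    _ ≤ 1 * C := by gcongr
    _ = C := one_mul C

/-- The second moment bound is applied to the image of `μ` under squaring the traceless part, where
`tr U²` becomes a fourth power trace. This is where negligible `tr U⁴` yields concentration; `72 = 4
· 18`. -/
theorem integral_abs_pair_dev_sq_le (hN : 0 < N) (hμ : OrthInvariant μ) (hK : IsCompact K)
    (hμK : ∀ᵐ U ∂μ, U ∈ K) (hμ1 : μ.real Set.univ ≤ 1) {δ : ℝ} (hδ0 : 0 ≤ δ)
    (hδ : ∀ᵐ U ∂μ, U.trPow 4 ≤ δ * N ^ 4) (J : SymMat N) :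
    ∫ U, |J.sq.dev.pair U.dev.sq| ∂μ ≤ √(72 * δ) * (N * J.trPow 2) := by
  have hN' : (0 : ℝ) < N := by exact_mod_cast hN
  set T : SymMat N → SymMat N := fun U => U.dev.sq with hT
  have hTc : Continuous T := SymMat.continuous_sq.comp SymMat.continuous_dev
  have hTO : ∀ O U, T (SymMat.conj O U) = SymMat.conj O (T U) := fun O U => by
    simp only [hT, SymMat.dev_conj, SymMat.sq_conj]
  set f : SymMat N → ℝ := fun U => J.sq.dev.pair (T U) with hf
  have hfc : Continuous f := (SymMat.continuous_pair _).comp hTc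
  have h2 := integral_sq_pair_dev_le hN (hμ.map hTc hTO) (hK.image hTc)
    (ae_map_mem_image hK hμK hTc) J.sq
  have hc2 : Continuous fun U => J.sq.dev.pair U ^ 2 := (SymMat.continuous_pair _).pow 2
  rw [integral_map hTc.measurable.aemeasurable hc2.aestronglyMeasurable,
    integral_map hTc.measurable.aemeasurable
      (SymMat.continuous_trPow 2).aestronglyMeasurable] at h2
  have h3 : ∫ U, (T U).trPow 2 ∂μ ≤ 18 * (δ * N ^ 4) := by
    refine integral_le_of_ae_le hK hμK hμ1 (by positivity) ((SymMat.continuous_trPow 2).comp hTc) ?_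
    filter_upwards [hδ] with U hU
    rw [hT, SymMat.trPow_two_sq]
    exact (SymMat.trPow_four_dev_le hN U).trans (by linarith)
  refine (integral_abs_sq_le hμ1 (integrable_of_isCompact hK hμK hfc)
    (integrable_of_isCompact hK hμK (hfc.pow 2))).trans ?_
  have h4 : ∫ U, f U ^ 2 ∂μ ≤ (72 * δ) * (N * J.trPow 2) ^ 2 := by
    refine h2.trans ?_
    rw [SymMat.trPow_two_sq]
    have h5 : 4 / (N : ℝ) ^ 2 * J.trPow 4 ≤ 4 / (N : ℝ) ^ 2 * J.trPow 2 ^ 2 :=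
      mul_le_mul_of_nonneg_left J.trPow_four_le (by positivity)
    refine (mul_le_mul h5 h3 (integral_nonneg fun U => (T U).trPow_two_nonneg)
      (mul_nonneg (by positivity) (sq_nonneg _))).trans_eq ?_
    generalize J.trPow 2 = x
    field_simp
    ring
  refine (Real.sqrt_le_sqrt h4).trans ?_
  rw [Real.sqrt_mul (by positivity), Real.sqrt_sq (mul_nonneg hN'.le J.trPow_two_nonneg)]

/-- Quantitative convergence of the characteristic function to the Gaussian mixture. -/
theorem norm_integral_exp_sub_le_of_bounds (hN : 0 < N) (hμ : OrthInvariant μ) (hK : IsCompact K)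
    (hμK : ∀ᵐ U ∂μ, U ∈ K) (hμ1 : μ.real Set.univ ≤ 1) {M δ : ℝ} (hM0 : 0 ≤ M) (hδ0 : 0 ≤ δ)
    (hM : ∀ᵐ U ∂μ, U.trPow 2 ≤ M * N ^ 2) (hδ : ∀ᵐ U ∂μ, U.trPow 4 ≤ δ * N ^ 4)
    (J : SymMat N) (τ : ℝ) :
    ‖∫ U, Complex.exp (Complex.I * ((J.dev.pair U + τ * U.mean : ℝ) : ℂ)) ∂μ -
      ∫ U, Complex.exp (((-(U.dev.trPow 2 / N ^ 2 * J.trPow 2) : ℝ) : ℂ) +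
        Complex.I * ((τ * U.mean : ℝ) : ℂ)) ∂μ‖ ≤
      2 * √(72 * δ) * J.trPow 2 + 8 * M * (∑ i, ∑ j, |J.1 i j|) ^ 2 / N := by
  have hN' : (0 : ℝ) < N := by exact_mod_cast hN
  refine (norm_integral_exp_sub_le hN hμ hK hμK J τ).trans ?_
  set f : SymMat N → ℝ := fun U => J.sq.dev.pair U.dev.sq with hf
  have hfc : Continuous f :=
    (SymMat.continuous_pair _).comp (SymMat.continuous_sq.comp SymMat.continuous_dev)
  have h1 : ∫ U, |f U| ∂μ ≤ √(72 * δ) * (N * J.trPow 2) :=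
    integral_abs_pair_dev_sq_le hN hμ hK hμK hμ1 hδ0 hδ J
  set S := ∑ i, ∑ j, |J.1 i j| with hS
  -- A bound of order `N²` on `tr U²` is spread by invariance over all entries, each of which is of
  -- order one in mean square.
  have hentry : ∀ i j, ∫ U : SymMat N, U.dev.1 i j ^ 2 ∂μ ≤ 4 * M := by
    intro i j
    have h2 := integral_sq_pair_dev_le hN hμ hK hμK (SymMat.entry i j)
    simp only [SymMat.pair_dev_left, SymMat.pair_entry] at h2
    have h3 : ∫ U : SymMat N, U.trPow 2 ∂μ ≤ M * N ^ 2 :=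
      integral_le_of_ae_le hK hμK hμ1 (by positivity) (SymMat.continuous_trPow 2) hM
    have h5 : 0 ≤ ∫ U : SymMat N, U.trPow 2 ∂μ := integral_nonneg fun U => U.trPow_two_nonneg
    have := SymMat.trPow_two_entry_le i j
    calc _ ≤ _ := h2
      _ ≤ 4 / (N : ℝ) ^ 2 * 1 * (M * N ^ 2) := by gcongr
      _ = 4 * M := by field_simp
  have hdc : ∀ i j, Continuous fun U : SymMat N => U.dev.1 i j := fun i j =>
    (SymMat.continuous_apply i j).comp SymMat.continuous_dev
  set c : SymMat N → ℝ := fun U => (U.dev.1 * J.1 * (U.dev.1 * J.1)).trace with hc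
  have hcc : Continuous c := by
    have h := (SymMat.continuous_val (N := N)).comp SymMat.continuous_dev
    have h' : Continuous fun U : SymMat N => U.dev.1 * J.1 := h.matrix_mul continuous_const
    exact (h'.matrix_mul h').matrix_trace
  have h2 : ∫ U, |c U| ∂μ ≤ 4 * M * S ^ 2 := by
    set G : (Fin N × Fin N) → (Fin N × Fin N) → SymMat N → ℝ := fun p q U =>
      |J.1 p.1 p.2| * |J.1 q.1 q.2| * ((U.dev.1 q.2 p.1 ^ 2 + U.dev.1 p.2 q.1 ^ 2) / 2) with hG
    have hi : ∀ i j, Integrable (fun U : SymMat N => U.dev.1 i j ^ 2) μ := fun i j =>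
      integrable_of_isCompact hK hμK ((hdc i j).pow 2)
    have hGi : ∀ p q, Integrable (G p q) μ := fun p q =>
      (((hi _ _).add (hi _ _)).div_const 2).const_mul _
    calc ∫ U, |c U| ∂μ ≤ ∫ U, ∑ p, ∑ q, G p q U ∂μ :=
          integral_mono (integrable_of_isCompact hK hμK hcc.abs)
            (integrable_finsetSum _ fun p _ => integrable_finsetSum _ fun q _ => hGi p q)
            fun U => SymMat.abs_trace_cross_le U.dev J
      _ = ∑ p, ∑ q, ∫ U, G p q U ∂μ := by
          rw [integral_finsetSum _ fun p _ => integrable_finsetSum _ fun q _ => hGi p q]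
          exact Finset.sum_congr rfl fun p _ => integral_finsetSum _ fun q _ => hGi p q
      _ ≤ ∑ p : Fin N × Fin N, ∑ q : Fin N × Fin N, |J.1 p.1 p.2| * |J.1 q.1 q.2| * (4 * M) := by
          refine Finset.sum_le_sum fun p _ => Finset.sum_le_sum fun q _ => ?_
          rw [hG, integral_const_mul, integral_div, integral_add (hi _ _) (hi _ _)]
          refine mul_le_mul_of_nonneg_left ?_ (by positivity)
          linarith [hentry q.2 p.1, hentry p.2 q.1]
      _ = 4 * M * S ^ 2 := by
          have e : S = ∑ p : Fin N × Fin N, |J.1 p.1 p.2| := by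
            rw [hS, Fintype.sum_prod_type]
          rw [e, pow_two, Finset.sum_mul_sum, Finset.mul_sum]
          refine Finset.sum_congr rfl fun p _ => ?_
          rw [Finset.mul_sum]
          exact Finset.sum_congr rfl fun q _ => by ring
  -- In the squared commutator, the trace part of `J²` reproduces the damping exactly. The traceless
  -- part of `J²` leaves `f`, and the mixed product `UJUJ` leaves `c`.
  have hpt : ∀ U : SymMat N, |SymMat.commSq U.dev J / N - 2 * (U.dev.trPow 2 / N ^ 2 * J.trPow 2)| ≤
      2 / N * |f U| + 2 / N * |c U| := by
    intro U
    have e : SymMat.commSq U.dev J / N - 2 * (U.dev.trPow 2 / N ^ 2 * J.trPow 2) =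
        2 / N * f U - 2 / N * c U := by
      rw [SymMat.commSq_eq, hf, hc]
      simp only [SymMat.pair_dev_left, SymMat.pair_dev_right, SymMat.trace_sq, SymMat.mean]
      field_simp
      ring
    rw [e]
    refine (abs_sub _ _).trans ?_
    rw [abs_mul, abs_mul, abs_of_pos (show (0 : ℝ) < 2 / N by positivity)]
  have hi1 : Integrable (fun U => |f U|) μ := integrable_of_isCompact hK hμK hfc.abs
  have hi2 : Integrable (fun U => |c U|) μ := integrable_of_isCompact hK hμK hcc.abs
  calc ∫ U, |SymMat.commSq U.dev J / N - 2 * (U.dev.trPow 2 / N ^ 2 * J.trPow 2)| ∂μ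
      ≤ ∫ U, (2 / N * |f U| + 2 / N * |c U|) ∂μ :=
        integral_mono_of_nonneg (Eventually.of_forall fun U => abs_nonneg _)
          ((hi1.const_mul _).add (hi2.const_mul _)) (Eventually.of_forall hpt)
    _ = 2 / N * ∫ U, |f U| ∂μ + 2 / N * ∫ U, |c U| ∂μ := by
        rw [integral_add (hi1.const_mul _) (hi2.const_mul _), integral_const_mul,
          integral_const_mul]
    _ ≤ 2 / N * (√(72 * δ) * (N * J.trPow 2)) + 2 / N * (4 * M * S ^ 2) := by gcongr
    _ = 2 * √(72 * δ) * J.trPow 2 + 8 * M * S ^ 2 / N := by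
        field_simp
        ring

end Moments

/-! ### Infinite symmetric matrices and their finite blocks -/

theorem infPow_one (J : Matrix ℕ ℕ ℝ) : infPow J 1 = J := by
  ext a b
  simp only [infPow]
  rw [tsum_eq_single a fun c hc => by simp [Matrix.one_apply_ne hc.symm]]
  simp

theorem infPow_diagonal (d : ℕ → ℝ) (k : ℕ) :
    infPow (Matrix.diagonal d) k = Matrix.diagonal fun a => d a ^ k := by
  induction k with
  | zero =>
    simp only [infPow, pow_zero]
    exact Matrix.diagonal_one.symm
  | succ k ih =>
    ext a c
    simp only [infPow, ih]
    rw [tsum_eq_single a fun b hb => by simp [Matrix.diagonal_apply_ne _ hb.symm]]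
    by_cases h : a = c
    · subst h
      simp [pow_succ]
    · simp [Matrix.diagonal_apply_ne _ h]

namespace SymMatInf

theorem trPow_two_eq_tsum (J : SymMatInf) : J.trPow 2 = ∑' p : ℕ × ℕ, J.1 p.1 p.2 ^ 2 := by
  rw [J.2.2.tsum_prod]
  refine tsum_congr fun a => ?_
  change ∑' b, infPow J.1 1 a b * J.1 b a = _
  rw [infPow_one]
  refine tsum_congr fun b => ?_
  rw [J.2.1.apply a b, pow_two]

theorem trPow_two_nonneg (J : SymMatInf) : 0 ≤ J.trPow 2 := by
  rw [trPow_two_eq_tsum]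
  exact tsum_nonneg fun p => sq_nonneg _

theorem trPow_two_congr {J J' : SymMatInf} (h : J.evenTraces = J'.evenTraces) :
    J.trPow 2 = J'.trPow 2 := by
  simpa [evenTraces] using congrFun h 0

theorem summable_sq_diag (J : SymMatInf) : Summable fun k => J.1 k k ^ 2 :=
  J.2.2.comp_injective (i := fun k : ℕ => (k, k)) fun _ _ h => congrArg Prod.fst h

/-- The infinite diagonal matrix with square summable entries `d`. -/
noncomputable def ofDiag (d : ℕ → ℝ) (hd : Summable fun k => d k ^ 2) : SymMatInf :=
  ⟨Matrix.diagonal d, Matrix.diagonal_transpose d, by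
    have hi : Function.Injective fun k : ℕ => (k, k) := fun _ _ h => congrArg Prod.fst h
    refine (hi.summable_iff fun p hp => ?_).1 (hd.congr fun k => ?_)
    · have : p.1 ≠ p.2 := fun h => hp ⟨p.1, Prod.ext rfl h⟩
      simp [Matrix.diagonal_apply_ne _ this]
    · simp⟩

theorem trPow_ofDiag (d : ℕ → ℝ) (hd : Summable fun k => d k ^ 2) (k : ℕ) :
    (ofDiag d hd).trPow k = ∑' a, d a ^ k := by
  simp [trPow, ofDiag, infPow_diagonal]

theorem evenTraces_ofDiag_congr {d d' : ℕ → ℝ} (hd : Summable fun k => d k ^ 2)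
    (hd' : Summable fun k => d' k ^ 2) (h : ∀ k, d k ^ 2 = d' k ^ 2) :
    (ofDiag d hd).evenTraces = (ofDiag d' hd').evenTraces := by
  funext p
  simp only [evenTraces, trPow_ofDiag, pow_mul, h]

theorem trace_corner (J : SymMatInf) (N : ℕ) :
    (J.corner N).1.trace = ∑ k ∈ Finset.range N, J.1 k k := by
  rw [Matrix.trace, Finset.sum_range]
  rfl

/-- The `N × N` matrix agreeing with `J` on the upper left `K × K` block, zero elsewhere. -/
noncomputable def block (J : SymMatInf) (K N : ℕ) : SymMat N :=
  ⟨fun i j => if (i : ℕ) < K ∧ (j : ℕ) < K then J.1 i j else 0, by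
    refine Matrix.IsSymm.ext fun i j => ?_
    rw [J.2.1.apply i j]
    simp only [and_comm]⟩

theorem sum_block (f : ℝ → ℝ) (hf : f 0 = 0) (J : SymMatInf) {K N : ℕ} (hKN : K ≤ N) :
    ∑ i, ∑ j, f ((J.block K N).1 i j) =
      ∑ p ∈ Finset.range K ×ˢ Finset.range K, f (J.1 p.1 p.2) := by
  have h : ∀ m n : ℕ, f (if m < K ∧ n < K then J.1 m n else 0) =
      if m < K then (if n < K then f (J.1 m n) else 0) else 0 := by
    intro m n
    split_ifs <;> simp_all
  have hs : ∀ g : ℕ → ℝ, (∑ i ∈ Finset.range N, if i < K then g i else 0) =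
      ∑ i ∈ Finset.range K, g i := by
    intro g
    rw [← Finset.sum_filter]
    refine Finset.sum_congr ?_ fun _ _ => rfl
    ext i
    simp only [Finset.mem_filter, Finset.mem_range]
    omega
  simp only [block, h]
  rw [Finset.sum_product, ← hs, Finset.sum_range]
  refine Finset.sum_congr rfl fun i _ => ?_
  split_ifs
  · rw [← hs, Finset.sum_range]
  · simp

theorem trPow_two_block (J : SymMatInf) {K N : ℕ} (hKN : K ≤ N) : (J.block K N).trPow 2 =
    ∑ p ∈ Finset.range K ×ˢ Finset.range K, J.1 p.1 p.2 ^ 2 := by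
  rw [SymMat.trPow_two_eq_sum]
  exact J.sum_block (fun x => x ^ 2) (by simp) hKN

theorem block_self (J : SymMatInf) (N : ℕ) : J.block N N = J.corner N := by
  refine Subtype.ext (Matrix.ext fun i j => ?_)
  exact if_pos ⟨i.2, j.2⟩

theorem trPow_two_corner_sub_block (J : SymMatInf) (K N : ℕ) :
    (J.corner N - J.block K N).trPow 2 = (J.corner N).trPow 2 - (J.block K N).trPow 2 := by
  simp only [SymMat.trPow_two_eq_sum, ← Finset.sum_sub_distrib]
  refine Finset.sum_congr rfl fun i _ => Finset.sum_congr rfl fun j _ => ?_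
  rw [SymMat.val_sub, Matrix.sub_apply]
  simp only [block, corner]
  split_ifs <;> ring

theorem trPow_two_block_le (J : SymMatInf) {K N : ℕ} (hKN : K ≤ N) :
    (J.block K N).trPow 2 ≤ J.trPow 2 := by
  rw [trPow_two_block J hKN, trPow_two_eq_tsum]
  exact J.2.2.sum_le_tsum _ fun _ _ => sq_nonneg _

/-- Hilbert–Schmidt approximation by a finite block. The sum of absolute values of its entries is
independent of `N`, so the error term in which it is divided by `N` disappears in the limit. -/
theorem exists_block (J : SymMatInf) {η : ℝ} (hη : 0 < η) : ∃ K : ℕ, ∃ C : ℝ, ∀ N, K ≤ N →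
    |J.trPow 2 - (J.block K N).trPow 2| ≤ η ∧ (J.corner N - J.block K N).trPow 2 ≤ η ∧
      (J.block K N).trPow 2 ≤ J.trPow 2 ∧ ∑ i, ∑ j, |(J.block K N).1 i j| = C := by
  have hs : HasSum (fun p : ℕ × ℕ => J.1 p.1 p.2 ^ 2) (J.trPow 2) := by
    rw [trPow_two_eq_tsum]
    exact J.2.2.hasSum
  have ht : Tendsto (fun K : ℕ => Finset.range K ×ˢ Finset.range K) atTop atTop := by
    refine tendsto_atTop_finset_of_monotone (fun m n h => ?_) fun p => ⟨p.1 + p.2 + 1, ?_⟩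
    · exact Finset.product_subset_product (Finset.range_mono h) (Finset.range_mono h)
    · simp only [Finset.mem_product, Finset.mem_range]
      omega
  obtain ⟨K, hK⟩ := ((hs.comp ht).eventually (lt_mem_nhds (sub_lt_self (J.trPow 2) hη))).exists
  refine ⟨K, ∑ p ∈ Finset.range K ×ˢ Finset.range K, |J.1 p.1 p.2|, fun N hN => ?_⟩
  have h1 := J.trPow_two_block_le hN
  have h2 : J.trPow 2 - η < (J.block K N).trPow 2 := by
    rw [trPow_two_block J hN]
    exact hK
  have h3 := J.trPow_two_block_le (le_refl N)
  rw [block_self] at h3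
  refine ⟨?_, ?_, h1, J.sum_block (fun x => |x|) (by simp) hN⟩
  · rw [abs_of_nonneg (by linarith)]
    linarith
  · rw [trPow_two_corner_sub_block]
    linarith

end SymMatInf

/-! ### The comparison for measures without compact support -/

section Quantitative

variable {N : ℕ} {μ : Measure (SymMat N)}

theorem OrthInvariant.restrict (hμ : OrthInvariant μ) {S : Set (SymMat N)} (hS : MeasurableSet S)
    (hSO : ∀ O, SymMat.conj O ⁻¹' S = S) : OrthInvariant (μ.restrict S) := by
  intro O
  conv_lhs => rw [← hSO O, ← Measure.restrict_map (SymMat.measurable_conj O) hS, hμ O]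

theorem norm_setIntegral_sub_integral_le {X : Type*} [MeasurableSpace X] {μ : Measure X}
    [IsProbabilityMeasure μ] {S : Set X} (hS : MeasurableSet S) {f : X → ℂ} (hf : Integrable f μ)
    (hf1 : ∀ x, ‖f x‖ ≤ 1) : ‖∫ x, f x ∂μ - ∫ x in S, f x ∂μ‖ ≤ μ.real Sᶜ := by
  rw [← integral_add_compl hS hf, add_sub_cancel_left]
  have := norm_setIntegral_le_of_norm_le_const (measure_lt_top μ Sᶜ) fun x _ => hf1 x
  simpa using this

theorem norm_exp_I_mul_sub_le (x y : ℝ) :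
    ‖Complex.exp (Complex.I * (x : ℂ)) - Complex.exp (Complex.I * (y : ℂ))‖ ≤ |x - y| := by
  have h : Complex.exp (Complex.I * (x : ℂ)) - Complex.exp (Complex.I * (y : ℂ)) =
      Complex.exp (Complex.I * (y : ℂ)) * (Complex.exp (Complex.I * ((x - y : ℝ) : ℂ)) - 1) := by
    rw [mul_sub, ← Complex.exp_add, mul_one]
    congr 2
    push_cast
    ring
  rw [h, norm_mul, Complex.norm_exp_I_mul_ofReal, one_mul]
  exact Real.norm_exp_I_mul_ofReal_sub_one_le

theorem abs_exp_neg_sub_le {x y : ℝ} (hx : 0 ≤ x) (hy : 0 ≤ y) :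
    |Real.exp (-x) - Real.exp (-y)| ≤ |x - y| := by
  wlog h : x ≤ y generalizing x y
  · rw [abs_sub_comm, abs_sub_comm x]
    exact this hy hx (le_of_not_ge h)
  have h1 : Real.exp (-y) ≤ Real.exp (-x) := Real.exp_le_exp.2 (by linarith)
  have h2 : Real.exp (-y) = Real.exp (-x) * Real.exp (-(y - x)) := by
    rw [← Real.exp_add]
    congr 1
    ring
  have h3 : Real.exp (-x) ≤ 1 := Real.exp_le_one_iff.2 (by linarith)
  have h4 := Real.one_sub_le_exp_neg (y - x)
  rw [abs_of_nonneg (by linarith), abs_of_nonpos (by linarith), h2]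
  nlinarith [Real.exp_pos (-x)]

theorem norm_exp_ofReal_add_I_mul (x y : ℝ) :
    ‖Complex.exp ((x : ℂ) + Complex.I * (y : ℂ))‖ = Real.exp x := by
  simp [Complex.norm_exp]

theorem norm_exp_neg_add_I_mul_sub_le {x y : ℝ} (hx : 0 ≤ x) (hy : 0 ≤ y) (z : ℝ) :
    ‖Complex.exp (((-x : ℝ) : ℂ) + Complex.I * (z : ℂ)) -
      Complex.exp (((-y : ℝ) : ℂ) + Complex.I * (z : ℂ))‖ ≤ |x - y| := by
  rw [Complex.exp_add, Complex.exp_add, ← sub_mul, norm_mul, Complex.norm_exp_I_mul_ofReal, mul_one,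
    ← Complex.ofReal_exp, ← Complex.ofReal_exp, ← Complex.ofReal_sub, Complex.norm_real]
  exact abs_exp_neg_sub_le hx hy

/-- The characteristic function of an invariant measure is close to a mixture of Gaussians in the
traceless direction. -/
theorem norm_charFun_sub_mixture_le [IsProbabilityMeasure μ] (hN : 0 < N) (hμ : OrthInvariant μ)
    {M δ : ℝ} (hM0 : 0 ≤ M) (hδ0 : 0 ≤ δ) (J J' : SymMat N) {t : ℝ} (ht : 0 ≤ t) :
    ‖∫ U, Complex.exp (Complex.I * (J.pair U : ℂ)) ∂μ -
      ∫ U, Complex.exp (((-(U.dev.trPow 2 / N ^ 2 * t) : ℝ) : ℂ) +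
        Complex.I * ((J.1.trace * U.mean : ℝ) : ℂ)) ∂μ‖ ≤
      2 * (μ.real {U | M * N ^ 2 < U.trPow 2} + μ.real {U | δ * N ^ 4 < U.trPow 4}) +
        2 * √(M * (J - J').trPow 2) +
        (2 * √(72 * δ) * J'.trPow 2 + 8 * M * (∑ i, ∑ j, |J'.1 i j|) ^ 2 / N) +
        M * |t - J'.trPow 2| := by
  have hN' : (0 : ℝ) < N := by exact_mod_cast hN
  set τ := J.1.trace
  -- Truncation by conjugation-invariant functions keeps the restricted measure invariant while
  -- making its support compact.
  set S : Set (SymMat N) := {U | U.trPow 2 ≤ M * N ^ 2} ∩ {U | U.trPow 4 ≤ δ * N ^ 4} with hS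
  have hSc : IsClosed S := (isClosed_le (SymMat.continuous_trPow 2) continuous_const).inter
    (isClosed_le (SymMat.continuous_trPow 4) continuous_const)
  have hSK : IsCompact S := (SymMat.isCompact_trPow_two_le (M * N ^ 2)).of_isClosed_subset hSc
    fun U hU => hU.1
  have hSm := hSc.measurableSet
  have hSO : ∀ O, SymMat.conj O ⁻¹' S = S := fun O => by
    ext U
    simp [hS, SymMat.trPow_conj]
  set ρ := μ.restrict S with hρ
  have hρO : OrthInvariant ρ := hμ.restrict hSm hSO
  have hρS : ∀ᵐ U ∂ρ, U ∈ S := ae_restrict_mem hSm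
  have hρ1 : ρ.real Set.univ ≤ 1 := by
    rw [hρ, measureReal_restrict_apply_univ]
    exact measureReal_le_one
  have hSμ : μ.real Sᶜ ≤ μ.real {U | M * N ^ 2 < U.trPow 2} + μ.real {U | δ * N ^ 4 < U.trPow 4} := by
    refine le_trans (measureReal_mono fun U hU => ?_) (measureReal_union_le _ _)
    by_contra h
    simp only [Set.mem_union, Set.mem_ofPred_eq, not_or, not_lt] at h
    exact hU h
  set b : SymMat N → ℝ := fun U => U.dev.trPow 2 / N ^ 2 with hb
  have hbc : Continuous b :=
    ((SymMat.continuous_trPow 2).comp SymMat.continuous_dev).div_const _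
  have hb0 : ∀ U, 0 ≤ b U := fun U => div_nonneg U.dev.trPow_two_nonneg (by positivity)
  have hbM : ∀ U ∈ S, b U ≤ M := fun U hU => by
    rw [hb, div_le_iff₀ (by positivity)]
    exact (SymMat.trPow_two_dev_le hN U).trans hU.1
  have hm := SymMat.continuous_mean (N := N)
  set f₁ : SymMat N → ℂ := fun U => Complex.exp (Complex.I * (J.pair U : ℂ)) with hf₁
  -- Only the traceless part of `J` is replaced by that of `J'`; the phase keeps the trace of `J`.
  -- Comparing the traces would not be possible, as they are not controlled by the Hilbert–Schmidt
  -- norm uniformly in `N`.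
  set f₂ : SymMat N → ℂ := fun U =>
    Complex.exp (Complex.I * ((J'.dev.pair U + τ * U.mean : ℝ) : ℂ)) with hf₂
  set f₃ : SymMat N → ℂ := fun U => Complex.exp (((-(b U * J'.trPow 2) : ℝ) : ℂ) +
    Complex.I * ((τ * U.mean : ℝ) : ℂ)) with hf₃
  set f₄ : SymMat N → ℂ := fun U => Complex.exp (((-(b U * t) : ℝ) : ℂ) +
    Complex.I * ((τ * U.mean : ℝ) : ℂ)) with hf₄
  have hp := J.continuous_pair
  have hp' := J'.dev.continuous_pair
  have c₁ : Continuous f₁ := by fun_prop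
  have c₂ : Continuous f₂ := by fun_prop
  have c₃ : Continuous f₃ := by fun_prop
  have c₄ : Continuous f₄ := by fun_prop
  have n₁ : ∀ U, ‖f₁ U‖ ≤ 1 := fun U => (Complex.norm_exp_I_mul_ofReal _).le
  have n₄ : ∀ U, ‖f₄ U‖ ≤ 1 := fun U => by
    rw [hf₄, norm_exp_ofReal_add_I_mul, Real.exp_le_one_iff, neg_nonpos]
    exact mul_nonneg (hb0 U) ht
  have i₁ : Integrable f₁ μ := Integrable.of_bound c₁.aestronglyMeasurable 1 (ae_of_all _ n₁)
  have i₄ : Integrable f₄ μ := Integrable.of_bound c₄.aestronglyMeasurable 1 (ae_of_all _ n₄)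
  have j : ∀ {f : SymMat N → ℂ}, Continuous f → Integrable f ρ := fun hf =>
    integrable_of_isCompact hSK hρS hf
  have e₁ := norm_setIntegral_sub_integral_le hSm i₁ n₁
  have e₄ := norm_setIntegral_sub_integral_le hSm i₄ n₄
  have e₂₃ : ‖∫ U, f₂ U ∂ρ - ∫ U, f₃ U ∂ρ‖ ≤
      2 * √(72 * δ) * J'.trPow 2 + 8 * M * (∑ i, ∑ j, |J'.1 i j|) ^ 2 / N :=
    norm_integral_exp_sub_le_of_bounds hN hρO hSK hρS hρ1 hM0 hδ0 (hρS.mono fun U hU => hU.1)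
      (hρS.mono fun U hU => hU.2) J' τ
  have e₃₄ : ‖∫ U, f₃ U ∂ρ - ∫ U, f₄ U ∂ρ‖ ≤ M * |t - J'.trPow 2| := by
    rw [← integral_sub (j c₃) (j c₄)]
    have h : ∀ᵐ U ∂ρ, ‖f₃ U - f₄ U‖ ≤ M * |t - J'.trPow 2| := hρS.mono fun U hU => by
      refine (norm_exp_neg_add_I_mul_sub_le (mul_nonneg (hb0 U) J'.trPow_two_nonneg)
        (mul_nonneg (hb0 U) ht) _).trans ?_
      rw [← mul_sub, abs_mul, abs_of_nonneg (hb0 U), abs_sub_comm]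
      exact mul_le_mul_of_nonneg_right (hbM U hU) (abs_nonneg _)
    refine (norm_integral_le_of_norm_le_const h).trans ?_
    have := mul_nonneg hM0 (abs_nonneg (t - J'.trPow 2))
    nlinarith
  have e₁₂ : ‖∫ U, f₁ U ∂ρ - ∫ U, f₂ U ∂ρ‖ ≤ 2 * √(M * (J - J').trPow 2) := by
    rw [← integral_sub (j c₁) (j c₂)]
    have hcd := (J - J').dev.continuous_pair
    have hi : Integrable (fun U => |(J - J').dev.pair U|) ρ :=
      integrable_of_isCompact hSK hρS hcd.abs
    have h : ∀ U, ‖f₁ U - f₂ U‖ ≤ |(J - J').dev.pair U| := fun U => by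
      refine (norm_exp_I_mul_sub_le _ _).trans_eq ?_
      rw [SymMat.pair_dev_left, SymMat.pair_dev_left, SymMat.pair_sub_left,
        SymMat.pair_dev_right J]
      congr 1
      ring
    refine (norm_integral_le_of_norm_le hi (Eventually.of_forall h)).trans ?_
    refine (integral_abs_sq_le hρ1 (integrable_of_isCompact hSK hρS hcd)
      (integrable_of_isCompact hSK hρS (hcd.pow 2))).trans ?_
    have h3 : ∫ U : SymMat N, U.trPow 2 ∂ρ ≤ M * N ^ 2 :=
      integral_le_of_ae_le hSK hρS hρ1 (by positivity) (SymMat.continuous_trPow 2)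
        (hρS.mono fun U hU => hU.1)
    have h4 : ∫ U, (J - J').dev.pair U ^ 2 ∂ρ ≤ 2 ^ 2 * (M * (J - J').trPow 2) := by
      refine (integral_sq_pair_dev_le hN hρO hSK hρS (J - J')).trans ?_
      refine (mul_le_mul_of_nonneg_left h3 (mul_nonneg (by positivity)
        (J - J').trPow_two_nonneg)).trans_eq ?_
      field_simp
      ring
    refine (Real.sqrt_le_sqrt h4).trans_eq ?_
    rw [Real.sqrt_mul (by positivity), Real.sqrt_sq (by positivity)]
  have key : ∫ U, f₁ U ∂μ - ∫ U, f₄ U ∂μ = (∫ U, f₁ U ∂μ - ∫ U, f₁ U ∂ρ) +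
      (∫ U, f₁ U ∂ρ - ∫ U, f₂ U ∂ρ) + (∫ U, f₂ U ∂ρ - ∫ U, f₃ U ∂ρ) +
      (∫ U, f₃ U ∂ρ - ∫ U, f₄ U ∂ρ) - (∫ U, f₄ U ∂μ - ∫ U, f₄ U ∂ρ) := by ring
  rw [key]
  refine (norm_sub_le _ _).trans ?_
  have t1 := norm_add_le ((∫ U, f₁ U ∂μ - ∫ U, f₁ U ∂ρ) + (∫ U, f₁ U ∂ρ - ∫ U, f₂ U ∂ρ) +
    (∫ U, f₂ U ∂ρ - ∫ U, f₃ U ∂ρ)) (∫ U, f₃ U ∂ρ - ∫ U, f₄ U ∂ρ)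
  have t2 := norm_add_le ((∫ U, f₁ U ∂μ - ∫ U, f₁ U ∂ρ) + (∫ U, f₁ U ∂ρ - ∫ U, f₂ U ∂ρ))
    (∫ U, f₂ U ∂ρ - ∫ U, f₃ U ∂ρ)
  have t3 := norm_add_le (∫ U, f₁ U ∂μ - ∫ U, f₁ U ∂ρ) (∫ U, f₁ U ∂ρ - ∫ U, f₂ U ∂ρ)
  linarith

end Quantitative

/-! ### Convergence to zero in probability -/

/-- Convergence to zero in probability along a sequence of probability spaces. -/
def TendstoZeroInProb {Ω : ℕ → Type*} [∀ N, MeasurableSpace (Ω N)] (μ : (N : ℕ) → Measure (Ω N))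
    (X : (N : ℕ) → Ω N → ℝ) : Prop :=
  ∀ ε : ℝ, 0 < ε → Tendsto (fun N => (μ N).real {x | ε < |X N x|}) atTop (𝓝 0)

section InProb

variable {Ω : ℕ → Type*} [∀ N, MeasurableSpace (Ω N)] {μ : (N : ℕ) → Measure (Ω N)}
  {X : (N : ℕ) → Ω N → ℝ}

theorem TendstoZeroInProb.of_eventually_le
    (h : ∀ ε : ℝ, 0 < ε → ∀ η : ℝ, 0 < η → ∀ᶠ N in atTop, (μ N).real {x | ε < |X N x|} ≤ η) :
    TendstoZeroInProb μ X := by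
  intro ε hε
  rw [Metric.tendsto_nhds]
  intro η hη
  filter_upwards [h ε hε (η / 2) (by positivity)] with N hN
  rw [Real.dist_0_eq_abs, abs_of_nonneg measureReal_nonneg]
  linarith

theorem TendstoZeroInProb.mul_of_bound [∀ N, IsProbabilityMeasure (μ N)]
    (hX : TendstoZeroInProb μ X) {c : ℕ → ℝ} {C : ℝ} (hc : ∀ᶠ N in atTop, |c N| ≤ C) :
    TendstoZeroInProb μ fun N x => c N * X N x := by
  have hC : 0 < |C| + 1 := by positivity
  intro ε hε
  refine squeeze_zero' (Eventually.of_forall fun N => measureReal_nonneg) ?_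
    (hX (ε / (|C| + 1)) (by positivity))
  filter_upwards [hc] with N hN
  refine measureReal_mono fun x hx => ?_
  simp only [Set.mem_ofPred_eq, abs_mul] at hx ⊢
  rw [div_lt_iff₀ hC]
  have h1 : |c N| ≤ |C| + 1 := hN.trans ((le_abs_self C).trans (by linarith))
  nlinarith [abs_nonneg (X N x)]

theorem TendstoZeroInProb.tendsto_integral [∀ N, IsProbabilityMeasure (μ N)]
    (hXm : ∀ N, Measurable (X N)) (hX : TendstoZeroInProb μ X) {f : (N : ℕ) → Ω N → ℂ} {C : ℝ}
    (hfC : ∀ N x, ‖f N x‖ ≤ C) (hfX : ∀ᶠ N in atTop, ∀ x, ‖f N x‖ ≤ |X N x|) :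
    Tendsto (fun N => ∫ x, f N x ∂(μ N)) atTop (𝓝 0) := by
  rw [Metric.tendsto_nhds]
  intro ε hε
  have hb : ∀ᶠ N in atTop, ‖∫ x, f N x ∂(μ N)‖ ≤
      ε / 2 + C * (μ N).real {x | ε / 2 < |X N x|} := by
    filter_upwards [hfX] with N hN
    have hm : MeasurableSet {x | ε / 2 < |X N x|} :=
      measurableSet_lt measurable_const (hXm N).abs
    have hi : Integrable ({x | ε / 2 < |X N x|}.indicator fun _ => C) (μ N) :=
      (integrable_const C).indicator hm
    refine (norm_integral_le_of_norm_le ((integrable_const (ε / 2)).add hi)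
      (Eventually.of_forall fun x => ?_)).trans_eq ?_
    · have h0 := (norm_nonneg _).trans (hfC N x)
      by_cases hx : ε / 2 < |X N x|
      · simp only [Pi.add_apply, Set.indicator, Set.mem_ofPred_eq, if_pos hx]
        linarith [hfC N x]
      · simp only [Pi.add_apply, Set.indicator, Set.mem_ofPred_eq, if_neg hx]
        linarith [hN x]
    · have := integral_add (integrable_const (ε / 2) (μ := μ N)) hi
      simp only [Pi.add_apply]
      rw [this, integral_indicator hm]
      simp [mul_comm]
  have ht : Tendsto (fun N => ε / 2 + C * (μ N).real {x | ε / 2 < |X N x|}) atTop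
      (𝓝 (ε / 2 + C * 0)) := ((hX (ε / 2) (by positivity)).const_mul C).const_add _
  filter_upwards [hb, ht.eventually (gt_mem_nhds (show ε / 2 + C * 0 < ε by linarith))] with N h1 h2
  rw [dist_zero_right]
  exact h1.trans_lt h2

theorem norm_one_sub_exp_I_mul_sq (x : ℝ) :
    ‖1 - Complex.exp (Complex.I * (x : ℂ))‖ ^ 2 = 2 * (1 - Real.cos x) := by
  rw [mul_comm, Complex.exp_mul_I, ← Complex.normSq_eq_norm_sq, Complex.normSq_apply,
    ← Complex.ofReal_cos, ← Complex.ofReal_sin]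
  simp only [Complex.sub_re, Complex.add_re, Complex.mul_re, Complex.sub_im, Complex.add_im,
    Complex.mul_im, Complex.ofReal_re, Complex.ofReal_im, Complex.I_re, Complex.I_im,
    Complex.one_re, Complex.one_im]
  nlinarith [Real.sin_sq_add_cos_sq x]

/-- Lévy continuity at zero: if `∫ (1 - cos (c X_N)) → 0` for all `c` then `X_N → 0` in
probability. -/
theorem TendstoZeroInProb.of_cos [∀ N, IsProbabilityMeasure (μ N)] (hXm : ∀ N, Measurable (X N))
    (h : ∀ c : ℝ, Tendsto (fun N => ∫ x, (1 - Real.cos (c * X N x)) ∂(μ N)) atTop (𝓝 0)) :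
    TendstoZeroInProb μ X := by
  have hprob : ∀ N, IsProbabilityMeasure ((μ N).map (X N)) := fun N =>
    Measure.isProbabilityMeasure_map (hXm N).aemeasurable
  have hchar : ∀ (N : ℕ) (c : ℝ), charFun ((μ N).map (X N)) c =
      ∫ x, Complex.exp (Complex.I * ((c * X N x : ℝ) : ℂ)) ∂(μ N) := fun N c => by
    have hc : Continuous fun x : ℝ => Complex.exp (c * x * Complex.I) := by fun_prop
    rw [charFun_apply_real, integral_map (hXm N).aemeasurable hc.aestronglyMeasurable]
    refine integral_congr_ae (Eventually.of_forall fun x => ?_)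
    simp only
    congr 1
    push_cast
    ring
  -- Since `|1 - exp (ix)|² = 2 (1 - cos x)`, Cauchy–Schwarz lets the cosine integrals control the
  -- whole complex characteristic function.
  have hle : ∀ (N : ℕ) (c : ℝ), ‖1 - charFun ((μ N).map (X N)) c‖ ≤
      √(2 * ∫ x, (1 - Real.cos (c * X N x)) ∂(μ N)) := by
    intro N c
    have hcm : Measurable fun x => Complex.exp (Complex.I * ((c * X N x : ℝ) : ℂ)) := by
      have := hXm N
      fun_prop
    have hi : Integrable (fun x => Complex.exp (Complex.I * ((c * X N x : ℝ) : ℂ))) (μ N) :=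
      Integrable.of_bound hcm.aestronglyMeasurable 1
        (ae_of_all _ fun x => (Complex.norm_exp_I_mul_ofReal _).le)
    have hi' : Integrable (fun x => 1 - Complex.exp (Complex.I * ((c * X N x : ℝ) : ℂ))) (μ N) :=
      (integrable_const 1).sub hi
    have e : 1 - charFun ((μ N).map (X N)) c =
        ∫ x, (1 - Complex.exp (Complex.I * ((c * X N x : ℝ) : ℂ))) ∂(μ N) := by
      rw [hchar, integral_sub (integrable_const 1) hi]
      simp
    rw [e]
    refine (norm_integral_le_integral_norm _).trans ?_
    have hsq : ∀ x, ‖1 - Complex.exp (Complex.I * ((c * X N x : ℝ) : ℂ))‖ ^ 2 =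
        2 * (1 - Real.cos (c * X N x)) := fun x => norm_one_sub_exp_I_mul_sq _
    have hi2 : Integrable (fun x => ‖1 - Complex.exp (Complex.I * ((c * X N x : ℝ) : ℂ))‖ ^ 2)
        (μ N) := by
      refine Integrable.of_bound ((hi'.norm.aestronglyMeasurable).pow 2) 4 (ae_of_all _ fun x => ?_)
      rw [hsq, Real.norm_eq_abs, abs_le]
      constructor <;> linarith [Real.neg_one_le_cos (c * X N x), Real.cos_le_one (c * X N x)]
    have h2 := integral_abs_sq_le (μ := μ N) (by simp) hi'.norm hi2
    simp only [abs_norm] at h2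
    refine h2.trans_eq ?_
    simp only [hsq]
    rw [integral_const_mul]
  have hto : ∀ c : ℝ, Tendsto (fun N => 1 - charFun ((μ N).map (X N)) c) atTop (𝓝 0) := by
    intro c
    have h1 : Tendsto (fun N => √(2 * ∫ x, (1 - Real.cos (c * X N x)) ∂(μ N))) atTop (𝓝 0) := by
      simpa using ((h c).const_mul 2).sqrt
    exact squeeze_zero_norm (fun N => hle N c) h1
  intro r hr
  have hI : Tendsto (fun N => ∫ t in (-(2 * r⁻¹))..(2 * r⁻¹), (1 - charFun ((μ N).map (X N)) t))
      atTop (𝓝 (∫ t in (-(2 * r⁻¹))..(2 * r⁻¹), (0 : ℂ))) := by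
    refine intervalIntegral.tendsto_integral_filter_of_dominated_convergence (fun _ => 2)
      (Eventually.of_forall fun N => ?_) (Eventually.of_forall fun N => ?_) ?_ ?_
    · exact (measurable_const.sub measurable_charFun).aestronglyMeasurable
    · refine ae_of_all _ fun t _ => (norm_sub_le _ _).trans ?_
      have := norm_charFun_le_one (μ := (μ N).map (X N)) t
      simp only [norm_one]
      linarith
    · exact intervalIntegrable_const
    · exact ae_of_all _ fun t _ => hto t
  have hfin : Tendsto (fun N => 2⁻¹ * r *
      ‖∫ t in (-(2 * r⁻¹))..(2 * r⁻¹), (1 - charFun ((μ N).map (X N)) t)‖) atTop (𝓝 0) := by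
    simpa using hI.norm.const_mul (2⁻¹ * r)
  refine squeeze_zero (fun N => measureReal_nonneg) (fun N => ?_) hfin
  have h1 := measureReal_abs_gt_le_integral_charFun (μ := (μ N).map (X N)) hr
  rw [neg_mul] at h1
  have hs : MeasurableSet {x : ℝ | r < |x|} := measurableSet_lt measurable_const measurable_id.abs
  rw [map_measureReal_apply (hXm N) hs] at h1
  exact h1

end InProb

/-! ### Gaussian mixtures in the limit `N → ∞` -/

section Limit

variable {μ : (N : ℕ) → Measure (SymMat N)} [∀ N, IsProbabilityMeasure (μ N)] {ν : Measure ℝ}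
  [IsProbabilityMeasure ν]

/-- A bounded continuous substitute for the indicator of a tail, so that weak convergence applies to
it. -/
theorem exists_integral_clamp_lt (ν : Measure ℝ) [IsProbabilityMeasure ν] {ε : ℝ} (hε : 0 < ε) :
    ∃ R : ℝ, 0 ≤ R ∧ ∫ b, min 1 (max 0 (b - R)) ∂ν < ε := by
  have h : Tendsto (fun n : ℕ => ∫ b, min 1 (max 0 (b - (n : ℝ))) ∂ν) atTop (𝓝 (∫ _b, 0 ∂ν)) := by
    refine tendsto_integral_of_dominated_convergence (fun _ => 1) (fun n => ?_)
      (integrable_const 1) (fun n => ae_of_all _ fun b => ?_) (ae_of_all _ fun b => ?_)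
    · exact Continuous.aestronglyMeasurable (by fun_prop)
    · rw [Real.norm_eq_abs, abs_of_nonneg (le_min zero_le_one (le_max_left _ _))]
      exact min_le_left _ _
    · refine tendsto_const_nhds.congr' ?_
      filter_upwards [eventually_ge_atTop ⌈b⌉₊] with n hn
      have h1 : b ≤ n := (Nat.le_ceil b).trans (by exact_mod_cast hn)
      rw [max_eq_left (by linarith), min_eq_right zero_le_one]
  rw [integral_zero] at h
  obtain ⟨n, hn⟩ := (h.eventually (gt_mem_nhds hε)).exists
  exact ⟨n, Nat.cast_nonneg n, hn⟩

theorem RadialLawTendsto.tight (h : RadialLawTendsto μ ν) {ε : ℝ} (hε : 0 < ε) :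
    ∃ M : ℝ, 0 ≤ M ∧ ∀ᶠ N in atTop, (μ N).real {U | M * N ^ 2 < U.trPow 2} ≤ ε := by
  obtain ⟨R, hR0, hR⟩ := exists_integral_clamp_lt ν hε
  set f : BoundedContinuousFunction ℝ ℝ := BoundedContinuousFunction.ofNormedAddCommGroup
    (fun b => min 1 (max 0 (b - R))) (by fun_prop) 1 fun b => by
      rw [Real.norm_eq_abs, abs_of_nonneg (le_min zero_le_one (le_max_left _ _))]
      exact min_le_left _ _ with hf
  have h1 := (h f).eventually (gt_mem_nhds (show ∫ b, f b ∂ν < ε from hR))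
  -- The clamp equals one from `R + 1` on, and `N (N + 1) ≤ 2 N²` for `N ≥ 1` supplies the factor
  -- `2`.
  refine ⟨2 * (R + 1), by positivity, ?_⟩
  filter_upwards [h1, eventually_gt_atTop 0] with N hN hN0
  have hN1 : (1 : ℝ) ≤ N := by exact_mod_cast hN0
  refine le_trans ?_ hN.le
  have hm : MeasurableSet {U : SymMat N | 2 * (R + 1) * (N : ℝ) ^ 2 < U.trPow 2} :=
    measurableSet_lt measurable_const (SymMat.continuous_trPow 2).measurable
  rw [← integral_indicator_one hm]
  have hc : Continuous fun U : SymMat N => f (U.trPow 2 / ((N : ℝ) * ((N : ℝ) + 1))) :=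
    f.continuous.comp ((SymMat.continuous_trPow 2).div_const _)
  refine integral_mono ((integrable_const 1).indicator hm)
    (Integrable.of_bound hc.aestronglyMeasurable ‖f‖ (ae_of_all _ fun U => f.norm_coe_le_norm _))
    fun U => ?_
  have hf0 : ∀ x, 0 ≤ f x := fun x => le_min zero_le_one (le_max_left _ _)
  by_cases hU : U ∈ {U : SymMat N | 2 * (R + 1) * (N : ℝ) ^ 2 < U.trPow 2}
  swap
  · rw [Set.indicator_of_notMem hU]
    exact hf0 _
  rw [Set.indicator_of_mem hU]
  have h2 : R + 1 ≤ U.trPow 2 / ((N : ℝ) * ((N : ℝ) + 1)) := by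
    rw [le_div_iff₀ (by positivity)]
    refine le_trans ?_ (le_of_lt hU)
    nlinarith [mul_nonneg (mul_nonneg (show 0 ≤ R + 1 by positivity) (show (0 : ℝ) ≤ N by positivity))
      (sub_nonneg.2 hN1)]
  change (1 : ℝ) ≤ min 1 (max 0 (_ - R))
  exact le_min le_rfl (le_max_of_le_right (by linarith))

theorem QuarticNegligible.eventually_le (h : QuarticNegligible μ) {δ ε : ℝ} (hδ : 0 < δ)
    (hε : 0 < ε) : ∀ᶠ N in atTop, (μ N).real {U | δ * N ^ 4 < U.trPow 4} ≤ ε := by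
  have h1 := (ENNReal.tendsto_toReal ENNReal.zero_ne_top).comp (h δ hδ)
  filter_upwards [h1.eventually (gt_mem_nhds (show (0 : ENNReal).toReal < ε by simpa using hε)),
    eventually_gt_atTop 0] with N hN hN0
  refine le_trans (measureReal_mono fun U hU => ?_) hN.le
  change δ * (N : ℝ) ^ 4 < U.trPow 4 at hU
  change δ * ((N : ℝ) * ((N : ℝ) + 1) / 2) ^ 2 < U.trPow 4
  refine lt_of_le_of_lt ?_ hU
  have hN1 : (1 : ℝ) ≤ N := by exact_mod_cast hN0
  refine mul_le_mul_of_nonneg_left ?_ hδ.le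
  have h2 : (N : ℝ) * (N + 1) / 2 ≤ N ^ 2 := by nlinarith
  calc ((N : ℝ) * (N + 1) / 2) ^ 2 ≤ ((N : ℝ) ^ 2) ^ 2 := by gcongr
    _ = (N : ℝ) ^ 4 := by ring

/-- The difference between the characteristic function at the corner of `J` and the mixture of
Gaussians tends to zero. -/
theorem tendsto_charFun_sub_mixture (hμ : ∀ N, OrthInvariant (μ N)) (hr : RadialLawTendsto μ ν)
    (hq : QuarticNegligible μ) (J : SymMatInf) :
    Tendsto (fun N : ℕ => ∫ U, Complex.exp (Complex.I * ((J.corner N).pair U : ℂ)) ∂(μ N) -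
      ∫ U, Complex.exp (((-(U.dev.trPow 2 / N ^ 2 * J.trPow 2) : ℝ) : ℂ) +
        Complex.I * (((J.corner N).1.trace * U.mean : ℝ) : ℂ)) ∂(μ N)) atTop (𝓝 0) := by
  rw [Metric.tendsto_nhds]
  intro ε hε
  set t := J.trPow 2 with ht
  have ht0 : 0 ≤ t := J.trPow_two_nonneg
  -- The order of choices matters: tightness fixes `M`, then `δ` controls the quartic error, `η` is
  -- small relative to `M`, the block and its constant `C` depend on `η`, and `N` is taken large
  -- last.
  obtain ⟨M, hM0, hM⟩ := hr.tight (show 0 < ε / 16 by positivity)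
  obtain ⟨δ, hδ, hδt⟩ : ∃ δ : ℝ, 0 < δ ∧ 2 * √(72 * δ) * t ≤ ε / 8 := by
    have hc : Tendsto (fun δ : ℝ => 2 * √(72 * δ) * t) (𝓝[>] 0) (𝓝 (2 * √(72 * 0) * t)) :=
      (Continuous.tendsto (by fun_prop) 0).mono_left nhdsWithin_le_nhds
    rw [mul_zero, Real.sqrt_zero, mul_zero, zero_mul] at hc
    obtain ⟨δ, h1, h2⟩ := ((hc.eventually (gt_mem_nhds (show 0 < ε / 8 by positivity))).and
      self_mem_nhdsWithin).exists
    exact ⟨δ, h2, h1.le⟩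
  obtain ⟨η, hη, hη1, hη2⟩ : ∃ η : ℝ, 0 < η ∧ 2 * √(M * η) ≤ ε / 8 ∧ M * η ≤ ε / 8 := by
    have hc : Tendsto (fun η : ℝ => 2 * √(M * η)) (𝓝[>] 0) (𝓝 (2 * √(M * 0))) :=
      (Continuous.tendsto (by fun_prop) 0).mono_left nhdsWithin_le_nhds
    have hd : Tendsto (fun η : ℝ => M * η) (𝓝[>] 0) (𝓝 (M * 0)) :=
      (Continuous.tendsto (by fun_prop) 0).mono_left nhdsWithin_le_nhds
    rw [mul_zero, Real.sqrt_zero, mul_zero] at hc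
    rw [mul_zero] at hd
    obtain ⟨η, ⟨h1, h2⟩, h3⟩ := (((hc.eventually (gt_mem_nhds (show 0 < ε / 8 by positivity))).and
      (hd.eventually (gt_mem_nhds (show 0 < ε / 8 by positivity)))).and self_mem_nhdsWithin).exists
    exact ⟨η, h3, h1.le, h2.le⟩
  obtain ⟨K, C, hK⟩ := J.exists_block hη
  have hC : Tendsto (fun N : ℕ => 8 * M * C ^ 2 / (N : ℝ)) atTop (𝓝 0) :=
    tendsto_const_div_atTop_nhds_zero_nat _
  filter_upwards [hM, hq.eventually_le hδ (show 0 < ε / 16 by positivity), eventually_ge_atTop K,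
    eventually_gt_atTop 0, hC.eventually (gt_mem_nhds (show 0 < ε / 8 by positivity))]
    with N h1 h2 h3 h4 h5
  obtain ⟨k1, k2, k3, k4⟩ := hK N h3
  have hmain := norm_charFun_sub_mixture_le h4 (hμ N) hM0 hδ.le (J.corner N) (J.block K N) ht0
  rw [k4] at hmain
  rw [dist_zero_right]
  have g1 : 2 * √(M * (J.corner N - J.block K N).trPow 2) ≤ ε / 8 := by
    refine le_trans ?_ hη1
    gcongr
  have g2 : 2 * √(72 * δ) * (J.block K N).trPow 2 ≤ ε / 8 := by
    refine le_trans ?_ hδt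
    gcongr
  have g3 : M * |t - (J.block K N).trPow 2| ≤ ε / 8 := by
    refine le_trans ?_ hη2
    gcongr
  linarith

/-- If the limiting characteristic function only sees the even traces, two sources with the same
even traces have the same limit, and the trace of one controls that of the other. -/
theorem tendsto_integral_one_sub_cos (hμ : ∀ N, OrthInvariant (μ N)) (hr : RadialLawTendsto μ ν)
    (hq : QuarticNegligible μ) {φ : (ℕ → ℝ) → ℂ}
    (hφ : ∀ J : SymMatInf, Tendsto (fun N : ℕ =>
      ∫ U, Complex.exp (Complex.I * ((J.corner N).pair U : ℂ)) ∂(μ N)) atTop (𝓝 (φ J.evenTraces)))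
    {J J' : SymMatInf} (hJ : J.evenTraces = J'.evenTraces)
    (hJ' : TendstoZeroInProb μ fun N U => (J'.corner N).1.trace * U.mean) :
    Tendsto (fun N : ℕ => ∫ U : SymMat N, (1 - Real.cos ((J.corner N).1.trace * U.mean)) ∂(μ N))
      atTop (𝓝 0) := by
  set t := J.trPow 2 with ht
  have ht0 : 0 ≤ t := J.trPow_two_nonneg
  set E : (ℕ → ℝ) → (N : ℕ) → SymMat N → ℂ := fun τ N U =>
    Complex.exp (((-(U.dev.trPow 2 / N ^ 2 * t) : ℝ) : ℂ) + Complex.I * ((τ N * U.mean : ℝ) : ℂ))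
    with hE
  set τ : ℕ → ℝ := fun N => (J.corner N).1.trace
  set τ' : ℕ → ℝ := fun N => (J'.corner N).1.trace
  have hbc : ∀ N, Continuous fun U : SymMat N => U.dev.trPow 2 / (N : ℝ) ^ 2 := fun N =>
    ((SymMat.continuous_trPow 2).comp SymMat.continuous_dev).div_const _
  have hb0 : ∀ (N : ℕ) (U : SymMat N), 0 ≤ U.dev.trPow 2 / (N : ℝ) ^ 2 := fun N U =>
    div_nonneg U.dev.trPow_two_nonneg (by positivity)
  have hmc : ∀ N, Continuous fun U : SymMat N => U.mean := fun N => SymMat.continuous_mean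
  have hEc : ∀ τ N, Continuous (E τ N) := fun τ N => by
    have := hbc N
    have := hmc N
    simp only [hE]
    fun_prop
  have hE1 : ∀ τ N U, ‖E τ N U‖ ≤ 1 := fun τ N U => by
    rw [hE, norm_exp_ofReal_add_I_mul, Real.exp_le_one_iff, neg_nonpos]
    exact mul_nonneg (hb0 N U) ht0
  have hEi : ∀ τ N, Integrable (E τ N) (μ N) := fun τ N =>
    Integrable.of_bound (hEc τ N).aestronglyMeasurable 1 (ae_of_all _ (hE1 τ N))
  have h1 : Tendsto (fun N : ℕ => ∫ U, Complex.exp (Complex.I * ((J.corner N).pair U : ℂ)) ∂(μ N) -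
      ∫ U, E τ N U ∂(μ N)) atTop (𝓝 0) := tendsto_charFun_sub_mixture hμ hr hq J
  have h2 : Tendsto (fun N : ℕ => ∫ U, Complex.exp (Complex.I * ((J'.corner N).pair U : ℂ)) ∂(μ N) -
      ∫ U, E τ' N U ∂(μ N)) atTop (𝓝 0) := by
    have h := tendsto_charFun_sub_mixture hμ hr hq J'
    rw [← SymMatInf.trPow_two_congr hJ] at h
    exact h
  have h3 : Tendsto (fun N => ∫ U, (E τ' N U - E (fun _ => 0) N U) ∂(μ N)) atTop (𝓝 0) := by
    refine hJ'.tendsto_integral (fun N => ((hmc N).measurable.const_mul _)) (C := 2)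
      (fun N U => ?_) (Eventually.of_forall fun N U => ?_)
    · refine (norm_sub_le _ _).trans ?_
      linarith [hE1 τ' N U, hE1 (fun _ => 0) N U]
    · simp only [hE]
      rw [Complex.exp_add, Complex.exp_add, ← mul_sub, norm_mul, ← Complex.ofReal_exp,
        Complex.norm_real, Real.norm_eq_abs, abs_of_pos (Real.exp_pos _)]
      have h4 : Real.exp (-(U.dev.trPow 2 / (N : ℝ) ^ 2 * t)) ≤ 1 := by
        rw [Real.exp_le_one_iff, neg_nonpos]
        exact mul_nonneg (hb0 N U) ht0
      have h5 := norm_exp_I_mul_sub_le (τ' N * U.mean) (0 * U.mean)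
      rw [zero_mul, sub_zero] at h5
      simp only [zero_mul]
      exact (mul_le_of_le_one_left (norm_nonneg _) h4).trans h5
  -- Both characteristic functions have the same limit, so the mixtures with phases `τ` and `τ'`
  -- agree asymptotically; by `h3` the latter phase can be dropped.
  have h4 : Tendsto (fun N => ∫ U, (E (fun _ => 0) N U - E τ N U) ∂(μ N)) atTop (𝓝 0) := by
    have h5 := (h1.sub h2).sub h3 |>.sub ((hφ J).sub (hφ J'))
    rw [hJ] at h5
    simp only [sub_self] at h5
    refine h5.congr fun N => ?_
    rw [integral_sub (hEi τ' N) (hEi (fun _ => 0) N), integral_sub (hEi (fun _ => 0) N) (hEi τ N)]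
    ring
  have h5 : Tendsto (fun N => ∫ U : SymMat N, Real.exp (-(U.dev.trPow 2 / (N : ℝ) ^ 2 * t)) *
      (1 - Real.cos (τ N * U.mean)) ∂(μ N)) atTop (𝓝 0) := by
    have h6 := (Complex.continuous_re.tendsto 0).comp h4
    rw [Complex.zero_re] at h6
    refine h6.congr fun N => ?_
    have h7 := integral_re ((hEi (fun _ => 0) N).sub (hEi τ N))
    simp only [Function.comp_apply]
    refine Eq.trans h7.symm ?_
    refine integral_congr_ae (Eventually.of_forall fun U => ?_)
    simp only [hE, Pi.sub_apply, RCLike.re_to_complex, Complex.sub_re, Complex.exp_re]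
    simp [-Complex.ofReal_mul, -Complex.ofReal_neg]
    ring
  rw [Metric.tendsto_nhds]
  intro ε hε
  -- Where `tr U² ≤ M N²` the damping factor is at least `exp (-M t)` and can be divided out; the
  -- complement has small probability.
  obtain ⟨M, hM0, hM⟩ := hr.tight (show 0 < ε / 4 by positivity)
  have h6 : Tendsto (fun N => Real.exp (M * t) * ∫ U : SymMat N,
      Real.exp (-(U.dev.trPow 2 / (N : ℝ) ^ 2 * t)) * (1 - Real.cos (τ N * U.mean)) ∂(μ N))
      atTop (𝓝 0) := by simpa using h5.const_mul (Real.exp (M * t))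
  filter_upwards [hM, h6.eventually (gt_mem_nhds (show 0 < ε / 4 by positivity)),
    eventually_gt_atTop 0] with N g1 g2 hN
  have hN' : (0 : ℝ) < N := by exact_mod_cast hN
  set S : Set (SymMat N) := {U | M * (N : ℝ) ^ 2 < U.trPow 2} with hS
  have hSm : MeasurableSet S :=
    measurableSet_lt measurable_const (SymMat.continuous_trPow 2).measurable
  have hcos : ∀ x : ℝ, 0 ≤ 1 - Real.cos x ∧ 1 - Real.cos x ≤ 2 := fun x =>
    ⟨by linarith [Real.cos_le_one x], by linarith [Real.neg_one_le_cos x]⟩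
  have hi : Integrable (fun U : SymMat N => Real.exp (-(U.dev.trPow 2 / (N : ℝ) ^ 2 * t)) *
      (1 - Real.cos (τ N * U.mean))) (μ N) := by
    have c1 := hbc N
    have c2 := hmc N
    have hc : Continuous fun U : SymMat N => Real.exp (-(U.dev.trPow 2 / (N : ℝ) ^ 2 * t)) *
      (1 - Real.cos (τ N * U.mean)) := by fun_prop
    refine Integrable.of_bound hc.aestronglyMeasurable 2 (ae_of_all _ fun U => ?_)
    have h7 : Real.exp (-(U.dev.trPow 2 / (N : ℝ) ^ 2 * t)) ≤ 1 := by
      rw [Real.exp_le_one_iff, neg_nonpos]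
      exact mul_nonneg (hb0 N U) ht0
    rw [Real.norm_eq_abs, abs_mul, abs_of_pos (Real.exp_pos _), abs_of_nonneg (hcos _).1]
    nlinarith [hcos (τ N * U.mean)]
  have hind : Integrable (S.indicator fun _ => (2 : ℝ)) (μ N) := (integrable_const 2).indicator hSm
  have hle : ∫ U : SymMat N, (1 - Real.cos (τ N * U.mean)) ∂(μ N) ≤
      ∫ U : SymMat N, (Real.exp (M * t) * (Real.exp (-(U.dev.trPow 2 / (N : ℝ) ^ 2 * t)) *
      (1 - Real.cos (τ N * U.mean))) + S.indicator (fun _ => (2 : ℝ)) U) ∂(μ N) := by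
    refine integral_mono_of_nonneg (ae_of_all _ fun U => (hcos _).1) ((hi.const_mul _).add hind)
      (ae_of_all _ fun U => ?_)
    simp only
    by_cases hU : U ∈ S
    · rw [Set.indicator_of_mem hU]
      have := mul_nonneg (Real.exp_pos (M * t)).le (mul_nonneg
        (Real.exp_pos (-(U.dev.trPow 2 / (N : ℝ) ^ 2 * t))).le (hcos (τ N * U.mean)).1)
      linarith [(hcos (τ N * U.mean)).2]
    · rw [Set.indicator_of_notMem hU, add_zero, ← mul_assoc, ← Real.exp_add]
      refine le_mul_of_one_le_left (hcos _).1 (Real.one_le_exp ?_)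
      have h8 : U.dev.trPow 2 / (N : ℝ) ^ 2 ≤ M := by
        rw [div_le_iff₀ (by positivity)]
        exact (SymMat.trPow_two_dev_le hN U).trans (not_lt.1 hU)
      nlinarith
  rw [integral_add (hi.const_mul _) hind, integral_const_mul, integral_indicator hSm,
    setIntegral_const, smul_eq_mul] at hle
  rw [Real.dist_0_eq_abs, abs_of_nonneg (integral_nonneg fun U => (hcos _).1)]
  linarith

end Limit

/-! ### Negligibility of the trace, and the Laplace transform -/

/-- Partial sums of `±|d k|` with greedy signs, chosen to stay bounded. -/
noncomputable def greedySum (d : ℕ → ℝ) : ℕ → ℝ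
  | 0 => 0
  | k + 1 => if 0 ≤ greedySum d k then greedySum d k - |d k| else greedySum d k + |d k|

theorem sq_greedySum_succ_sub (d : ℕ → ℝ) (k : ℕ) :
    (greedySum d (k + 1) - greedySum d k) ^ 2 = d k ^ 2 := by
  rw [greedySum]
  split_ifs
  · rw [sub_sub_cancel_left, neg_sq, sq_abs]
  · rw [add_sub_cancel_left, sq_abs]

theorem abs_greedySum_le {d : ℕ → ℝ} {B : ℝ} (hB : ∀ k, |d k| ≤ B) (k : ℕ) :
    |greedySum d k| ≤ B := by
  induction k with
  | zero => simpa [greedySum] using (abs_nonneg _).trans (hB 0)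
  | succ k ih =>
    have h1 := hB k
    have h0 := abs_nonneg (d k)
    rw [abs_le] at ih ⊢
    rw [greedySum]
    split_ifs with h
    · constructor <;> linarith
    · constructor <;> linarith [not_le.1 h]

theorem RadialLawTendsto.ae_nonneg {μ : (N : ℕ) → Measure (SymMat N)} {ν : Measure ℝ}
    [IsProbabilityMeasure ν] (h : RadialLawTendsto μ ν) : ∀ᵐ b ∂ν, 0 ≤ b := by
  set f : BoundedContinuousFunction ℝ ℝ := BoundedContinuousFunction.ofNormedAddCommGroup
    (fun b => min 1 (max 0 (-b))) (by fun_prop) 1 fun b => by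
      rw [Real.norm_eq_abs, abs_of_nonneg (le_min zero_le_one (le_max_left _ _))]
      exact min_le_left _ _ with hf
  have hf0 : ∀ b, 0 ≤ f b := fun b => le_min zero_le_one (le_max_left _ _)
  have h0 : ∀ b, 0 ≤ b → f b = 0 := fun b hb => by
    change min 1 (max 0 (-b)) = 0
    rw [max_eq_left (by linarith), min_eq_right zero_le_one]
  have h1 : ∫ b, f b ∂ν = 0 := by
    refine tendsto_nhds_unique (h f) (tendsto_const_nhds.congr fun N => ?_)
    refine (integral_eq_zero_of_ae (Eventually.of_forall fun U => ?_)).symm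
    exact h0 _ (div_nonneg U.trPow_two_nonneg (by positivity))
  have h2 := (integral_eq_zero_iff_of_nonneg (fun b => hf0 b) (f.integrable ν)).1 h1
  filter_upwards [h2] with b hb
  by_contra hneg
  have h3 : 0 < f b := lt_min zero_lt_one (lt_max_of_lt_right (by linarith))
  exact h3.ne' hb

section Limit

variable {μ : (N : ℕ) → Measure (SymMat N)} [∀ N, IsProbabilityMeasure (μ N)] {ν : Measure ℝ}
  [IsProbabilityMeasure ν]

/-- Two square summable diagonals differing by signs: if the normalized traces of one are
negligible, so are those of the other. -/
theorem tendstoZeroInProb_sum_mul_mean (hμ : ∀ N, OrthInvariant (μ N)) (hr : RadialLawTendsto μ ν)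
    (hq : QuarticNegligible μ) {φ : (ℕ → ℝ) → ℂ}
    (hφ : ∀ J : SymMatInf, Tendsto (fun N : ℕ =>
      ∫ U, Complex.exp (Complex.I * ((J.corner N).pair U : ℂ)) ∂(μ N)) atTop (𝓝 (φ J.evenTraces)))
    {d d' : ℕ → ℝ} (hd : Summable fun k => d k ^ 2) (hdd : ∀ k, d k ^ 2 = d' k ^ 2)
    (h : TendstoZeroInProb μ fun N U => (∑ k ∈ Finset.range N, d' k) * U.mean) :
    TendstoZeroInProb μ fun N U => (∑ k ∈ Finset.range N, d k) * U.mean := by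
  have htr : ∀ (e : ℕ → ℝ) (he : Summable fun k => e k ^ 2) (N : ℕ),
      ((SymMatInf.ofDiag e he).corner N).1.trace = ∑ k ∈ Finset.range N, e k := fun e he N => by
    rw [SymMatInf.trace_corner]
    simp [SymMatInf.ofDiag]
  refine TendstoZeroInProb.of_cos
    (fun N => (SymMat.continuous_mean.measurable.const_mul _)) fun c => ?_
  have hs : Summable fun k => (c * d k) ^ 2 := by
    simp only [mul_pow]
    exact hd.mul_left _
  have hs' : Summable fun k => (c * d' k) ^ 2 := by
    simpa only [mul_pow, hdd] using hs
  have key := tendsto_integral_one_sub_cos hμ hr hq hφ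
    (SymMatInf.evenTraces_ofDiag_congr hs hs' fun k => by rw [mul_pow, mul_pow, hdd]) (by
      simp only [htr, ← Finset.mul_sum, mul_assoc]
      exact h.mul_of_bound (c := fun _ => c) (Eventually.of_forall fun _ => le_rfl))
  simpa only [htr, ← Finset.mul_sum, mul_assoc] using key

/-- The diagonals `(1, 1, 0, …)` and `(1, -1, 0, …)` have the same even traces. The second has trace
zero and the first trace `2`, so twice the normalized trace of `U` is negligible. -/
theorem tendstoZeroInProb_mean (hμ : ∀ N, OrthInvariant (μ N)) (hr : RadialLawTendsto μ ν)
    (hq : QuarticNegligible μ) {φ : (ℕ → ℝ) → ℂ}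
    (hφ : ∀ J : SymMatInf, Tendsto (fun N : ℕ =>
      ∫ U, Complex.exp (Complex.I * ((J.corner N).pair U : ℂ)) ∂(μ N)) atTop
        (𝓝 (φ J.evenTraces))) : TendstoZeroInProb μ fun _N U => U.mean := by
  set d : ℕ → ℝ := fun k => if k < 2 then 1 else 0 with hd
  set d' : ℕ → ℝ := fun k => if k = 0 then 1 else if k = 1 then -1 else 0 with hd'
  have hsum : ∀ (e : ℕ → ℝ), (∀ k, 2 ≤ k → e k = 0) → ∀ N, 2 ≤ N →
      ∑ k ∈ Finset.range N, e k = e 0 + e 1 := by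
    intro e he N hN
    rw [← Finset.sum_subset (Finset.range_mono hN) fun k _ hk => he k (by
      rw [Finset.mem_range] at hk
      omega)]
    simp [Finset.sum_range_succ]
  have hd0 : ∀ k, 2 ≤ k → d k = 0 := fun k hk => if_neg (by omega)
  have hd0' : ∀ k, 2 ≤ k → d' k = 0 := fun k hk => by
    simp only [hd', if_neg (show k ≠ 0 by omega), if_neg (show k ≠ 1 by omega)]
  have h := tendstoZeroInProb_sum_mul_mean hμ hr hq hφ (d := d) (d' := d')
    (summable_of_ne_finset_zero (s := Finset.range 2) fun k hk => by
      rw [hd0 k (by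
        rw [Finset.mem_range] at hk
        omega)]
      norm_num)
    (fun k => by
      simp only [hd, hd']
      split_ifs <;> first | omega | norm_num)
    (fun ε hε => by
      refine tendsto_const_nhds.congr' ?_
      filter_upwards [eventually_ge_atTop 2] with N hN
      rw [hsum d' hd0' N hN]
      simp [hd', hε.not_gt])
  have h2 := h.mul_of_bound (c := fun _ => 1 / 2) (Eventually.of_forall fun _ => le_rfl)
  intro ε hε
  refine (h2 ε hε).congr' ?_
  filter_upwards [eventually_ge_atTop 2] with N hN
  rw [hsum d hd0 N hN]
  norm_num [hd, ← mul_assoc]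

/-- The partial traces of `J` may be unbounded. With the greedy signs they are bounded, so
negligibility of the normalized trace of `U` suffices for them, and the sign comparison returns to
`J`. -/
theorem tendstoZeroInProb_trace_mul_mean (hμ : ∀ N, OrthInvariant (μ N))
    (hr : RadialLawTendsto μ ν) (hq : QuarticNegligible μ) {φ : (ℕ → ℝ) → ℂ}
    (hφ : ∀ J : SymMatInf, Tendsto (fun N : ℕ =>
      ∫ U, Complex.exp (Complex.I * ((J.corner N).pair U : ℂ)) ∂(μ N)) atTop (𝓝 (φ J.evenTraces)))
    (J : SymMatInf) : TendstoZeroInProb μ fun N U => (J.corner N).1.trace * U.mean := by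
  simp only [SymMatInf.trace_corner]
  have hs := J.summable_sq_diag
  obtain ⟨B, hB⟩ : ∃ B : ℝ, ∀ k, |J.1 k k| ≤ B := by
    refine ⟨√(∑' k, J.1 k k ^ 2), fun k => Real.le_sqrt_of_sq_le ?_⟩
    rw [sq_abs]
    exact hs.le_tsum k fun _ _ => sq_nonneg _
  refine tendstoZeroInProb_sum_mul_mean hμ hr hq hφ hs
    (fun k => (sq_greedySum_succ_sub (fun k => J.1 k k) k).symm) ?_
  simp only [Finset.sum_range_sub]
  refine (tendstoZeroInProb_mean hμ hr hq hφ).mul_of_bound (C := B)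
    (Eventually.of_forall fun N => ?_)
  simpa [greedySum] using abs_greedySum_le hB N

/-- The limiting characteristic function is the Laplace transform of the radial law. -/
theorem limit_charFun_eq_laplace (hμ : ∀ N, OrthInvariant (μ N))
    (hr : RadialLawTendsto μ ν) (hq : QuarticNegligible μ) {φ : (ℕ → ℝ) → ℂ}
    (hφ : ∀ J : SymMatInf, Tendsto (fun N : ℕ =>
      ∫ U, Complex.exp (Complex.I * ((J.corner N).pair U : ℂ)) ∂(μ N)) atTop (𝓝 (φ J.evenTraces)))
    (J : SymMatInf) : φ J.evenTraces = ((∫ b, Real.exp (-b * J.trPow 2) ∂ν : ℝ) : ℂ) := by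
  set t := J.trPow 2 with ht
  have ht0 : 0 ≤ t := J.trPow_two_nonneg
  set τ : ℕ → ℝ := fun N => (J.corner N).1.trace with hτ
  set b : (N : ℕ) → SymMat N → ℝ := fun N U => U.trPow 2 / ((N : ℝ) * ((N : ℝ) + 1)) with hb
  set β : (N : ℕ) → SymMat N → ℝ := fun N U => U.dev.trPow 2 / (N : ℝ) ^ 2 with hβ
  have hb0 : ∀ N U, 0 ≤ b N U := fun N U => div_nonneg U.trPow_two_nonneg (by positivity)
  have hβ0 : ∀ N U, 0 ≤ β N U := fun N U => div_nonneg U.dev.trPow_two_nonneg (by positivity)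
  have hbc : ∀ N, Continuous (b N) := fun N => (SymMat.continuous_trPow 2).div_const _
  have hβc : ∀ N, Continuous (β N) := fun N =>
    ((SymMat.continuous_trPow 2).comp SymMat.continuous_dev).div_const _
  have hmc : ∀ N, Continuous fun U : SymMat N => U.mean := fun N => SymMat.continuous_mean
  have hτm := tendstoZeroInProb_trace_mul_mean hμ hr hq hφ J
  have hm := tendstoZeroInProb_mean hμ hr hq hφ
  have hβb : TendstoZeroInProb μ fun N U => t * (β N U - b N U) := by
    refine TendstoZeroInProb.mul_of_bound (c := fun _ => t) ?_ (Eventually.of_forall fun _ => le_rfl)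
    refine TendstoZeroInProb.of_eventually_le fun ε hε η hη => ?_
    obtain ⟨M, hM0, hM⟩ := hr.tight (show 0 < η / 2 by positivity)
    have hlim : Tendsto (fun N : ℕ => (M + 1) / (N : ℝ)) atTop (𝓝 0) :=
      tendsto_const_div_atTop_nhds_zero_nat _
    filter_upwards [hM, (hm 1 one_pos).eventually (gt_mem_nhds (show 0 < η / 2 by positivity)),
      hlim.eventually (gt_mem_nhds hε), eventually_gt_atTop 0] with N h1 h2 h3 hN
    have hN' : (0 : ℝ) < N := by exact_mod_cast hN
    refine (measureReal_mono (fun U hU => ?_)).trans ((measureReal_union_le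
      {U : SymMat N | M * (N : ℝ) ^ 2 < U.trPow 2} {U : SymMat N | 1 < |U.mean|}).trans
      (by linarith))
    by_contra hcon
    simp only [Set.mem_union, Set.mem_ofPred_eq, not_or, not_lt] at hcon
    obtain ⟨h4, h5⟩ := hcon
    -- The two normalizations `N²` and `N (N + 1)`, and the removal of the mean, differ by a term of
    -- order `1/N` once `b` and the mean are bounded.
    have e : β N U - b N U = (b N U - U.mean ^ 2) / N := by
      simp only [hβ, hb]
      rw [SymMat.trPow_two_dev hN]
      field_simp
      ring
    have h6 : b N U ≤ M := by
      rw [hb, div_le_iff₀ (by positivity)]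
      refine h4.trans ?_
      nlinarith
    have h7 : U.mean ^ 2 ≤ 1 := by
      rw [← sq_abs]
      nlinarith [abs_nonneg U.mean]
    have h8 : |β N U - b N U| ≤ (M + 1) / N := by
      rw [e, abs_div, abs_of_pos hN']
      gcongr
      rw [abs_le]
      constructor <;> linarith [hb0 N U, sq_nonneg U.mean]
    exact absurd hU (not_lt.2 (h8.trans h3.le))
  have h1 := tendsto_charFun_sub_mixture hμ hr hq J
  set E : (N : ℕ) → SymMat N → ℂ := fun N U =>
    Complex.exp (((-(β N U * t) : ℝ) : ℂ) + Complex.I * ((τ N * U.mean : ℝ) : ℂ)) with hE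
  set F : (N : ℕ) → SymMat N → ℂ := fun N U => ((Real.exp (-(β N U * t)) : ℝ) : ℂ) with hF
  set G : (N : ℕ) → SymMat N → ℂ := fun N U => ((Real.exp (-(b N U * t)) : ℝ) : ℂ) with hG
  replace h1 : Tendsto (fun N : ℕ =>
      ∫ U, Complex.exp (Complex.I * ((J.corner N).pair U : ℂ)) ∂(μ N) - ∫ U, E N U ∂(μ N))
      atTop (𝓝 0) := h1
  have hexp : ∀ x : ℝ, 0 ≤ x → Real.exp (-(x * t)) ≤ 1 := fun x hx => by
    rw [Real.exp_le_one_iff, neg_nonpos]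
    exact mul_nonneg hx ht0
  have hE1 : ∀ N U, ‖E N U‖ ≤ 1 := fun N U => by
    rw [hE, norm_exp_ofReal_add_I_mul]
    exact hexp _ (hβ0 N U)
  have hF1 : ∀ N U, ‖F N U‖ ≤ 1 := fun N U => by
    rw [hF, Complex.norm_real, Real.norm_eq_abs, abs_of_pos (Real.exp_pos _)]
    exact hexp _ (hβ0 N U)
  have hG1 : ∀ N U, ‖G N U‖ ≤ 1 := fun N U => by
    rw [hG, Complex.norm_real, Real.norm_eq_abs, abs_of_pos (Real.exp_pos _)]
    exact hexp _ (hb0 N U)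
  have hEi : ∀ N, Integrable (E N) (μ N) := fun N => by
    have c1 := hβc N
    have c2 := hmc N
    have : Continuous (E N) := by fun_prop
    exact Integrable.of_bound this.aestronglyMeasurable 1 (ae_of_all _ (hE1 N))
  have hFi : ∀ N, Integrable (F N) (μ N) := fun N => by
    have c1 := hβc N
    have : Continuous (F N) := by fun_prop
    exact Integrable.of_bound this.aestronglyMeasurable 1 (ae_of_all _ (hF1 N))
  have hGi : ∀ N, Integrable (G N) (μ N) := fun N => by
    have c1 := hbc N
    have : Continuous (G N) := by fun_prop
    exact Integrable.of_bound this.aestronglyMeasurable 1 (ae_of_all _ (hG1 N))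
  have h2 : Tendsto (fun N => ∫ U, (E N U - F N U) ∂(μ N)) atTop (𝓝 0) := by
    refine hτm.tendsto_integral (fun N => ((hmc N).measurable.const_mul _)) (C := 2)
      (fun N U => (norm_sub_le _ _).trans (by linarith [hE1 N U, hF1 N U]))
      (Eventually.of_forall fun N U => ?_)
    simp only [hE, hF]
    rw [Complex.exp_add, ← Complex.ofReal_exp, ← mul_sub_one, norm_mul, Complex.norm_real,
      Real.norm_eq_abs, abs_of_pos (Real.exp_pos _)]
    exact (mul_le_of_le_one_left (norm_nonneg _) (hexp _ (hβ0 N U))).trans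
      Real.norm_exp_I_mul_ofReal_sub_one_le
  have h3 : Tendsto (fun N => ∫ U, (F N U - G N U) ∂(μ N)) atTop (𝓝 0) := by
    refine hβb.tendsto_integral
      (fun N => (((hβc N).sub (hbc N)).measurable.const_mul _)) (C := 2)
      (fun N U => (norm_sub_le _ _).trans (by linarith [hF1 N U, hG1 N U]))
      (Eventually.of_forall fun N U => ?_)
    simp only [hF, hG]
    rw [← Complex.ofReal_sub, Complex.norm_real]
    refine (abs_exp_neg_sub_le (mul_nonneg (hβ0 N U) ht0) (mul_nonneg (hb0 N U) ht0)).trans_eq ?_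
    change _ = |t * (β N U - b N U)|
    rw [← sub_mul, mul_comm]
  have h4 : Tendsto (fun N => ∫ U, G N U ∂(μ N)) atTop
      (𝓝 ((∫ b, Real.exp (-b * t) ∂ν : ℝ) : ℂ)) := by
    -- The exponential is unbounded on the negative half-line; replacing `b` by `max 0 b` changes
    -- nothing, as both the finite laws and `ν` are carried by `b ≥ 0`.
    set f : BoundedContinuousFunction ℝ ℝ := BoundedContinuousFunction.ofNormedAddCommGroup
      (fun b => Real.exp (-(max 0 b * t))) (by fun_prop) 1 fun b => by
        rw [Real.norm_eq_abs, abs_of_pos (Real.exp_pos _)]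
        exact hexp _ (le_max_left _ _) with hf
    have h5 := (Complex.continuous_ofReal.tendsto _).comp (hr f)
    have h6 : ∫ b, f b ∂ν = ∫ b, Real.exp (-b * t) ∂ν := by
      refine integral_congr_ae (hr.ae_nonneg.mono fun b hb => ?_)
      change Real.exp (-(max 0 b * t)) = _
      simp only [max_eq_right hb, neg_mul]
    rw [h6] at h5
    refine h5.congr fun N => ?_
    simp only [Function.comp_apply, hG]
    rw [integral_complex_ofReal]
    congr 1
    refine integral_congr_ae (Eventually.of_forall fun U => ?_)
    change Real.exp (-(max 0 (b N U) * t)) = _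
    rw [max_eq_right (hb0 N U)]
  refine tendsto_nhds_unique (hφ J) ?_
  have h5 := ((h1.add h2).add h3).add h4
  simp only [zero_add] at h5
  refine h5.congr fun N => ?_
  rw [integral_sub (hEi N) (hFi N), integral_sub (hFi N) (hGi N)]
  ring

end Limit

/-! ### Lévy–Khintchine on the half-line -/

section Laplace

/-- Both `1 - exp (-bt)` and `t (1 - exp (-b))` agree with `bt` to first order, so their difference
belongs to the test functions that do not see the origin. -/
theorem one_sub_exp_neg_sub_le_sq {b t : ℝ} (hb : 0 ≤ b) (ht : 0 ≤ t) :
    |1 - Real.exp (-b * t) - t * (1 - Real.exp (-b))| ≤ (t + t ^ 2) * b ^ 2 := by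
  have h : ∀ x : ℝ, 0 ≤ x → 1 - Real.exp (-x) ≤ x ∧ x - x ^ 2 ≤ 1 - Real.exp (-x) := by
    intro x hx
    have h1 := Real.one_sub_le_exp_neg x
    refine ⟨by linarith, ?_⟩
    have h2 : Real.exp (-x) ≤ 1 / (1 + x) := by
      rw [Real.exp_neg, ← one_div]
      exact one_div_le_one_div_of_le (by linarith) (by linarith [Real.add_one_le_exp x])
    have h3 : 1 / (1 + x) ≤ 1 - x + x ^ 2 := by
      rw [div_le_iff₀ (by linarith)]
      nlinarith [pow_nonneg hx 3]
    linarith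
  obtain ⟨h1, h2⟩ := h (b * t) (mul_nonneg hb ht)
  obtain ⟨h3, h4⟩ := h b hb
  rw [neg_mul, abs_le]
  constructor
  · nlinarith [mul_le_mul_of_nonneg_left h3 ht, mul_nonneg ht (sq_nonneg b)]
  · nlinarith [mul_le_mul_of_nonneg_left h4 ht, mul_nonneg (sq_nonneg t) (sq_nonneg b)]

theorem integrable_exp_neg_mul {ν : Measure ℝ} [IsProbabilityMeasure ν] (hν : ∀ᵐ b ∂ν, 0 ≤ b)
    {t : ℝ} (ht : 0 ≤ t) : Integrable (fun b => Real.exp (-b * t)) ν := by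
  refine Integrable.of_bound (Continuous.aestronglyMeasurable (by fun_prop)) 1 ?_
  filter_upwards [hν] with b hb
  rw [Real.norm_eq_abs, abs_of_pos (Real.exp_pos _), Real.exp_le_one_iff]
  nlinarith

variable {ν : ℝ → Measure ℝ} {σ : Measure ℝ} {ℓ : ℝ → ℝ}

theorem integral_one_sub_exp_neg_mul (hp : ∀ Δ : ℝ, 0 < Δ → IsProbabilityMeasure (ν Δ))
    (hν : ∀ Δ : ℝ, 0 < Δ → ∀ᵐ b ∂(ν Δ), 0 ≤ b)
    (hℓ : ∀ Δ : ℝ, 0 < Δ → ∀ t : ℝ, 0 ≤ t → Real.exp (-Δ * ℓ t) = ∫ b, Real.exp (-b * t) ∂(ν Δ))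
    {Δ : ℝ} (hΔ : 0 < Δ) {t : ℝ} (ht : 0 ≤ t) :
    ∫ b, (1 - Real.exp (-b * t)) ∂(ν Δ) = 1 - Real.exp (-Δ * ℓ t) := by
  have := hp Δ hΔ
  rw [integral_sub (integrable_const 1) (integrable_exp_neg_mul (hν Δ hΔ) ht), hℓ Δ hΔ t ht]
  simp

theorem tendsto_laplace_exponent_zero (hp : ∀ Δ : ℝ, 0 < Δ → IsProbabilityMeasure (ν Δ))
    (hν : ∀ Δ : ℝ, 0 < Δ → ∀ᵐ b ∂(ν Δ), 0 ≤ b)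
    (hℓ : ∀ Δ : ℝ, 0 < Δ → ∀ t : ℝ, 0 ≤ t →
      Real.exp (-Δ * ℓ t) = ∫ b, Real.exp (-b * t) ∂(ν Δ)) :
    Tendsto ℓ (𝓝[>] 0) (𝓝 0) := by
  have := hp 1 one_pos
  have h : Tendsto (fun t => ∫ b, Real.exp (-b * t) ∂(ν 1)) (𝓝[>] 0) (𝓝 (∫ _b, 1 ∂(ν 1))) := by
    refine tendsto_integral_filter_of_dominated_convergence (fun _ => 1)
      (Eventually.of_forall fun t => Continuous.aestronglyMeasurable (by fun_prop)) ?_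
      (integrable_const 1) (ae_of_all _ fun b => ?_)
    · filter_upwards [self_mem_nhdsWithin] with t ht
      filter_upwards [hν 1 one_pos] with b hb
      have ht' : (0 : ℝ) < t := ht
      rw [Real.norm_eq_abs, abs_of_pos (Real.exp_pos _), Real.exp_le_one_iff]
      nlinarith
    · have hc : Tendsto (fun t : ℝ => Real.exp (-b * t)) (𝓝[>] 0) (𝓝 (Real.exp (-b * 0))) :=
        (Continuous.tendsto (by fun_prop) 0).mono_left nhdsWithin_le_nhds
      simpa using hc
  have h1 : ∫ _b, (1 : ℝ) ∂(ν 1) = 1 := by simp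
  rw [h1] at h
  have h2 := (h.log one_ne_zero).neg
  rw [Real.log_one, neg_zero] at h2
  refine h2.congr' ?_
  filter_upwards [self_mem_nhdsWithin] with t ht
  rw [← hℓ 1 one_pos t (le_of_lt ht), Real.log_exp]
  ring

/-- The weight `b / (1 + b)` is at most `1 - exp (-b)`, which gives the bound with constant `ℓ 1`.
For the tails, `1 - exp (-bt)` is at least `1 - exp (-1)` beyond `1/t`, and `ℓ t` is small for small
`t`. -/
theorem levyFamily_of_laplace (hp : ∀ Δ : ℝ, 0 < Δ → IsProbabilityMeasure (ν Δ))
    (hν : ∀ Δ : ℝ, 0 < Δ → ∀ᵐ b ∂(ν Δ), 0 ≤ b)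
    (hℓ : ∀ Δ : ℝ, 0 < Δ → ∀ t : ℝ, 0 ≤ t → Real.exp (-Δ * ℓ t) = ∫ b, Real.exp (-b * t) ∂(ν Δ))
    (hσ : SmallVolumeLimit (fun b : ℝ => b) ν σ) : LevyFamily (fun b : ℝ => b) ν σ where
  continuous := continuous_id
  isCompact ε R _ := isCompact_Icc
  prob := hp
  nonneg := hν
  limit := hσ
  bound := by
    refine ⟨ℓ 1, fun Δ hΔ => ?_⟩
    have := hp Δ hΔ
    have h1 := integral_one_sub_exp_neg_mul hp hν hℓ hΔ zero_le_one
    have h2 := one_sub_exp_neg_mul_le Δ (ℓ 1)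
    have h3 : ∫ b, b / (1 + b) ∂(ν Δ) ≤ ∫ b, (1 - Real.exp (-b * 1)) ∂(ν Δ) := by
      refine integral_mono_of_nonneg ((hν Δ hΔ).mono fun b hb => ?_)
        ((integrable_const 1).sub (integrable_exp_neg_mul (hν Δ hΔ) zero_le_one))
        ((hν Δ hΔ).mono fun b hb => ?_)
      · exact div_nonneg hb (by linarith)
      · have h4 : Real.exp (-b * 1) ≤ 1 / (1 + b) := by
          rw [mul_one, Real.exp_neg, ← one_div]
          exact one_div_le_one_div_of_le (by linarith) (by linarith [Real.add_one_le_exp b])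
        have h5 : b / (1 + b) = 1 - 1 / (1 + b) := by
          field_simp
          ring
        change b / (1 + b) ≤ 1 - Real.exp (-b * 1)
        linarith
    linarith
  tail := by
    intro η hη
    have hc : (0 : ℝ) < 1 - Real.exp (-1) := by
      have := Real.exp_lt_exp.2 (show (-1 : ℝ) < 0 by norm_num)
      rw [Real.exp_zero] at this
      linarith
    obtain ⟨t, ht1, ht⟩ := (((tendsto_laplace_exponent_zero hp hν hℓ).eventually
      (gt_mem_nhds (mul_pos hη hc))).and self_mem_nhdsWithin).exists
    have ht' : (0 : ℝ) < t := ht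
    refine ⟨1 / t, fun Δ hΔ => ?_⟩
    have := hp Δ hΔ
    have h1 := integral_one_sub_exp_neg_mul hp hν hℓ hΔ ht'.le
    have h2 := one_sub_exp_neg_mul_le Δ (ℓ t)
    have hm : MeasurableSet {b : ℝ | 1 / t < b} := measurableSet_Ioi
    have h3 : ∫ b, {b : ℝ | 1 / t < b}.indicator (fun _ => 1 - Real.exp (-1)) b ∂(ν Δ) ≤
        ∫ b, (1 - Real.exp (-b * t)) ∂(ν Δ) := by
      refine integral_mono_ae ((integrable_const _).indicator hm)
        ((integrable_const 1).sub (integrable_exp_neg_mul (hν Δ hΔ) ht'.le))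
        ((hν Δ hΔ).mono fun b hb => ?_)
      by_cases hbt : b ∈ {b : ℝ | 1 / t < b}
      · rw [Set.indicator_of_mem hbt]
        have h4 : 1 < b * t := (div_lt_iff₀ ht').1 hbt
        have h5 : Real.exp (-b * t) ≤ Real.exp (-1) := Real.exp_le_exp.2 (by linarith)
        change 1 - Real.exp (-1) ≤ 1 - Real.exp (-b * t)
        linarith
      · rw [Set.indicator_of_notMem hbt]
        have h5 : Real.exp (-b * t) ≤ 1 := Real.exp_le_one_iff.2 (by nlinarith)
        change 0 ≤ 1 - Real.exp (-b * t)
        linarith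
    rw [integral_indicator hm, setIntegral_const, smul_eq_mul] at h3
    have h6 : (ν Δ).real {b : ℝ | 1 / t < b} * (1 - Real.exp (-1)) ≤
        η * Δ * (1 - Real.exp (-1)) := by nlinarith
    exact le_of_mul_le_mul_right h6 hc

/-- The Lévy–Khintchine formula for Laplace exponents. -/
theorem levy_khintchine_laplace (hp : ∀ Δ : ℝ, 0 < Δ → IsProbabilityMeasure (ν Δ))
    (hν : ∀ Δ : ℝ, 0 < Δ → ∀ᵐ b ∂(ν Δ), 0 ≤ b)
    (hℓ : ∀ Δ : ℝ, 0 < Δ → ∀ t : ℝ, 0 ≤ t → Real.exp (-Δ * ℓ t) = ∫ b, Real.exp (-b * t) ∂(ν Δ))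
    (hσ : SmallVolumeLimit (fun b : ℝ => b) ν σ) :
    IntegrableOn (fun b : ℝ => b / (1 + b)) (Set.Ioi 0) σ ∧ ∃ a : ℝ, 0 ≤ a ∧ ∀ t : ℝ, 0 ≤ t →
      IntegrableOn (fun b : ℝ => 1 - Real.exp (-b * t)) (Set.Ioi 0) σ ∧
      ℓ t = a * t + ∫ b in Set.Ioi (0 : ℝ), (1 - Real.exp (-b * t)) ∂σ := by
  have h := levyFamily_of_laplace hp hν hℓ hσ
  have hc : ∀ t : ℝ, Continuous fun b : ℝ => 1 - Real.exp (-b * t) := fun t => by fun_prop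
  have hψ0 : ∀ t : ℝ, 0 ≤ t → ∀ b : ℝ, 0 ≤ b → 0 ≤ 1 - Real.exp (-b * t) := fun t ht b hb => by
    have : Real.exp (-b * t) ≤ 1 := Real.exp_le_one_iff.2 (by nlinarith)
    linarith
  have hψ1 : ∀ t b : ℝ, 1 - Real.exp (-b * t) ≤ 1 := fun t b => by
    linarith [Real.exp_pos (-b * t)]
  have hψw : ∀ t : ℝ, 0 ≤ t → ∀ b : ℝ, 0 ≤ b →
      1 - Real.exp (-b * t) ≤ (1 + t) * (b / (1 + b)) := fun t ht b hb => by
    have h1 := Real.one_sub_le_exp_neg (b * t)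
    have h2 := hψ1 t b
    rw [← neg_mul] at h1
    rw [← mul_div_assoc, le_div_iff₀ (by linarith)]
    nlinarith
  have hint : ∀ t : ℝ, 0 ≤ t →
      IntegrableOn (fun b : ℝ => 1 - Real.exp (-b * t)) {b | 0 < b} σ := fun t ht =>
    h.integrableOn_of_le (hc t) fun b hb => by
      rw [abs_of_nonneg (hψ0 t ht b hb)]
      exact hψw t ht b hb
  have hlim : ∀ t : ℝ, 0 ≤ t →
      Tendsto (fun Δ : ℝ => Δ⁻¹ * ∫ b, (1 - Real.exp (-b * t)) ∂(ν Δ)) (𝓝[>] 0) (𝓝 (ℓ t)) := by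
    intro t ht
    refine (tendsto_inv_mul_one_sub_exp (ℓ t)).congr' ?_
    filter_upwards [self_mem_nhdsWithin] with Δ hΔ
    rw [integral_one_sub_exp_neg_mul hp hν hℓ hΔ ht]
  refine ⟨h.integrableOn_weight, ℓ 1 - ∫ b in Set.Ioi (0 : ℝ), (1 - Real.exp (-b * 1)) ∂σ,
    sub_nonneg.2 (h.integral_le_of_tendsto (hc 1) (hψ0 1 zero_le_one) (hψw 1 zero_le_one)
      (hlim 1 zero_le_one)), fun t ht => ⟨hint t ht, ?_⟩⟩
  -- This combination passes to the limit exactly, so the defect between `ℓ` and its `σ`-integral is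
  -- linear in `t`, with slope its value at `t = 1`.
  have hdc : Continuous fun b : ℝ => 1 - Real.exp (-b * t) - t * (1 - Real.exp (-b * 1)) := by
    fun_prop
  have h1 := h.tendsto_of_le_sq hdc (C := 1 + t + t ^ 2) (fun b hb => by
      have g1 := hψ0 t ht b hb
      have g2 := hψ0 1 zero_le_one b hb
      have g3 := hψ1 t b
      have g4 := hψ1 1 b
      rw [abs_le]
      constructor <;> nlinarith)
    (fun b hb => by
      rw [mul_one]
      refine (one_sub_exp_neg_sub_le_sq hb ht).trans ?_
      nlinarith [sq_nonneg b])
  have h2 := (hlim t ht).sub ((hlim 1 zero_le_one).const_mul t)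
  have h3 := tendsto_nhds_unique (h2.congr' ?_) h1
  swap
  · filter_upwards [self_mem_nhdsWithin] with Δ hΔ
    have hΔ' : (0 : ℝ) < Δ := hΔ
    have := hp Δ hΔ'
    have i1 : Integrable (fun b : ℝ => 1 - Real.exp (-b * t)) (ν Δ) :=
      (integrable_const 1).sub (integrable_exp_neg_mul (hν Δ hΔ') ht)
    have i2 : Integrable (fun b : ℝ => t * (1 - Real.exp (-b * 1))) (ν Δ) :=
      ((integrable_const 1).sub (integrable_exp_neg_mul (hν Δ hΔ') zero_le_one)).const_mul t
    rw [integral_sub i1 i2, integral_const_mul]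
    ring
  rw [integral_sub (hint t ht) ((hint 1 zero_le_one).const_mul t), integral_const_mul] at h3
  change _ = _ + ∫ b in {b : ℝ | 0 < b}, _ ∂σ
  change _ = (ℓ 1 - ∫ b in {b : ℝ | 0 < b}, (1 - Real.exp (-b * 1)) ∂σ) * t + _
  linarith

end Laplace

/-! ### The formula at infinite `N` -/

theorem levy_khintchine_limit (L : (ℕ → ℝ) → ℂ) (μ : ℝ → (N : ℕ) → Measure (SymMat N))
    (ν : ℝ → Measure ℝ) (σ : Measure ℝ)
    (hp : ∀ Δ : ℝ, 0 < Δ → ∀ N : ℕ, IsProbabilityMeasure (μ Δ N))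
    (hO : ∀ Δ : ℝ, 0 < Δ → ∀ N : ℕ, OrthInvariant (μ Δ N))
    (hν : ∀ Δ : ℝ, 0 < Δ → IsProbabilityMeasure (ν Δ))
    (hr : ∀ Δ : ℝ, 0 < Δ → RadialLawTendsto (μ Δ) (ν Δ))
    (hq : ∀ Δ : ℝ, 0 < Δ → QuarticNegligible (μ Δ)) (hL : IsLimitExponent L μ)
    (hσ : SmallVolumeLimit (fun b : ℝ => b) ν σ) :
    IntegrableOn (fun b : ℝ => b / (1 + b)) (Set.Ioi 0) σ ∧
      ∃ a : ℝ, 0 ≤ a ∧ ∀ J : SymMatInf,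
        IntegrableOn (fun b : ℝ => 1 - Real.exp (-b * J.trPow 2)) (Set.Ioi 0) σ ∧
        L J.evenTraces =
          ((a * J.trPow 2 +
            ∫ b in Set.Ioi (0 : ℝ), (1 - Real.exp (-b * J.trPow 2)) ∂σ : ℝ) : ℂ) := by
  have key : ∀ Δ : ℝ, 0 < Δ → ∀ J : SymMatInf, Complex.exp (-(Δ : ℂ) * L J.evenTraces) =
      ((∫ b, Real.exp (-b * J.trPow 2) ∂(ν Δ) : ℝ) : ℂ) := by
    intro Δ hΔ J
    have := hp Δ hΔ
    have := hν Δ hΔ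
    exact limit_charFun_eq_laplace (hO Δ hΔ) (hr Δ hΔ) (hq Δ hΔ)
      (φ := fun e => Complex.exp (-(Δ : ℂ) * L e)) (hL Δ hΔ) J
  have him : ∀ J : SymMatInf, (L J.evenTraces).im = 0 := fun J =>
    im_eq_zero_of_exp_neg_mul fun Δ hΔ => by rw [key Δ hΔ J, Complex.ofReal_im]
  have hre : ∀ J : SymMatInf, (((L J.evenTraces).re : ℝ) : ℂ) = L J.evenTraces := fun J =>
    Complex.ext (Complex.ofReal_re _) (by rw [Complex.ofReal_im, him])
  have hexp : ∀ Δ : ℝ, 0 < Δ → ∀ J : SymMatInf, Real.exp (-Δ * (L J.evenTraces).re) =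
      ∫ b, Real.exp (-b * J.trPow 2) ∂(ν Δ) := by
    intro Δ hΔ J
    have h := key Δ hΔ J
    rw [← hre J] at h
    have e : -(Δ : ℂ) * (((L J.evenTraces).re : ℝ) : ℂ) =
        ((-Δ * (L J.evenTraces).re : ℝ) : ℂ) := by
      push_cast
      ring
    rw [e, ← Complex.ofReal_exp] at h
    exact_mod_cast h
  have hsum : ∀ t : ℝ, Summable fun k => (Pi.single 0 √t : ℕ → ℝ) k ^ 2 := fun t =>
    summable_of_ne_finset_zero (s := {0}) fun k hk => by
      rw [Pi.single_eq_of_ne (by simpa using hk)]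
      norm_num
  -- A single diagonal entry `√t` realizes every value `t ≥ 0` of `tr J²`, which turns `L` into a
  -- function on the half-line.
  set D : ℝ → SymMatInf := fun t => SymMatInf.ofDiag (Pi.single 0 √t) (hsum t) with hD
  have hDt : ∀ t : ℝ, 0 ≤ t → (D t).trPow 2 = t := fun t ht => by
    rw [hD, SymMatInf.trPow_ofDiag, tsum_eq_single 0 fun k hk => by
      rw [Pi.single_eq_of_ne hk]
      norm_num, Pi.single_eq_same, Real.sq_sqrt ht]
  -- The Laplace transform depends on `J` only through `tr J²`, and so does `L` by injectivity of
  -- the real exponential; the higher traces drop out.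
  have hℓ : ∀ J : SymMatInf, (L J.evenTraces).re = (L (D (J.trPow 2)).evenTraces).re := by
    intro J
    have h1 := hexp 1 one_pos J
    have h2 := hexp 1 one_pos (D (J.trPow 2))
    rw [hDt _ J.trPow_two_nonneg, ← h1] at h2
    have h3 := Real.exp_injective h2
    linarith
  obtain ⟨hw, a, ha, h⟩ := levy_khintchine_laplace (ℓ := fun t => (L (D t).evenTraces).re) hν
    (fun Δ hΔ => by
      have := hp Δ hΔ
      have := hν Δ hΔ
      exact (hr Δ hΔ).ae_nonneg)
    (fun Δ hΔ t ht => by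
      have h := hexp Δ hΔ (D t)
      rwa [hDt t ht] at h) hσ
  refine ⟨hw, a, ha, fun J => ?_⟩
  obtain ⟨h1, h2⟩ := h _ J.trPow_two_nonneg
  refine ⟨h1, ?_⟩
  rw [← hre J, hℓ J, h2]

theorem theorem1 :
    -- finite `N`
    (∀ (N : ℕ) (L : (ℕ → ℝ) → ℂ) (μ : ℝ → Measure (SymMat N)) (σ : Measure (SymMat N)),
      (∀ Δ : ℝ, 0 < Δ → IsProbabilityMeasure (μ Δ)) →
      (∀ Δ : ℝ, 0 < Δ → OrthInvariant (μ Δ)) →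
      IsExponent L μ →
      SmallVolumeLimit (fun U : SymMat N => U.trPow 2) μ σ →
      OrthInvariant (σ.restrict {U : SymMat N | 0 < U.trPow 2}) ∧
      IntegrableOn (fun U : SymMat N => U.trPow 2 / (1 + U.trPow 2))
        {U : SymMat N | 0 < U.trPow 2} σ ∧
      ∃ a : ℝ, 0 ≤ a ∧ ∀ J : SymMat N,
        IntegrableOn (fun U : SymMat N => 1 - Real.cos (J.pair U))
          {U : SymMat N | 0 < U.trPow 2} σ ∧
        L J.evenTraces =
          ((a * J.trPow 2 +
            ∫ U in {U : SymMat N | 0 < U.trPow 2}, (1 - Real.cos (J.pair U)) ∂σ : ℝ) : ℂ) ∧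
        (∀ ε : ℝ, 0 < ε →
          IntegrableOn (fun U : SymMat N => 1 - Complex.exp (Complex.I * (J.pair U : ℂ)))
            {U : SymMat N | ε < U.trPow 2} σ) ∧
        Tendsto (fun ε : ℝ => ((a * J.trPow 2 : ℝ) : ℂ) +
            ∫ U in {U : SymMat N | ε < U.trPow 2},
              (1 - Complex.exp (Complex.I * (J.pair U : ℂ))) ∂σ)
          (𝓝[>] 0) (𝓝 (L J.evenTraces))) ∧
    -- `N = ∞`
    (∀ (L : (ℕ → ℝ) → ℂ) (μ : ℝ → (N : ℕ) → Measure (SymMat N)) (ν : ℝ → Measure ℝ)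
        (σ : Measure ℝ),
      (∀ Δ : ℝ, 0 < Δ → ∀ N : ℕ, IsProbabilityMeasure (μ Δ N)) →
      (∀ Δ : ℝ, 0 < Δ → ∀ N : ℕ, OrthInvariant (μ Δ N)) →
      (∀ Δ : ℝ, 0 < Δ → IsProbabilityMeasure (ν Δ)) →
      (∀ Δ : ℝ, 0 < Δ → RadialLawTendsto (μ Δ) (ν Δ)) →
      (∀ Δ : ℝ, 0 < Δ → QuarticNegligible (μ Δ)) →
      IsLimitExponent L μ →
      SmallVolumeLimit (fun b : ℝ => b) ν σ →
      IntegrableOn (fun b : ℝ => b / (1 + b)) (Set.Ioi 0) σ ∧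
      ∃ a : ℝ, 0 ≤ a ∧ ∀ J : SymMatInf,
        IntegrableOn (fun b : ℝ => 1 - Real.exp (-b * J.trPow 2)) (Set.Ioi 0) σ ∧
        L J.evenTraces =
          ((a * J.trPow 2 +
            ∫ b in Set.Ioi (0 : ℝ), (1 - Real.exp (-b * J.trPow 2)) ∂σ : ℝ) : ℂ)) :=
  ⟨fun _ L μ σ hp hO hL hσ => levy_khintchine_finite L μ σ hp hO hL hσ,
    fun L μ ν σ hp hO hν hr hq hL hσ => levy_khintchine_limit L μ ν σ hp hO hν hr hq hL hσ⟩
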